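/- **Setting.** Let $\lambda$ be the security parameter. $\mathsf{Setup}(1^\lambda)$ returns parameters $(k,w,\delta,s,|\mathsf{seed}|)$ bounded by a polynomial in $\lambda$, with $k,s\ge 1$ and $w\le 2k$. For $\bm a\in\mathbb F_2^k$ let $\bm H=[\bm I_k\ \bm A]$ be the systematic quasi-cyclic $k\times 2k$ parity-check matrix with $\bm A$ the circulant matrix of $\bm a$; let $\mathsf{rot}_r$ be the cyclic shift by $r$ positions (in each block of length $k$), $\pi[\cdot]$ the action of $\pi\in S_{2k}$ on the coordinates of $\mathbb F_2^{2k}$, and $|\cdot|$ the Hamming weight. "$\bm a\leftarrow_\theta S$" means that $\bm a$ is computed from the seed $\theta$ by a deterministic polynomial-time algorithm; it is understood that permutations $\pi\in S_{2k}$ and vectors $\bm v\in\mathbb F_2^{2k}$ sampled from a uniformly random seed are computationally indistinguishable from uniformly random ones. $\mathsf{Com}(m;\rho)$ is a polynomial-time commitment scheme whose (possibly empty) string $\rho$ of coins is uniform and is revealed to open the commitment. It is *hiding* if for all probabilistic polynomial-time (PPT) adversaries (with auxiliary input of polynomial size) and every pair of messages $(m_0,m_1)$ (depending on $\lambda$,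 of the same, polynomially bounded, length), $|\Pr[b=b']-\frac12|$ is negligible, where $b$ is a uniform bit and $b'$ is the answer of the adversary to a commitment to $m_b$. $\mathsf{Compress}$ is any deterministic polynomial-time algorithm. "Computationally indistinguishable" is meant for PPT distinguishers with auxiliary input of polynomial size. **Keys.** $\phi_1,\phi_2\in\{0,1\}^{|\mathsf{seed}|}$ are uniform, $\bm H\leftarrow_{\phi_2}$ quasi-cyclic matrices, $(\bm x^1,\dots,\bm x^s)\leftarrow_{\phi_1}\{\bm x\in\mathbb F_2^{2k}:|\bm x|=w\}^s$, $\bm y^i=\bm H\bm x^i$; $\mathsf{sk}=\phi_1$ and $\mathsf{pk}=(\phi_2,\bm y^1,\dots,\bm y^s)$. **Optimized quasi-cyclic Stern protocol.** (1) For $i=1,\dots,\delta$ the prover draws uniform seeds $\theta_i,\xi_i$, sets $\pi_i\leftarrow_{\theta_i}S_{2k}$, $\bm v_i\leftarrow_{\xi_i}\mathbb F_2^{2k}$, $\bm u_i=\pi_i^{-1}[\bm v_i]$, $c_{i,1}=\mathsf{Com}(\pi_i\|\bm H\bm u_i)$, $c_{i,2}=\mathsf{Com}(\pi_i[\bm u_i])$,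 and sends $\mathsf{Cmt}_1=\mathsf{Com}(c_{1,1}\|c_{1,2}\|\cdots\|c_{\delta,1}\|c_{\delta,2})$. (2) The verifier sends $\mathsf{Ch}_1=((s_i,r_i))_i$, uniform with $s_i$ one of the $s$ indices and $r_i\in[0,k-1]$. (3) With $\bm x_i'=\mathsf{rot}_{r_i}(\bm x^{s_i})$ and $c_{i,3}=\mathsf{Com}(\pi_i[\bm u_i+\bm x_i'])$ the prover sends $\mathsf{Cmt}_2=\mathsf{Com}(c_{1,3}\|\cdots\|c_{\delta,3})$. (4) The verifier sends uniform bits $\mathsf{Ch}_2=(b_1,\dots,b_\delta)$. (5) The prover sends $\mathsf{Rsp}=\mathsf{Compress}(d_1,\dots,d_\delta)$, where $d_i=(\theta_i,\bm u_i+\bm x_i',c_{i,2})$ if $b_i=0$ and $d_i=(\xi_i,\pi_i[\bm x_i'],c_{i,1})$ if $b_i=1$, each $d_i$ together with the coins of the two commitments of iteration $i$ that the verifier recomputes, and the input of $\mathsf{Compress}$ together with the coins of $\mathsf{Cmt}_1,\mathsf{Cmt}_2$. The transcript is $(\mathsf{Cmt}_1,\mathsf{Ch}_1,\mathsf{Cmt}_2,\mathsf{Ch}_2,\mathsf{Rsp})$.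 **Theorem (Honest-Verifier Zero-Knowledge).** If the commitment scheme is hiding, then the optimized quasi-cyclic Stern protocol is honest-verifier zero-knowledge: there is a PPT simulator which, on input $1^\lambda$, the parameters $\mathsf{param}$ and the public key $\mathsf{pk}$ only, outputs transcripts that are computationally indistinguishable from those of honest executions between the prover with input $(\mathsf{param},\mathsf{sk},\mathsf{pk})$ and the verifier with input $(\mathsf{param},\mathsf{pk})$, for all $\mathsf{param}$ returned by $\mathsf{Setup}(1^\lambda)$ and all $(\mathsf{sk},\mathsf{pk})$ returned by key generation. -/

import Mathlib

namespace QCStern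

/-! ### Data, probabilistic programs and their running time -/

/-- The data on which programs work: finite binary trees. -/
inductive Val : Type where
  | nil : Val
  | node : Val → Val → Val

namespace Val

/-- The size of a datum: its number of nodes (leaves included). -/
def size : Val → ℕ
  | nil => 1
  | node a b => 1 + a.size + b.size

/-- First component. -/
def hd : Val → Val
  | nil => nil
  | node a _ => a

/-- Second component. -/
def tl : Val → Val
  | nil => nil
  | node _ b => b

/-- The list that a datum represents (`nil` is the empty list, `node` is cons). -/
def toList : Val → List Val
  | nil => []
  | node a b => a :: b.toList

/-- Truth value of a datum: `nil` is false, everything else is true. -/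
def isTrue : Val → Bool
  | nil => false
  | node _ _ => true

end Val

/-- Encoding of a bit. -/
def encBool : Bool → Val
  | false => .nil
  | true => .node .nil .nil

/-- Encoding of a list. -/
def encList {α : Type} (e : α → Val) : List α → Val
  | [] => .nil
  | a :: l => .node (e a) (encList e l)

/-- Unary encoding of a natural number, so that `encNat l` is the usual `1^l`. -/
def encNat : ℕ → Val
  | 0 => .nil
  | n + 1 => .node .nil (encNat n)

/-- Encoding of a bit string. -/
def encBits (l : List Bool) : Val := encList encBool l

/-- Encoding of a finite sequence. -/
def encSeq {α : Type} {n : ℕ} (e : α → Val) (f : Fin n → α) : Val := encList e (List.ofFn f)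

/-- Probabilistic while-programs (in point-free form) on binary trees. -/
inductive Prog : Type where
  /-- return the input -/
  | ident : Prog
  /-- return `nil` -/
  | empty : Prog
  /-- first component of the input -/
  | hd : Prog
  /-- second component of the input -/
  | tl : Prog
  /-- return an element of the input list chosen uniformly at random (so that a fair coin is a
  uniform choice from a list of length two) -/
  | pick : Prog
  /-- run both programs on the input and return the pair of the results -/
  | pair : Prog → Prog → Prog
  /-- run the first program, then the second one on its result -/
  | seq : Prog → Prog → Prog
  /-- branch on the result of the first program -/
  | cond : Prog → Prog → Prog → Prog
  /-- `loop c b`: while the program `c` returns true on the current datum, apply `b` to it -/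
  | loop : Prog → Prog → Prog

/-- The distribution of outcomes of a run: `some (v, t)` is "result `v` after `t` time units",
`none` is "no result, as some loop was cut off". -/
abbrev Outcome : Type := PMF (Option (Val × ℕ))

/-- Add `n` time units to a run. -/
noncomputable def Outcome.charge (n : ℕ) (r : Outcome) : Outcome :=
  PMF.map (Option.map fun p => (p.1, n + p.2)) r

/-- Continue a run, adding up the times. -/
noncomputable def Outcome.andThen (r : Outcome) (f : Val → Outcome) : Outcome :=
  PMF.bind r fun o =>
    match o with
    | none => PMF.pure none
    | some (v, t) => Outcome.charge t (f v)

/-- The outcome with result `v` after `t` time units. -/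
noncomputable def Outcome.ret (v : Val) (t : ℕ) : Outcome := PMF.pure (some (v, t))

/-- A while loop with test `c` and body `b`, cut off when `d` tests have not ended it.
A test costs the size of the current datum in addition to the time of `c`. -/
noncomputable def whileLoop (c b : Val → Outcome) : ℕ → Val → Outcome
  | 0, _ => PMF.pure none
  | d + 1, v => Outcome.charge v.size <| Outcome.andThen (c v) fun a =>
      if a.isTrue then Outcome.andThen (b v) (whileLoop c b d) else Outcome.ret v 0

/-- A uniformly random element of the list represented by a datum (`nil` for the empty list). -/
noncomputable def pickElem : Val → PMF Val
  | .nil => PMF.pure .nil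
  | .node a b =>
      PMF.map (fun i : Fin (b.toList.length + 1) => (a :: b.toList).get i)
        (PMF.uniformOfFintype (Fin (b.toList.length + 1)))

/-- `p.exec d v` is the run of the program `p` on the input `v`, where every loop is cut off after
`d` iterations. Each elementary operation costs the size of the datum it is applied to, so that
the size of a result is at most proportional to the time spent. -/
noncomputable def Prog.exec (d : ℕ) : Prog → Val → Outcome
  | .ident, v => Outcome.ret v v.size
  | .empty, v => Outcome.ret .nil v.size
  | .hd, v => Outcome.ret v.hd v.size
  | .tl, v => Outcome.ret v.tl v.size
  | .pick, v => PMF.map (fun a => some (a, v.size)) (pickElem v)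
  | .pair f g, v => Outcome.charge v.size <| Outcome.andThen (Prog.exec d f v) fun a =>
      Outcome.andThen (Prog.exec d g v) fun b => Outcome.ret (.node a b) 0
  | .seq f g, v => Outcome.andThen (Prog.exec d f v) (Prog.exec d g)
  | .cond c f g, v => Outcome.charge v.size <| Outcome.andThen (Prog.exec d c v) fun a =>
      if a.isTrue then Prog.exec d f v else Prog.exec d g v
  | .loop c b, v => whileLoop (Prog.exec d c) (Prog.exec d b) d v

/-- A probabilistic polynomial time (PPT) algorithm: a program that, on every input and for all
random choices, halts within a number of time units that is polynomial in the size of the input.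
(A loop of `m` iterations takes more than `m` time units, so cutting loops off after `bound`
iterations is no restriction.) -/
structure PPT where
  /-- the program -/
  prog : Prog
  /-- the time bound -/
  bound : Polynomial ℕ
  /-- the program respects the time bound -/
  halts : ∀ v : Val, ∀ o ∈ (prog.exec (bound.eval v.size) v).support,
    ∃ (w : Val) (t : ℕ), o = some (w, t) ∧ t ≤ bound.eval v.size

/-- The output distribution of a PPT algorithm. -/
noncomputable def PPT.eval (A : PPT) (v : Val) : PMF Val :=
  PMF.map (fun o => (o.map Prod.fst).getD .nil) (A.prog.exec (A.bound.eval v.size) v)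

/-- The distribution of the bit that a PPT algorithm answers. -/
noncomputable def PPT.guess (A : PPT) (v : Val) : PMF Bool := PMF.map Val.isTrue (A.eval v)

/-- The function `f` is computed by a deterministic polynomial time algorithm, with respect to the
encodings `ein` and `eout`. -/
def PolyTime {α β : Type} (ein : α → Val) (eout : β → Val) (f : α → β) : Prop :=
  ∃ A : PPT, ∀ a : α, A.eval (ein a) = PMF.pure (eout (f a))

/-! ### Asymptotics and indistinguishability -/

/-- `f` is bounded by a polynomial. -/
def PolyBounded (f : ℕ → ℕ) : Prop := ∃ q : Polynomial ℕ, ∀ l, f l ≤ q.eval l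

/-- `f` is negligible: it tends to zero faster than the inverse of every polynomial. -/
def Negligible (f : ℕ → ℝ) : Prop :=
  Asymptotics.SuperpolynomialDecay Filter.atTop (fun l : ℕ => (l : ℝ)) f

/-- The probability that `D` answers 1 on a sample of `X`, given `1^l` and the auxiliary
input `z`. -/
noncomputable def acceptProb (D : PPT) (l : ℕ) (z : Val) (X : PMF Val) : ℝ :=
  ((PMF.bind X fun x => D.guess (.node (encNat l) (.node z x))) true).toReal

/-- Computational indistinguishability of two ensembles: every PPT distinguisher, with any
auxiliary input of polynomial size, has a negligible advantage. -/
def CompIndist (X Y : ℕ → PMF Val) : Prop :=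
  ∀ (D : PPT) (z : ℕ → Val), PolyBounded (fun l => (z l).size) →
    Negligible fun l => |acceptProb D l (z l) (X l) - acceptProb D l (z l) (Y l)|

/-! ### Commitment schemes -/

/-- Bit strings of length `n`. -/
abbrev Bits (n : ℕ) : Type := Fin n → Bool

/-- The encoding of a bit string of fixed length. -/
def encFixed {n : ℕ} (b : Bits n) : Val := encSeq encBool b

/-- A commitment scheme. `commit l m ρ` is the commitment to the message `m` at the security
parameter `l` with the random coins `ρ`. A commitment `c` is opened to `m` by revealing the coins
`ρ` (if there are any), and the opening is accepted if and only if `c = commit l m ρ`. -/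
structure CommitmentScheme where
  /-- the number of random coins -/
  coinLen : ℕ → ℕ
  /-- the commitment function -/
  commit : (l : ℕ) → List Bool → Bits (coinLen l) → List Bool
  /-- the number of coins is efficiently computable -/
  coinLen_polyTime : PolyTime encNat encNat coinLen
  /-- commitments are efficiently computable -/
  commit_polyTime :
    PolyTime (fun a : Σ l : ℕ, List Bool × Bits (coinLen l) =>
        .node (encNat a.1) (.node (encBits a.2.1) (encFixed a.2.2)))
      encBits (fun a => commit a.1 a.2.1 a.2.2)

/-- The random coins of one commitment. -/
abbrev CommitmentScheme.Coins (COM : CommitmentScheme) (l : ℕ) : Type := Bits (COM.coinLen l)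

/-- The hiding experiment: a random bit `b` is drawn, the adversary gets `1^l`, its auxiliary
input and a commitment to `m_b`, and answers `b'`. The outcome is whether `b = b'`. -/
noncomputable def CommitmentScheme.hidingExperiment (COM : CommitmentScheme) (A : PPT) (l : ℕ)
    (z : Val) (m₀ m₁ : List Bool) : PMF Bool := do
  let b ← PMF.uniformOfFintype Bool
  let ρ ← PMF.uniformOfFintype (COM.Coins l)
  let c := COM.commit l (if b then m₁ else m₀) ρ
  let b' ← A.guess (.node (encNat l) (.node z (encBits c)))
  return (b == b')

/-- The advantage in the hiding experiment. -/
noncomputable def CommitmentScheme.hidingAdvantage (COM : CommitmentScheme) (A : PPT) (l : ℕ)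
    (z : Val) (m₀ m₁ : List Bool) : ℝ :=
  |(COM.hidingExperiment A l z m₀ m₁ true).toReal - 1 / 2|

/-- Computationally hiding: for every PPT adversary, with any auxiliary input of polynomial size,
and every pair of messages of the same, polynomially bounded, length, the advantage is
negligible. -/
def CommitmentScheme.Hiding (COM : CommitmentScheme) : Prop :=
  ∀ (A : PPT) (z : ℕ → Val) (m₀ m₁ : ℕ → List Bool),
    PolyBounded (fun l => (z l).size) → PolyBounded (fun l => (m₀ l).length) →
    (∀ l, (m₀ l).length = (m₁ l).length) →
    Negligible fun l => COM.hidingAdvantage A l (z l) (m₀ l) (m₁ l)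

/-! ### Parameters, vectors, permutations and quasi-cyclic codes -/

/-- The parameters: block length `k`, weight `w`, number of iterations `δ`, number `s` of syndromes
in the public key, and length `seedLen` of the seeds. -/
structure Params where
  k : ℕ
  w : ℕ
  δ : ℕ
  s : ℕ
  seedLen : ℕ
  k_pos : 0 < k
  s_pos : 0 < s
  w_le : w ≤ 2 * k

instance (P : Params) : NeZero P.k := ⟨P.k_pos.ne'⟩

instance (P : Params) : NeZero P.s := ⟨P.s_pos.ne'⟩

/-- Encoding of the parameters. -/
def encParams (P : Params) : Val :=
  encList encNat [P.k, P.w, P.δ, P.s, P.seedLen]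

/-- Index set of the `2k` coordinates: two blocks of length `k`. -/
abbrev Pos (k : ℕ) : Type := Fin k ⊕ Fin k

/-- The space `F_2^k`. -/
abbrev Vec (k : ℕ) : Type := Fin k → ZMod 2

/-- The space `F_2^{2k}`. -/
abbrev Vec₂ (k : ℕ) : Type := Pos k → ZMod 2

/-- The cyclic shift of a vector by `r` positions. -/
def rot {k : ℕ} (r : Fin k) (y : Vec k) : Vec k := fun j => y (j - r)

/-- The cyclic shift by `r` positions in each of the two blocks. -/
def rot₂ {k : ℕ} (r : Fin k) (x : Vec₂ k) : Vec₂ k :=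
  Sum.elim (rot r fun j => x (.inl j)) (rot r fun j => x (.inr j))

/-- The action `π[x]` of a permutation on the coordinates of a vector. -/
def permute {k : ℕ} (π : Equiv.Perm (Pos k)) (x : Vec₂ k) : Vec₂ k := fun i => x (π.symm i)

/-- The systematic quasi-cyclic parity check matrix `[I_k A]`, with `A` the circulant matrix of
`a`. A uniform matrix of this shape is given by a uniform `a`. -/
def qcMatrix {k : ℕ} (a : Vec k) : Matrix (Fin k) (Pos k) (ZMod 2) :=
  Matrix.fromCols 1 (Matrix.circulant a)

/-- The vectors of weight `w` in `F_2^{2k}`. -/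
abbrev WeightVec (P : Params) : Type := {x : Vec₂ P.k // hammingNorm x = P.w}

/-- The bits of a vector. -/
def vecBits {k : ℕ} (y : Vec k) : List Bool := List.ofFn fun i => decide (y i = 1)

/-- The bits of a vector with two blocks. -/
def vecBits₂ {k : ℕ} (x : Vec₂ k) : List Bool :=
  vecBits (fun i => x (.inl i)) ++ vecBits (fun i => x (.inr i))

/-- The bits of a permutation: the rows of its permutation matrix, so that the row of `i` is the
indicator of `π⁻¹ i`. -/
def permBits {k : ℕ} (π : Equiv.Perm (Pos k)) : List Bool :=
  let row : Pos k → List Bool := fun i =>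
    (List.ofFn fun j => decide (π (.inl j) = i)) ++ (List.ofFn fun j => decide (π (.inr j) = i))
  (List.ofFn fun i => row (.inl i)).flatten ++ (List.ofFn fun i => row (.inr i)).flatten

/-! ### Sampling from seeds -/

/-- Seeds. -/
abbrev Seed (P : Params) : Type := Bits P.seedLen

/-- Encoding of security parameter, parameters and seed. -/
def encSeedInput (a : Σ _ : ℕ, Σ P : Params, Seed P) : Val :=
  .node (encNat a.1) (.node (encParams a.2.1) (encFixed a.2.2))

/-- Deterministic polynomial time algorithms that sample from a seed: a permutation, a vector
of `F_2^{2k}`, a quasi-cyclic matrix (given by its circulant block), and `s` vectors of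
weight `w`. -/
structure SeedSampler where
  perm : (l : ℕ) → (P : Params) → Seed P → Equiv.Perm (Pos P.k)
  vec : (l : ℕ) → (P : Params) → Seed P → Vec₂ P.k
  block : (l : ℕ) → (P : Params) → Seed P → Vec P.k
  secrets : (l : ℕ) → (P : Params) → Seed P → Fin P.s → WeightVec P
  perm_polyTime : ∃ A : PPT, ∀ l P θ,
    A.eval (encSeedInput ⟨l, P, θ⟩) = PMF.pure (encBits (permBits (perm l P θ)))
  vec_polyTime : ∃ A : PPT, ∀ l P θ,
    A.eval (encSeedInput ⟨l, P, θ⟩) = PMF.pure (encBits (vecBits₂ (vec l P θ)))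
  block_polyTime : ∃ A : PPT, ∀ l P θ,
    A.eval (encSeedInput ⟨l, P, θ⟩) = PMF.pure (encBits (vecBits (block l P θ)))
  secrets_polyTime : ∃ A : PPT, ∀ l P θ,
    A.eval (encSeedInput ⟨l, P, θ⟩) =
      PMF.pure (encSeq (fun x : WeightVec P => encBits (vecBits₂ x.1)) (secrets l P θ))

/-- A setup algorithm draws parameters for a given security parameter. -/
abbrev Setup : Type := ℕ → PMF Params

/-- The parameters returned by `Setup(1^l)` are bounded by a polynomial in `l`
(the weight is at most `2k`). -/
def Setup.PolyBounded (setup : Setup) : Prop :=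
  ∃ q : Polynomial ℕ, ∀ l, ∀ P ∈ (setup l).support,
    P.k ≤ q.eval l ∧ P.δ ≤ q.eval l ∧ P.s ≤ q.eval l ∧ P.seedLen ≤ q.eval l

/-- Sampling a permutation or a vector from a uniformly random seed is computationally
indistinguishable from sampling it uniformly at random. -/
def SeedSampler.Pseudorandom (E : SeedSampler) (setup : Setup) : Prop :=
  ∀ par : ℕ → Params, (∀ l, par l ∈ (setup l).support) →
    CompIndist
      (fun l => PMF.map (fun θ => encBits (permBits (E.perm l (par l) θ)))
        (PMF.uniformOfFintype (Seed (par l))))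
      (fun l => PMF.map (fun π => encBits (permBits π))
        (PMF.uniformOfFintype (Equiv.Perm (Pos (par l).k)))) ∧
    CompIndist
      (fun l => PMF.map (fun ξ => encBits (vecBits₂ (E.vec l (par l) ξ)))
        (PMF.uniformOfFintype (Seed (par l))))
      (fun l => PMF.map (fun v => encBits (vecBits₂ v))
        (PMF.uniformOfFintype (Vec₂ (par l).k)))

/-! ### The protocol -/

/-- Secret keys: the seed of the secret vectors. -/
abbrev SecretKey (P : Params) : Type := Seed P

/-- Public keys: the seed of the parity check matrix and the `s` syndromes. -/
abbrev PublicKey (P : Params) : Type := Seed P × (Fin P.s → Vec P.k)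

/-- Encoding of a public key. -/
def encPublicKey {P : Params} (pk : PublicKey P) : Val :=
  .node (encFixed pk.1) (encSeq (fun y => encBits (vecBits y)) pk.2)

/-- Key generation. -/
noncomputable def keyGen (E : SeedSampler) (l : ℕ) (P : Params) :
    PMF (SecretKey P × PublicKey P) := do
  let φ₁ ← PMF.uniformOfFintype (Seed P)
  let φ₂ ← PMF.uniformOfFintype (Seed P)
  let H := qcMatrix (E.block l P φ₂)
  let y : Fin P.s → Vec P.k := fun i => H.mulVec (E.secrets l P φ₁ i).1
  return (φ₁, (φ₂, y))

/-- The first challenges `(s_i, r_i)`. -/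
abbrev Challenge₁ (P : Params) : Type := Fin P.δ → Fin P.s × Fin P.k

/-- The second challenges `b_i`. -/
abbrev Challenge₂ (P : Params) : Type := Bits P.δ

/-- The response `d_i` to one iteration: a seed, a vector and the commitment that the verifier
cannot recompute, together with the coins of the two commitments that the verifier recomputes. -/
structure Response (COM : CommitmentScheme) (l : ℕ) (P : Params) where
  seed : Seed P
  word : Vec₂ P.k
  com : List Bool
  coinsA : COM.Coins l
  coinsB : COM.Coins l

/-- Encoding of a response. -/
def encResponse {COM : CommitmentScheme} {l : ℕ} {P : Params} (d : Response COM l P) : Val :=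
  .node (encFixed d.seed) (.node (encBits (vecBits₂ d.word)) (.node (encBits d.com)
    (.node (encFixed d.coinsA) (encFixed d.coinsB))))

/-- All that the prover reveals in its last message, before compression: the coins of the
commitments `Cmt_1` and `Cmt_2`, and the responses `d_1, …, d_δ`. -/
structure Opening (COM : CommitmentScheme) (l : ℕ) (P : Params) where
  coins₁ : COM.Coins l
  coins₂ : COM.Coins l
  d : Fin P.δ → Response COM l P

/-- Encoding of the prover's last message. -/
def encOpening {COM : CommitmentScheme} {l : ℕ} {P : Params} (o : Opening COM l P) : Val :=
  .node (encFixed o.coins₁) (.node (encFixed o.coins₂) (encSeq encResponse o.d))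

/-- A compression algorithm for the last message of the prover: any deterministic polynomial time
algorithm. It may use the parameters and the second challenge, which the verifier knows. -/
structure Compressor (COM : CommitmentScheme) where
  compress : (l : ℕ) → (P : Params) → Challenge₂ P → Opening COM l P → Val
  compress_polyTime : ∃ A : PPT, ∀ l P b o,
    A.eval (.node (encNat l) (.node (encParams P) (.node (encFixed b) (encOpening o)))) =
      PMF.pure (compress l P b o)

/-- Transcripts `(Cmt_1, Ch_1, Cmt_2, Ch_2, Rsp)`. -/
structure Transcript (P : Params) where
  cmt₁ : List Bool
  ch₁ : Challenge₁ P
  cmt₂ : List Bool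
  ch₂ : Challenge₂ P
  rsp : Val

/-- Encoding of a transcript. -/
def encTranscript {P : Params} (t : Transcript P) : Val :=
  .node (encBits t.cmt₁) (.node
    (encSeq (fun c : Fin P.s × Fin P.k => .node (encNat c.1) (encNat c.2)) t.ch₁)
    (.node (encBits t.cmt₂) (.node (encFixed t.ch₂) t.rsp)))

/-- The distribution of the transcripts of honest executions between the prover with input
`(param, sk, pk)` and the verifier with input `(param, pk)`. -/
noncomputable def honestTranscript (COM : CommitmentScheme) (E : SeedSampler) (Z : Compressor COM)
    (l : ℕ) (P : Params) (sk : SecretKey P) (pk : PublicKey P) : PMF (Transcript P) := do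
  let H := qcMatrix (E.block l P pk.1)
  let x : Fin P.s → WeightVec P := E.secrets l P sk
  -- prover, first message
  let θ ← PMF.uniformOfFintype (Fin P.δ → Seed P)
  let ξ ← PMF.uniformOfFintype (Fin P.δ → Seed P)
  let ρ₁ ← PMF.uniformOfFintype (Fin P.δ → COM.Coins l)
  let ρ₂ ← PMF.uniformOfFintype (Fin P.δ → COM.Coins l)
  let R₁ ← PMF.uniformOfFintype (COM.Coins l)
  let π : Fin P.δ → Equiv.Perm (Pos P.k) := fun i => E.perm l P (θ i)
  let v : Fin P.δ → Vec₂ P.k := fun i => E.vec l P (ξ i)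
  let u : Fin P.δ → Vec₂ P.k := fun i => permute (π i).symm (v i)
  let c₁ := fun i => COM.commit l (permBits (π i) ++ vecBits (H.mulVec (u i))) (ρ₁ i)
  let c₂ := fun i => COM.commit l (vecBits₂ (permute (π i) (u i))) (ρ₂ i)
  let cmt₁ := COM.commit l (List.ofFn fun i => c₁ i ++ c₂ i).flatten R₁
  -- verifier, first challenge
  let ch₁ ← PMF.uniformOfFintype (Challenge₁ P)
  -- prover, second message
  let ρ₃ ← PMF.uniformOfFintype (Fin P.δ → COM.Coins l)
  let R₂ ← PMF.uniformOfFintype (COM.Coins l)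
  let xr : Fin P.δ → Vec₂ P.k := fun i => rot₂ (ch₁ i).2 (x (ch₁ i).1).1
  let c₃ := fun i => COM.commit l (vecBits₂ (permute (π i) (u i + xr i))) (ρ₃ i)
  let cmt₂ := COM.commit l (List.ofFn c₃).flatten R₂
  -- verifier, second challenge
  let ch₂ ← PMF.uniformOfFintype (Challenge₂ P)
  -- prover, last message
  let d : Fin P.δ → Response COM l P := fun i =>
    if ch₂ i = false then ⟨θ i, u i + xr i, c₂ i, ρ₁ i, ρ₃ i⟩
    else ⟨ξ i, permute (π i) (xr i), c₁ i, ρ₂ i, ρ₃ i⟩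
  return ⟨cmt₁, ch₁, cmt₂, ch₂, Z.compress l P ch₂ ⟨R₁, R₂, d⟩⟩

/-- Honest-verifier zero-knowledge: there is a PPT simulator that, given the security parameter,
the parameters and the public key, outputs transcripts that are computationally indistinguishable
from those of honest executions, for all parameters returned by the setup and all keys returned by
the key generation. -/
def HonestVerifierZK (setup : Setup) (COM : CommitmentScheme) (E : SeedSampler)
    (Z : Compressor COM) : Prop :=
  ∃ S : PPT, ∀ par : ℕ → Params, (∀ l, par l ∈ (setup l).support) →
    ∀ key : (l : ℕ) → SecretKey (par l) × PublicKey (par l),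
      (∀ l, key l ∈ (keyGen E l (par l)).support) →
      CompIndist
        (fun l => PMF.map encTranscript
          (honestTranscript COM E Z l (par l) (key l).1 (key l).2))
        (fun l => S.eval
          (.node (encNat l) (.node (encParams (par l)) (encPublicKey (key l).2))))

end QCStern

namespace QCStern

/-! ### Runs of programs -/

/-! An honest-verifier simulator draws the challenges itself, so it knows in every iteration which
commitment stays closed. If the second challenge bit is 0, the verifier sees `π` and `u + x'`. Since
`u = π⁻¹[v]` with `v` pseudorandom, this word looks uniform whatever `π` and `x'` are, and the
simulator sends a fresh sampled word. The commitment `c₁` must open to `π` and `H u`; as `H`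
commutes with cyclic shifts and the characteristic is 2, `H u` equals `H (u + x')` plus the shifted
syndrome, which is computable from the public key. If the bit is 1, the verifier sees `v` and
`π[x']`. The symmetric group is transitive on words of a given weight, so for uniform `π` the word
`π[x']` has the same distribution as `π[x]` for any `x` of weight `w`; the simulator takes `x` among
the vectors sampled from the public seed. In both cases the closed commitment is replaced by one to
a dummy message of equal length.

For each bit there are two hybrid steps, in this order (`compIndist_iter₀`, `compIndist_iter₁`):
hiding replaces the closed commitment, after which the seed that stays hidden enters only through
the revealed word, and pseudorandomness applies to that word. All other data, secrets included, are
fixed by averaging (`CompIndist.bind`) and handed to the non-uniform distinguisher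
(`CompIndist.process`). A hybrid argument over the `δ` independent iterations (`CompIndist.iid`) and
the common polynomial-time map `finish`, which forms the outer commitments and the compressed
response, give the transcripts (`honestTranscript_eq`, `simulator_eq`).

The remaining work is the machine model: reductions and simulator must be programs with polynomial
time bounds. They are written as functions on `Val` and built from closure properties of `IsPPT` and
`IsPT`; the essential one is that folds with polynomially bounded accumulators take polynomial time
(`IsPPT.pfold`). -/

theorem Val.size_pos (v : Val) : 1 ≤ v.size := by
  cases v <;> simp only [Val.size] <;> omega

theorem Val.hd_node (a b : Val) : (Val.node a b).hd = a := rfl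

theorem Val.tl_node (a b : Val) : (Val.node a b).tl = b := rfl

theorem Val.size_hd_le (v : Val) : v.hd.size ≤ v.size := by
  cases v <;> simp only [Val.size, Val.hd] <;> omega

theorem Val.size_tl_le (v : Val) : v.tl.size ≤ v.size := by
  cases v <;> simp only [Val.size, Val.tl] <;> omega

theorem Val.size_le_of_mem_toList {v x : Val} (h : x ∈ v.toList) : x.size ≤ v.size := by
  induction v with
  | nil => simp [Val.toList] at h
  | node a b _ ih =>
    simp only [Val.toList, List.mem_cons] at h
    simp only [Val.size]
    rcases h with rfl | h
    · omega
    · have := ih h; omega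

theorem Val.length_toList_le (v : Val) : v.toList.length ≤ v.size := by
  induction v with
  | nil => simp [Val.toList]
  | node _ y _ ih => simp only [Val.toList, Val.size, List.length_cons]; omega

/-- Natural coefficients are nonnegative; this is what allows a time bound to be evaluated at an
upper bound of the input size. -/
theorem polynomial_eval_mono (q : Polynomial ℕ) {a b : ℕ} (h : a ≤ b) : q.eval a ≤ q.eval b := by
  rw [Polynomial.eval_eq_sum, Polynomial.eval_eq_sum]
  exact Finset.sum_le_sum fun i _ => Nat.mul_le_mul_left _ (Nat.pow_le_pow_left h i)

/-! ### Supports and results of runs -/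

namespace Outcome

theorem mem_support_charge {n : ℕ} {r : Outcome} {w : Val} {t : ℕ} :
    some (w, t) ∈ (r.charge n).support ↔ ∃ t', some (w, t') ∈ r.support ∧ t = n + t' := by
  simp only [charge, PMF.mem_support_map_iff]
  constructor
  · rintro ⟨_ | ⟨w', t'⟩, h, h'⟩
    · simp at h'
    · simp only [Option.map_some, Option.some.injEq, Prod.mk.injEq] at h'
      obtain ⟨rfl, rfl⟩ := h'
      exact ⟨t', h, rfl⟩
  · rintro ⟨t', h, rfl⟩
    exact ⟨_, h, rfl⟩

theorem none_mem_support_charge {n : ℕ} {r : Outcome} :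
    none ∈ (r.charge n).support ↔ none ∈ r.support := by
  simp only [charge, PMF.mem_support_map_iff]
  constructor
  · rintro ⟨_ | o, h, h'⟩
    · exact h
    · simp at h'
  · exact fun h => ⟨_, h, rfl⟩

theorem mem_support_andThen {r : Outcome} {f : Val → Outcome} {w : Val} {t : ℕ} :
    some (w, t) ∈ (r.andThen f).support ↔ ∃ v t₁ t₂, some (v, t₁) ∈ r.support ∧
      some (w, t₂) ∈ (f v).support ∧ t = t₁ + t₂ := by
  simp only [andThen, PMF.mem_support_bind_iff]
  constructor
  · rintro ⟨_ | ⟨v, t₁⟩, h, h'⟩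
    · simp at h'
    · obtain ⟨t₂, h₂, rfl⟩ := mem_support_charge.1 h'
      exact ⟨v, t₁, t₂, h, h₂, rfl⟩
  · rintro ⟨v, t₁, t₂, h₁, h₂, rfl⟩
    exact ⟨_, h₁, mem_support_charge.2 ⟨t₂, h₂, rfl⟩⟩

theorem none_mem_support_andThen {r : Outcome} {f : Val → Outcome} :
    none ∈ (r.andThen f).support ↔ none ∈ r.support ∨
      ∃ v t, some (v, t) ∈ r.support ∧ none ∈ (f v).support := by
  simp only [andThen, PMF.mem_support_bind_iff]
  constructor
  · rintro ⟨_ | ⟨v, t₁⟩, h, h'⟩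
    · exact .inl h
    · exact .inr ⟨v, t₁, h, none_mem_support_charge.1 h'⟩
  · rintro (h | ⟨v, t, h, h'⟩)
    · exact ⟨none, h, by simp⟩
    · exact ⟨_, h, none_mem_support_charge.2 h'⟩

theorem mem_support_ret {v w : Val} {s t : ℕ} :
    some (w, t) ∈ (ret v s).support ↔ w = v ∧ t = s := by
  simp [ret]

end Outcome

/-- Points outside the support carry weight zero, so continuations need to agree only at reachable
values. -/
theorem pmf_bind_congr {α β : Type} {μ : PMF α} {f g : α → PMF β}
    (h : ∀ a ∈ μ.support, f a = g a) : μ.bind f = μ.bind g := by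
  ext b
  simp only [PMF.bind_apply]
  refine tsum_congr fun a => ?_
  by_cases ha : a ∈ μ.support
  · rw [h a ha]
  · rw [PMF.apply_eq_zero_iff _ _ |>.2 ha, zero_mul, zero_mul]

namespace Outcome

theorem andThen_congr {r : Outcome} {f g : Val → Outcome}
    (h : ∀ v t, some (v, t) ∈ r.support → f v = g v) : r.andThen f = r.andThen g := by
  refine pmf_bind_congr ?_
  rintro (_ | ⟨v, t⟩) hv
  · rfl
  · simp only [h v t hv]

/-- The result of a run, without the time. -/
noncomputable def result (r : Outcome) : PMF (Option Val) := PMF.map (Option.map Prod.fst) r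

theorem result_charge (n : ℕ) (r : Outcome) : (r.charge n).result = r.result := by
  simp only [result, charge, PMF.map_comp]
  congr 1
  funext o
  cases o <;> rfl

theorem result_ret (v : Val) (t : ℕ) : (ret v t).result = PMF.map some (PMF.pure v) := by
  simp [result, ret, PMF.pure_map]

/-- The description `κ` of the second run is required only on the support of `μ`, because time
bounds, and with them the absence of cut-offs, are known only for reachable intermediate results. -/
theorem result_andThen (r : Outcome) (f : Val → Outcome) {μ : PMF Val} {κ : Val → PMF Val}
    (hr : r.result = μ.map some) (hf : ∀ v ∈ μ.support, (f v).result = (κ v).map some) :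
    (r.andThen f).result = (μ.bind κ).map some := by
  have h : (r.andThen f).result =
      r.result.bind fun o => o.elim (PMF.pure none) fun v => (f v).result := by
    simp only [result, andThen, PMF.map_bind, PMF.bind_map]
    congr 1
    funext o
    cases o with
    | none => simp [PMF.pure_map]
    | some p => exact result_charge p.2 (f p.1)
  rw [h, hr, PMF.bind_map, PMF.map_bind]
  exact pmf_bind_congr hf

end Outcome

/-- The size of a result is at most the time spent. -/
theorem Prog.size_le_time (d : ℕ) (p : Prog) : ∀ (v w : Val) (t : ℕ),
    some (w, t) ∈ (p.exec d v).support → w.size ≤ t := by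
  induction p with
  | ident | empty | hd | tl =>
    intro v w t h
    obtain ⟨rfl, rfl⟩ := Outcome.mem_support_ret.1 h
    first | exact le_rfl | exact v.size_pos | exact v.size_hd_le | exact v.size_tl_le
  | pick =>
    intro v w t h
    simp only [Prog.exec, PMF.mem_support_map_iff, Option.some.injEq, Prod.mk.injEq] at h
    obtain ⟨a, ha, rfl, rfl⟩ := h
    cases v with
    | nil => simp only [pickElem, PMF.mem_support_pure_iff] at ha; rw [ha]
    | node x y =>
      simp only [pickElem, PMF.mem_support_map_iff] at ha
      obtain ⟨i, -, rfl⟩ := ha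
      exact Val.size_le_of_mem_toList (v := .node x y) (List.get_mem _ _)
  | pair f g hf hg =>
    intro v w t h
    obtain ⟨t', h', rfl⟩ := Outcome.mem_support_charge.1 h
    obtain ⟨a, t₁, t₂, h₁, h₂, rfl⟩ := Outcome.mem_support_andThen.1 h'
    obtain ⟨b, t₃, t₄, h₃, h₄, rfl⟩ := Outcome.mem_support_andThen.1 h₂
    obtain ⟨rfl, rfl⟩ := Outcome.mem_support_ret.1 h₄
    have := hf _ _ _ h₁
    have := hg _ _ _ h₃
    have := v.size_pos
    simp only [Val.size]
    omega
  | seq f g hf hg =>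
    intro v w t h
    obtain ⟨a, t₁, t₂, h₁, h₂, rfl⟩ := Outcome.mem_support_andThen.1 h
    have := hg _ _ _ h₂
    omega
  | cond c f g hc hf hg =>
    intro v w t h
    obtain ⟨t', h', rfl⟩ := Outcome.mem_support_charge.1 h
    obtain ⟨a, t₁, t₂, h₁, h₂, rfl⟩ := Outcome.mem_support_andThen.1 h'
    split at h₂
    · have := hf _ _ _ h₂; omega
    · have := hg _ _ _ h₂; omega
  | loop c b hc hb =>
    -- The loop's own cut-off drops by one per iteration while that of the programs inside it stays
    -- `d`; the induction therefore separates the two.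
    suffices H : ∀ n v w t,
        some (w, t) ∈ (whileLoop (c.exec d) (b.exec d) n v).support → w.size ≤ t from H d
    intro n
    induction n with
    | zero => intro v w t h; simp [whileLoop] at h
    | succ n ih =>
      intro v w t h
      obtain ⟨t', h', rfl⟩ := Outcome.mem_support_charge.1 h
      obtain ⟨a, t₁, t₂, h₁, h₂, rfl⟩ := Outcome.mem_support_andThen.1 h'
      split at h₂
      · obtain ⟨a, t₃, t₄, h₃, h₄, rfl⟩ := Outcome.mem_support_andThen.1 h₂
        have := ih _ _ _ h₄
        omega
      · obtain ⟨rfl, rfl⟩ := Outcome.mem_support_ret.1 h₂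
        omega

/-- A run that is never cut off does not change when the cut-off is raised. -/
theorem Prog.exec_eq_of_le {d d' : ℕ} (hd : d ≤ d') (p : Prog) : ∀ v : Val,
    none ∉ (p.exec d v).support → p.exec d' v = p.exec d v := by
  induction p with
  | ident | empty | hd | tl | pick => intro v _; rfl
  | pair f g hf hg =>
    intro v h
    simp only [Prog.exec, Outcome.none_mem_support_charge, Outcome.none_mem_support_andThen,
      not_or, not_exists, not_and] at h ⊢
    rw [hf v h.1]
    refine congrArg _ (Outcome.andThen_congr fun a t ha => ?_)
    rw [hg v (h.2 a t ha).1]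
  | seq f g hf hg =>
    intro v h
    simp only [Prog.exec, Outcome.none_mem_support_andThen, not_or, not_exists, not_and] at h ⊢
    rw [hf v h.1]
    exact Outcome.andThen_congr fun a t ha => hg a (h.2 a t ha)
  | cond c f g hc hf hg =>
    intro v h
    simp only [Prog.exec, Outcome.none_mem_support_charge, Outcome.none_mem_support_andThen,
      not_or, not_exists, not_and] at h ⊢
    rw [hc v h.1]
    refine congrArg _ (Outcome.andThen_congr fun a t ha => ?_)
    have := h.2 a t ha
    split at this
    · rw [if_pos ‹_›, if_pos ‹_›, hf v this]
    · rw [if_neg ‹_›, if_neg ‹_›, hg v this]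
  | loop c b hc hb =>
    suffices H : ∀ n n', n ≤ n' → ∀ v, none ∉ (whileLoop (c.exec d) (b.exec d) n v).support →
        whileLoop (c.exec d') (b.exec d') n' v = whileLoop (c.exec d) (b.exec d) n v from
      H d d' hd
    intro n
    induction n with
    | zero => intro n' _ v h; simp [whileLoop] at h
    | succ n ih =>
      intro n' hn v h
      obtain ⟨n', rfl⟩ : ∃ m, n' = m + 1 := ⟨n' - 1, by omega⟩
      simp only [whileLoop, Outcome.none_mem_support_charge, Outcome.none_mem_support_andThen,
        not_or, not_exists, not_and] at h ⊢
      rw [hc v h.1]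
      refine congrArg _ (Outcome.andThen_congr fun a t ha => ?_)
      have h₁ := h.2 a t ha
      split at h₁
      · simp only [Outcome.none_mem_support_andThen, not_or, not_exists, not_and] at h₁
        rw [if_pos ‹_›, if_pos ‹_›, hb v h₁.1]
        exact Outcome.andThen_congr fun w s hw => ih n' (by omega) w (h₁.2 w s hw)
      · rw [if_neg ‹_›, if_neg ‹_›]

/-! ### Runs with a time bound, for all sufficiently large cut-offs -/

/-- The program `p` on the input `v` halts within time `T` and its result has distribution `μ`. -/
structure Runs (p : Prog) (v : Val) (μ : PMF Val) (T : ℕ) : Prop where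
  result : ∀ d, T ≤ d → Outcome.result (p.exec d v) = μ.map some
  time : ∀ d, T ≤ d → ∀ w t, some (w, t) ∈ (p.exec d v).support → t ≤ T

namespace Runs

variable {p f g c : Prog} {v : Val} {μ ν : PMF Val} {T T₁ T₂ T₃ : ℕ}

theorem exists_time (h : Runs p v μ T) {w : Val} (hw : w ∈ μ.support) {d : ℕ} (hd : T ≤ d) :
    ∃ t, some (w, t) ∈ (p.exec d v).support := by
  have : some w ∈ (μ.map some).support := (PMF.mem_support_map_iff _ _ _).2 ⟨w, hw, rfl⟩
  rw [← h.result d hd, Outcome.result, PMF.mem_support_map_iff] at this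
  obtain ⟨_ | ⟨w', t⟩, h₁, h₂⟩ := this
  · simp at h₂
  · simp only [Option.map_some, Option.some.injEq] at h₂
    exact ⟨t, h₂ ▸ h₁⟩

theorem mem_support (h : Runs p v μ T) {d : ℕ} (hd : T ≤ d) {w : Val} {t : ℕ}
    (hw : some (w, t) ∈ (p.exec d v).support) : w ∈ μ.support := by
  have : some w ∈ (Outcome.result (p.exec d v)).support :=
    (PMF.mem_support_map_iff _ _ _).2 ⟨_, hw, rfl⟩
  rw [h.result d hd, PMF.mem_support_map_iff] at this
  obtain ⟨w', h₁, h₂⟩ := this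
  exact Option.some.inj h₂ ▸ h₁

theorem none_notMem (h : Runs p v μ T) {d : ℕ} (hd : T ≤ d) :
    none ∉ (p.exec d v).support := by
  intro hn
  have : none ∈ (Outcome.result (p.exec d v)).support :=
    (PMF.mem_support_map_iff _ _ _).2 ⟨_, hn, rfl⟩
  rw [h.result d hd, PMF.mem_support_map_iff] at this
  obtain ⟨w', h₁, h₂⟩ := this
  simp at h₂

/-- Producing data takes time. This bounds the input of the second program in a composition. -/
theorem size_le (h : Runs p v μ T) {w : Val} (hw : w ∈ μ.support) : w.size ≤ T := by
  obtain ⟨t, ht⟩ := h.exists_time hw le_rfl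
  exact (p.size_le_time _ _ _ _ ht).trans (h.time _ le_rfl _ _ ht)

theorem mono (h : Runs p v μ T) (hT : T ≤ T₁) : Runs p v μ T₁ :=
  ⟨fun d hd => h.result d (hT.trans hd), fun d hd w t hw => (h.time d (hT.trans hd) w t hw).trans hT⟩

theorem of_ret {w : Val} (h : ∀ d, p.exec d v = Outcome.ret w v.size) :
    Runs p v (PMF.pure w) v.size where
  result d _ := by rw [h, Outcome.result_ret]
  time d _ w t hw := by
    rw [h] at hw
    exact (Outcome.mem_support_ret.1 hw).2.le

theorem pick : Runs .pick v (pickElem v) v.size where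
  result d _ := by
    simp only [Prog.exec, Outcome.result, PMF.map_comp]
    rfl
  time d _ w t hw := by
    simp only [Prog.exec, PMF.mem_support_map_iff, Option.some.injEq, Prod.mk.injEq] at hw
    obtain ⟨a, ha, rfl, rfl⟩ := hw
    exact le_rfl

theorem pair (hf : Runs f v μ T₁) (hg : Runs g v ν T₂) :
    Runs (.pair f g) v (μ.bind fun a => ν.bind fun b => PMF.pure (.node a b))
      (v.size + T₁ + T₂) where
  result d hd := by
    rw [Prog.exec, Outcome.result_charge]
    refine Outcome.result_andThen _ _ (hf.result d (by omega)) fun a _ => ?_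
    exact Outcome.result_andThen _ _ (hg.result d (by omega)) fun b _ => Outcome.result_ret _ _
  time d hd w t h := by
    obtain ⟨t', h', rfl⟩ := Outcome.mem_support_charge.1 h
    obtain ⟨a, t₁, t₂, h₁, h₂, rfl⟩ := Outcome.mem_support_andThen.1 h'
    obtain ⟨b, t₃, t₄, h₃, h₄, rfl⟩ := Outcome.mem_support_andThen.1 h₂
    obtain ⟨rfl, rfl⟩ := Outcome.mem_support_ret.1 h₄
    have := hf.time d (by omega) _ _ h₁
    have := hg.time d (by omega) _ _ h₃
    omega

/-- One bound `T₂` has to serve all reachable intermediate results; `Runs.size_le` and monotonicity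
of polynomials will supply it. -/
theorem seq {κ : Val → PMF Val} (hf : Runs f v μ T₁)
    (hg : ∀ w ∈ μ.support, Runs g w (κ w) T₂) : Runs (.seq f g) v (μ.bind κ) (T₁ + T₂) where
  result d hd := Outcome.result_andThen _ _ (hf.result d (by omega))
    fun w hw => (hg w hw).result d (by omega)
  time d hd w t h := by
    obtain ⟨a, t₁, t₂, h₁, h₂, rfl⟩ := Outcome.mem_support_andThen.1 h
    have := hf.time d (by omega) _ _ h₁
    have := (hg a (hf.mem_support (by omega) h₁)).time d (by omega) _ _ h₂
    omega

/-- The times of both branches are added instead of taking the maximum, so that bounds remain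
polynomials. -/
theorem cond {a : Val} (hc : Runs c v (PMF.pure a) T₁) (hf : Runs f v μ T₂)
    (hg : Runs g v ν T₃) :
    Runs (.cond c f g) v (if a.isTrue then μ else ν) (v.size + T₁ + T₂ + T₃) where
  result d hd := by
    rw [Prog.exec, Outcome.result_charge, Outcome.result_andThen (μ := PMF.pure a)
      (κ := fun a => if a.isTrue then μ else ν) _ _ (hc.result d (by omega)), PMF.pure_bind]
    intro b _
    split
    · exact hf.result d (by omega)
    · exact hg.result d (by omega)
  time d hd w t h := by
    obtain ⟨t', h', rfl⟩ := Outcome.mem_support_charge.1 h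
    obtain ⟨b, t₁, t₂, h₁, h₂, rfl⟩ := Outcome.mem_support_andThen.1 h'
    have := hc.time d (by omega) _ _ h₁
    split at h₂
    · have := hf.time d (by omega) _ _ h₂; omega
    · have := hg.time d (by omega) _ _ h₂; omega

end Runs

/-- The analogue of `Runs` for a loop, with separate cut-offs for the loop and its parts. -/
structure LoopRuns (c b : Prog) (v : Val) (μ : PMF Val) (T : ℕ) : Prop where
  result : ∀ d n, T ≤ d → T ≤ n →
    Outcome.result (whileLoop (c.exec d) (b.exec d) n v) = μ.map some
  time : ∀ d n, T ≤ d → T ≤ n → ∀ w t,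
    some (w, t) ∈ (whileLoop (c.exec d) (b.exec d) n v).support → t ≤ T

namespace LoopRuns

variable {c b : Prog} {v a : Val} {μ : PMF Val} {κ : Val → PMF Val} {T T₁ T₂ : ℕ}

theorem runs (h : LoopRuns c b v μ T) : Runs (.loop c b) v μ T :=
  ⟨fun d hd => h.result d d hd hd, fun d hd => h.time d d hd hd⟩

theorem mono (h : LoopRuns c b v μ T) (hT : T ≤ T₁) : LoopRuns c b v μ T₁ :=
  ⟨fun d n hd hn => h.result d n (hT.trans hd) (hT.trans hn),
    fun d n hd hn w t hw => (h.time d n (hT.trans hd) (hT.trans hn) w t hw).trans hT⟩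

theorem of_isTrue_false (hc : Runs c v (PMF.pure a) T) (ha : a.isTrue = false) :
    LoopRuns c b v (PMF.pure v) (v.size + T) where
  result d n hd hn := by
    -- Even a loop that stops at once needs a cut-off of at least one test; the size of `v`
    -- guarantees it.
    have := v.size_pos
    obtain ⟨n, rfl⟩ : ∃ m, n = m + 1 := ⟨n - 1, by omega⟩
    rw [whileLoop, Outcome.result_charge, Outcome.result_andThen (μ := PMF.pure a)
      (κ := fun _ => PMF.pure v) _ _ (hc.result d (by omega)), PMF.pure_bind]
    intro x hx
    rw [PMF.support_pure, Set.mem_singleton_iff] at hx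
    simp [hx, ha, Outcome.result_ret]
  time d n hd hn w t h := by
    have := v.size_pos
    obtain ⟨n, rfl⟩ : ∃ m, n = m + 1 := ⟨n - 1, by omega⟩
    obtain ⟨t', h', rfl⟩ := Outcome.mem_support_charge.1 h
    obtain ⟨x, t₁, t₂, h₁, h₂, rfl⟩ := Outcome.mem_support_andThen.1 h'
    have hx := hc.mem_support (by omega) h₁
    rw [PMF.support_pure, Set.mem_singleton_iff] at hx
    simp only [hx, ha, Bool.false_eq_true, if_false, Outcome.mem_support_ret] at h₂
    have := hc.time d (by omega) _ _ h₁
    omega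

/-- Every test costs at least one unit, so after one iteration the lowered cut-off is still at least
`T₂`: a loop never makes more iterations than its time bound. -/
theorem step (hc : Runs c v (PMF.pure a) T) (ha : a.isTrue = true) (hb : Runs b v μ T₁)
    (hl : ∀ w ∈ μ.support, LoopRuns c b w (κ w) T₂) :
    LoopRuns c b v (μ.bind κ) (v.size + T + T₁ + T₂) where
  result d n hd hn := by
    have := v.size_pos
    obtain ⟨n, rfl⟩ : ∃ m, n = m + 1 := ⟨n - 1, by omega⟩
    rw [whileLoop, Outcome.result_charge, Outcome.result_andThen (μ := PMF.pure a)
      (κ := fun _ => μ.bind κ) _ _ (hc.result d (by omega)), PMF.pure_bind]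
    intro x hx
    rw [PMF.support_pure, Set.mem_singleton_iff] at hx
    simp only [hx, ha, if_true]
    exact Outcome.result_andThen _ _ (hb.result d (by omega))
      fun w hw => (hl w hw).result d n (by omega) (by omega)
  time d n hd hn w t h := by
    have := v.size_pos
    obtain ⟨n, rfl⟩ : ∃ m, n = m + 1 := ⟨n - 1, by omega⟩
    obtain ⟨t', h', rfl⟩ := Outcome.mem_support_charge.1 h
    obtain ⟨x, t₁, t₂, h₁, h₂, rfl⟩ := Outcome.mem_support_andThen.1 h'
    have hx := hc.mem_support (by omega) h₁
    rw [PMF.support_pure, Set.mem_singleton_iff] at hx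
    simp only [hx, ha, if_true] at h₂
    obtain ⟨y, t₃, t₄, h₃, h₄, rfl⟩ := Outcome.mem_support_andThen.1 h₂
    have := hc.time d (by omega) _ _ h₁
    have := hb.time d (by omega) _ _ h₃
    have := (hl y (hb.mem_support (by omega) h₃)).time d n (by omega) (by omega) _ _ h₄
    omega

end LoopRuns

/-! ### Polynomial time functions on data -/

/-- The random function `f` on data is computed in polynomial time. -/
def IsPPT (f : Val → PMF Val) : Prop :=
  ∃ (p : Prog) (q : Polynomial ℕ), ∀ v, Runs p v (f v) (q.eval v.size)

/-- The function `f` on data is computed in polynomial time. -/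
def IsPT (f : Val → Val) : Prop := IsPPT fun v => PMF.pure (f v)

theorem IsPPT.size_le {f : Val → PMF Val} (hf : IsPPT f) :
    ∃ q : Polynomial ℕ, ∀ v, ∀ w ∈ (f v).support, w.size ≤ q.eval v.size := by
  obtain ⟨p, q, h⟩ := hf
  exact ⟨q, fun v w hw => (h v).size_le hw⟩

theorem IsPT.size_le {f : Val → Val} (hf : IsPT f) :
    ∃ q : Polynomial ℕ, ∀ v, (f v).size ≤ q.eval v.size := by
  obtain ⟨q, h⟩ := IsPPT.size_le hf
  exact ⟨q, fun v => h v _ (by simp)⟩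

theorem IsPT.id : IsPT fun v => v :=
  ⟨.ident, .X, fun v => by simpa using Runs.of_ret (p := .ident) fun _ => rfl⟩

theorem IsPT.nil : IsPT fun _ => .nil :=
  ⟨.empty, .X, fun v => by simpa using Runs.of_ret (p := .empty) fun _ => rfl⟩

theorem IsPPT.comp {f : Val → PMF Val} {g : Val → Val} (hf : IsPPT f) (hg : IsPT g) :
    IsPPT fun v => f (g v) := by
  obtain ⟨p, q, hp⟩ := hf
  obtain ⟨p', q', hp'⟩ := hg
  refine ⟨.seq p' p, q' + q.comp q', fun v => ?_⟩
  have := (hp' v).seq (κ := f) (g := p) (T₂ := q.eval (q'.eval v.size)) fun w hw =>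
    (hp w).mono (polynomial_eval_mono q ((hp' v).size_le hw))
  simpa [PMF.pure_bind] using this

theorem IsPT.comp {f : Val → Val} {g : Val → Val} (hf : IsPT f) (hg : IsPT g) :
    IsPT fun v => f (g v) :=
  IsPPT.comp (f := fun v => PMF.pure (f v)) hf hg

theorem IsPT.hd {f : Val → Val} (hf : IsPT f) : IsPT fun v => (f v).hd :=
  IsPT.comp (f := Val.hd)
    ⟨.hd, .X, fun v => by simpa using Runs.of_ret (p := .hd) fun _ => rfl⟩ hf

theorem IsPT.tl {f : Val → Val} (hf : IsPT f) : IsPT fun v => (f v).tl :=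
  IsPT.comp (f := Val.tl)
    ⟨.tl, .X, fun v => by simpa using Runs.of_ret (p := .tl) fun _ => rfl⟩ hf

theorem IsPT.node {f g : Val → Val} (hf : IsPT f) (hg : IsPT g) :
    IsPT fun v => .node (f v) (g v) := by
  obtain ⟨p, q, hp⟩ := hf
  obtain ⟨p', q', hp'⟩ := hg
  refine ⟨.pair p p', .X + q + q', fun v => ?_⟩
  simpa [PMF.pure_bind] using (hp v).pair (hp' v)

/-- The program pairs the sample with a copy of the input and continues on the pair. Hence the
sample is `e.hd` and the older variables are in `e.tl`; nested binds thus form an environment. -/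
theorem IsPPT.bind {f : Val → PMF Val} {h : Val → Val → PMF Val} (hf : IsPPT f)
    (hh : IsPPT fun e => h e.tl e.hd) : IsPPT fun v => (f v).bind (h v) := by
  obtain ⟨p, q, hp⟩ := hf
  obtain ⟨p', q', hp'⟩ := hh
  refine ⟨.seq (.pair p .ident) p', (.X + q + .X) + q'.comp (.X + q + .X), fun v => ?_⟩
  have h₁ : Runs .ident v (PMF.pure v) v.size := Runs.of_ret (p := .ident) fun _ => rfl
  have := ((hp v).pair h₁).seq (g := p') (κ := fun e => h e.tl e.hd)
    (T₂ := q'.eval (v.size + q.eval v.size + v.size)) fun w hw =>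
      (hp' w).mono (polynomial_eval_mono q' (((hp v).pair h₁).size_le hw))
  simpa [PMF.pure_bind, PMF.bind_bind, Val.hd, Val.tl] using this

theorem IsPPT.ite {c : Val → Val} {f g : Val → PMF Val} (hc : IsPT c) (hf : IsPPT f)
    (hg : IsPPT g) : IsPPT fun v => if (c v).isTrue then f v else g v := by
  obtain ⟨p, q, hp⟩ := hf
  obtain ⟨p', q', hp'⟩ := hg
  obtain ⟨p₀, q₀, hp₀⟩ := hc
  refine ⟨.cond p₀ p p', .X + q₀ + q + q', fun v => ?_⟩
  simpa using (hp₀ v).cond (hp v) (hp' v)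

theorem IsPT.ite {c f g : Val → Val} (hc : IsPT c) (hf : IsPT f) (hg : IsPT g) :
    IsPT fun v => if (c v).isTrue then f v else g v := by
  have := IsPPT.ite hc hf hg
  refine (iff_of_eq (congrArg IsPPT ?_)).1 this
  funext v
  exact (apply_ite PMF.pure _ _ _).symm

theorem IsPPT.pick {f : Val → Val} (hf : IsPT f) : IsPPT fun v => pickElem (f v) :=
  IsPPT.comp (f := pickElem) ⟨.pick, .X, fun v => by simpa using Runs.pick⟩ hf

/-- At the cut-off `A.bound` no run is cut off, so larger cut-offs change nothing, and the default
value `.nil` in `PPT.eval` never occurs. -/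
theorem PPT.runs (A : PPT) (v : Val) : Runs A.prog v (A.eval v) (A.bound.eval v.size) := by
  have hn : none ∉ (A.prog.exec (A.bound.eval v.size) v).support := fun h => by
    obtain ⟨w, t, h, -⟩ := A.halts v _ h
    simp at h
  refine ⟨fun d hd => ?_, fun d hd w t h => ?_⟩
  · rw [Prog.exec_eq_of_le hd _ _ hn, PPT.eval, PMF.map_comp, Outcome.result]
    refine (PMF.bind_pure_comp _ _).symm.trans (Eq.trans ?_ (PMF.bind_pure_comp _ _))
    refine pmf_bind_congr ?_
    rintro (_ | ⟨w, t⟩) h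
    · exact absurd h hn
    · rfl
  · rw [Prog.exec_eq_of_le hd _ _ hn] at h
    obtain ⟨w', t', h, ht⟩ := A.halts v _ h
    simp only [Option.some.injEq, Prod.mk.injEq] at h
    omega

theorem PPT.isPPT (A : PPT) : IsPPT A.eval := ⟨A.prog, A.bound, A.runs⟩

theorem IsPPT.exists_ppt {f : Val → PMF Val} (hf : IsPPT f) : ∃ A : PPT, ∀ v, A.eval v = f v := by
  obtain ⟨p, q, h⟩ := hf
  refine ⟨⟨p, q, fun v o ho => ?_⟩, fun v => ?_⟩
  · cases o with
    | none => exact absurd ho ((h v).none_notMem le_rfl)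
    | some o => exact ⟨o.1, o.2, rfl, (h v).time _ le_rfl _ _ ho⟩
  · have : ∀ o : Option (Val × ℕ), (o.map Prod.fst).getD .nil =
        ((fun o : Option Val => o.getD .nil) ∘ Option.map Prod.fst) o := fun _ => rfl
    simp only [PPT.eval, this]
    have e := (h v).result _ le_rfl
    rw [Outcome.result] at e
    rw [show (fun o : Option (Val × ℕ) =>
      ((fun o : Option Val => o.getD .nil) ∘ Option.map Prod.fst) o) =
      (fun o : Option Val => o.getD .nil) ∘ Option.map Prod.fst from rfl, ← PMF.map_comp, e,
      PMF.map_comp]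
    exact PMF.map_id _

/-! ### Folds over lists -/

/-- Left fold of a random function over a list. -/
noncomputable def pfold (s : Val → Val → PMF Val) : List Val → Val → PMF Val
  | [], a => PMF.pure a
  | x :: l, a => (s x a).bind (pfold s l)

theorem pfold_append (s : Val → Val → PMF Val) (l l' : List Val) (a : Val) :
    pfold s (l ++ l') a = (pfold s l a).bind (pfold s l') := by
  induction l generalizing a with
  | nil => simp [pfold, PMF.pure_bind]
  | cons x l ih =>
    simp only [List.cons_append, pfold, PMF.bind_bind]
    exact congrArg _ (funext fun b => ih b)

theorem pfold_pure (s : Val → Val → Val) (l : List Val) (a : Val) :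
    pfold (fun x a => PMF.pure (s x a)) l a = PMF.pure (l.foldl (fun a x => s x a) a) := by
  induction l generalizing a with
  | nil => rfl
  | cons x l ih => simp only [pfold, PMF.pure_bind, ih, List.foldl_cons]

theorem Val.size_tl_lt_of_isTrue {v : Val} (h : v.isTrue = true) : v.tl.size < v.size := by
  cases v <;> simp [isTrue, tl, size] at *

theorem Val.toList_eq_cons {v : Val} (h : v.isTrue = true) :
    v.toList = v.hd :: v.tl.toList := by
  cases v <;> simp [isTrue, toList, hd, tl] at *

/-- A fold whose intermediate values have polynomial size takes polynomial time. -/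
theorem IsPPT.pfold {s : Val → Val → Val → PMF Val} {l a : Val → Val}
    (hs : IsPPT fun e => s e.hd e.tl.hd e.tl.tl) (hl : IsPT l) (ha : IsPT a)
    (hB : ∃ B : Polynomial ℕ, ∀ v, ∀ l', l' <+: (l v).toList →
      ∀ w ∈ (pfold (s v) l' (a v)).support, w.size ≤ B.eval v.size) :
    IsPPT fun v => pfold (s v) (l v).toList (a v) := by
  obtain ⟨B, hB⟩ := hB
  obtain ⟨ql, hql⟩ := hl.size_le
  -- the state of the loop is `node list (node accumulator environment)`
  have hbody : IsPPT fun e => (s e.tl.tl e.hd.hd e.tl.hd).bind fun r =>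
      PMF.pure (.node e.hd.tl (.node r e.tl.tl)) := by
    have h₁ : IsPPT fun e => s e.tl.tl e.hd.hd e.tl.hd :=
      IsPPT.comp (g := fun e => .node e.tl.tl (.node e.hd.hd e.tl.hd)) hs
        (IsPT.id.tl.tl.node (IsPT.id.hd.hd.node IsPT.id.tl.hd))
    exact IsPPT.bind h₁ (IsPT.id.tl.hd.tl.node (IsPT.id.hd.node IsPT.id.tl.tl.tl))
  obtain ⟨pc, qc, hpc⟩ := IsPT.id.hd
  obtain ⟨pb, qb, hpb⟩ := hbody
  -- `N` bounds the size of the loop state (list, accumulator, input and two nodes), and `Q` the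
  -- cost of one round: the charge for the test, the test and the body.
  let N : Polynomial ℕ := ql + B + .X + 2
  let Q : Polynomial ℕ := N + qc.comp N + qb.comp N
  -- The list `pre` of elements already processed witnesses that the accumulator `w` is reachable,
  -- so the bound `B` applies to it. The number `m` bounds the size of the remaining list and
  -- thereby the number of rounds.
  have key : ∀ v m n xs w, (∃ pre, pre ++ xs.toList = (l v).toList ∧
      w ∈ (QCStern.pfold (s v) pre (a v)).support) → xs.size ≤ ql.eval v.size → xs.size ≤ m →
      n = v.size → LoopRuns pc pb (.node xs (.node w v))
        ((QCStern.pfold (s v) xs.toList w).map fun r => .node .nil (.node r v))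
        ((m + 1) * Q.eval n) := by
    intro v m
    induction m with
    | zero => intro n xs w _ _ h; have := xs.size_pos; omega
    | succ m ih =>
      rintro n xs w ⟨pre, hpre, hw⟩ hxs hm rfl
      have hwB := hB v pre ⟨_, hpre⟩ w hw
      have hsize : (Val.node xs (.node w v)).size ≤ N.eval v.size := by
        simp only [Val.size, N, Polynomial.eval_add, Polynomial.eval_X, Polynomial.eval_ofNat]
        omega
      have hc := (hpc (.node xs (.node w v))).mono (polynomial_eval_mono qc hsize)
      have hb := (hpb (.node xs (.node w v))).mono (polynomial_eval_mono qb hsize)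
      simp only [Val.hd, Val.tl] at hc hb
      have hQ : Q.eval v.size = N.eval v.size + qc.eval (N.eval v.size) +
          qb.eval (N.eval v.size) := by
        simp [Q]
      cases hx : xs.isTrue with
      | false =>
        have := LoopRuns.of_isTrue_false (b := pb) hc hx
        cases xs with
        | node _ _ => simp [Val.isTrue] at hx
        | nil =>
          simp only [Val.toList, QCStern.pfold, PMF.pure_map]
          refine this.mono ?_
          rw [hQ]
          nlinarith
      | true =>
        rw [Val.toList_eq_cons hx] at hpre ⊢
        have hlt := Val.size_tl_lt_of_isTrue hx
        have := LoopRuns.step (κ := fun e =>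
          (QCStern.pfold (s v) e.hd.toList e.tl.hd).map fun r => .node .nil (.node r v))
          (T₂ := (m + 1) * Q.eval v.size) hc hx hb ?_
        · simp only [QCStern.pfold, PMF.map_bind, PMF.bind_bind, PMF.pure_bind, Val.hd,
            Val.tl] at this ⊢
          refine this.mono ?_
          rw [hQ]
          nlinarith
        · intro e he
          simp only [PMF.mem_support_bind_iff, PMF.mem_support_pure_iff] at he
          obtain ⟨r, hr, rfl⟩ := he
          refine ih v.size xs.tl r ⟨pre ++ [xs.hd], by simpa using hpre, ?_⟩ (by omega) (by omega)
            rfl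
          rw [pfold_append, PMF.mem_support_bind_iff]
          refine ⟨w, hw, ?_⟩
          simp only [QCStern.pfold, PMF.bind_pure]
          exact hr
  have hloop : IsPPT fun v => (QCStern.pfold (s v) (l v).toList (a v)).map
      fun r => .node .nil (.node r v) := by
    obtain ⟨pi, qi, hpi⟩ := hl.node (ha.node IsPT.id)
    refine ⟨.seq pi (.loop pc pb), qi + (ql + 1) * Q, fun v => ?_⟩
    have := (hpi v).seq (κ := fun e =>
      (QCStern.pfold (s v) e.hd.toList e.tl.hd).map fun r => .node .nil (.node r v))
      (g := .loop pc pb) (T₂ := (ql.eval v.size + 1) * Q.eval v.size) ?_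
    · simpa [PMF.pure_bind, Val.hd, Val.tl] using this
    · intro e he
      rw [PMF.mem_support_pure_iff] at he
      subst he
      exact (key v _ _ (l v) (a v) ⟨[], rfl, by simp [QCStern.pfold]⟩ (hql v) (hql v) rfl).runs
  -- The loop returns its whole final state, from which the accumulator is extracted.
  have := hloop.bind (h := fun _ e => PMF.pure e.tl.hd) IsPT.id.hd.tl.hd
  refine (iff_of_eq (congrArg IsPPT ?_)).1 this
  funext v
  simp [PMF.bind_map, Function.comp_def, Val.hd, Val.tl]

/-- A factor per step could make the accumulator grow exponentially. Additive growth by `B` over at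
most `ql` steps keeps it below `qa + ql * B`. -/
theorem IsPPT.pfold_of_additive {s : Val → Val → Val → PMF Val} {l a : Val → Val}
    (hs : IsPPT fun e => s e.hd e.tl.hd e.tl.tl) (hl : IsPT l) (ha : IsPT a)
    (hB : ∃ B : Polynomial ℕ, ∀ v, ∀ x ∈ (l v).toList, ∀ a, ∀ w ∈ (s v x a).support,
      w.size ≤ a.size + B.eval v.size) :
    IsPPT fun v => QCStern.pfold (s v) (l v).toList (a v) := by
  obtain ⟨B, hB⟩ := hB
  obtain ⟨ql, hql⟩ := hl.size_le
  obtain ⟨qa, hqa⟩ := ha.size_le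
  refine IsPPT.pfold hs hl ha ⟨qa + ql * B, fun v l' hl' w hw => ?_⟩
  have key : ∀ (l' : List Val), (∀ x ∈ l', x ∈ (l v).toList) → ∀ a,
      ∀ w ∈ (QCStern.pfold (s v) l' a).support, w.size ≤ a.size + l'.length * B.eval v.size := by
    intro l'
    induction l' with
    | nil => intro _ a w hw; simp [QCStern.pfold] at hw; simp [hw]
    | cons x l' ih =>
      intro h a w hw
      simp only [QCStern.pfold, PMF.mem_support_bind_iff] at hw
      obtain ⟨b, hb, hw⟩ := hw
      have h₁ := hB v x (h x (by simp)) a b hb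
      have h₂ := ih (fun x hx => h x (by simp [hx])) b w hw
      simp only [List.length_cons]
      nlinarith
  have h₁ := key l' (fun x hx => hl'.subset hx) _ w hw
  have h₂ : l'.length ≤ ql.eval v.size := hl'.length_le.trans ((Val.length_toList_le _).trans (hql v))
  have := hqa v
  simp only [Polynomial.eval_add, Polynomial.eval_mul]
  nlinarith [Nat.mul_le_mul_right (B.eval v.size) h₂]

theorem IsPT.foldl {s : Val → Val → Val → Val} {l a : Val → Val}
    (hs : IsPT fun e => s e.hd e.tl.hd e.tl.tl) (hl : IsPT l) (ha : IsPT a)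
    (hB : ∃ B : Polynomial ℕ, ∀ v, ∀ l', l' <+: (l v).toList →
      (l'.foldl (fun a x => s v x a) (a v)).size ≤ B.eval v.size) :
    IsPT fun v => (l v).toList.foldl (fun a x => s v x a) (a v) := by
  obtain ⟨B, hB⟩ := hB
  have := IsPPT.pfold (s := fun v x a => PMF.pure (s v x a)) hs hl ha
    ⟨B, fun v l' hl' w hw => by
      rw [pfold_pure, PMF.mem_support_pure_iff] at hw
      exact hw ▸ hB v l' hl'⟩
  simpa only [pfold_pure, IsPT] using this

theorem IsPT.foldl_of_additive {s : Val → Val → Val → Val} {l a : Val → Val}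
    (hs : IsPT fun e => s e.hd e.tl.hd e.tl.tl) (hl : IsPT l) (ha : IsPT a)
    (hB : ∃ B : Polynomial ℕ, ∀ v, ∀ x ∈ (l v).toList, ∀ a,
      (s v x a).size ≤ a.size + B.eval v.size) :
    IsPT fun v => (l v).toList.foldl (fun a x => s v x a) (a v) := by
  obtain ⟨B, hB⟩ := hB
  have := IsPPT.pfold_of_additive (s := fun v x a => PMF.pure (s v x a)) hs hl ha
    ⟨B, fun v x hx a w hw => by
      rw [PMF.mem_support_pure_iff] at hw
      exact hw ▸ hB v x hx a⟩
  simpa only [pfold_pure, IsPT] using this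

/-! ### Lists -/

/-- The datum that represents a list. -/
def ofList : List Val → Val
  | [] => .nil
  | x :: l => .node x (ofList l)

@[simp] theorem toList_ofList (l : List Val) : (ofList l).toList = l := by
  induction l with
  | nil => rfl
  | cons x l ih => simp only [ofList, Val.toList, ih]

@[simp] theorem ofList_toList (v : Val) : ofList v.toList = v := by
  induction v with
  | nil => rfl
  | node x l _ ih => simp only [Val.toList, ofList, ih]

theorem encList_eq {α : Type} (e : α → Val) (l : List α) : encList e l = ofList (l.map e) := by
  induction l with
  | nil => rfl
  | cons x l ih => simp only [encList, List.map_cons, ofList, ih]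

@[simp] theorem toList_encList {α : Type} (e : α → Val) (l : List α) :
    (encList e l).toList = l.map e := by
  rw [encList_eq, toList_ofList]

theorem encBits_eq (l : List Bool) : encBits l = ofList (l.map encBool) := encList_eq _ _

@[simp] theorem toList_encBits (l : List Bool) : (encBits l).toList = l.map encBool :=
  toList_encList _ _

theorem encNat_eq (n : ℕ) : encNat n = ofList (List.replicate n .nil) := by
  induction n with
  | zero => rfl
  | succ n ih => simp only [encNat, List.replicate_succ, ofList, ih]

@[simp] theorem toList_encNat (n : ℕ) : (encNat n).toList = List.replicate n .nil := by
  rw [encNat_eq, toList_ofList]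

@[simp] theorem isTrue_encBool (b : Bool) : (encBool b).isTrue = b := by
  cases b <;> rfl

theorem size_ofList (l : List Val) : (ofList l).size = 1 + (l.map fun x => 1 + x.size).sum := by
  induction l with
  | nil => rfl
  | cons x l ih => simp only [ofList, Val.size, ih, List.map_cons, List.sum_cons]; omega

theorem size_ofList_le {l : List Val} {B : ℕ} (h : ∀ x ∈ l, x.size ≤ B) :
    (ofList l).size ≤ 1 + l.length * (1 + B) := by
  induction l with
  | nil => simp [ofList, Val.size]
  | cons x l ih =>
    have h₁ := h x (by simp)
    have h₂ := ih fun y hy => h y (by simp [hy])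
    simp only [ofList, Val.size, List.length_cons]
    nlinarith

theorem size_encNat (n : ℕ) : (encNat n).size = 2 * n + 1 := by
  induction n with
  | zero => rfl
  | succ n ih => simp only [encNat, Val.size, ih]; omega

theorem size_encBool_le (b : Bool) : (encBool b).size ≤ 3 := by
  cases b <;> simp [encBool, Val.size]

theorem size_encList_le {α : Type} {e : α → Val} {l : List α} {B : ℕ}
    (h : ∀ x ∈ l, (e x).size ≤ B) : (encList e l).size ≤ 1 + l.length * (1 + B) := by
  rw [encList_eq]
  refine (size_ofList_le (B := B) ?_).trans (by simp)
  simpa using h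

theorem size_encBits_le (l : List Bool) : (encBits l).size ≤ 1 + l.length * 4 :=
  size_encList_le fun b _ => size_encBool_le b

theorem length_le_size_encBits (l : List Bool) : l.length ≤ (encBits l).size := by
  simpa using (encBits l).length_toList_le

namespace Val

/-- Reversal of a list. -/
def rev (v : Val) : Val := ofList v.toList.reverse

/-- Concatenation of two lists. -/
def append (a b : Val) : Val := ofList (a.toList ++ b.toList)

/-- Image of a list under a function. -/
def map (f : Val → Val) (v : Val) : Val := ofList (v.toList.map f)

/-- Concatenation of the lists that a function assigns to the elements of a list. -/
def flatMap (f : Val → Val) (v : Val) : Val := ofList (v.toList.flatMap fun x => (f x).toList)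

/-- The list `v` without its first elements, as many as `c` has. -/
def drop (c v : Val) : Val := c.toList.foldl (fun a _ => a.tl) v

theorem size_rev (v : Val) : v.rev.size = v.size := by
  conv_rhs => rw [← ofList_toList v]
  rw [rev, size_ofList, size_ofList, List.map_reverse, List.sum_reverse]

end Val

theorem ofList_append_foldl (l : List Val) (a : Val) :
    l.foldl (fun a x => Val.node x a) a = ofList (l.reverse ++ a.toList) := by
  induction l generalizing a with
  | nil => simp
  | cons x l ih => simp [ih, Val.toList]

/-- A bound for the elements of a list that is computed in polynomial time. -/
theorem IsPT.exists_mem_size_le {l : Val → Val} (hl : IsPT l) :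
    ∃ q : Polynomial ℕ, ∀ v, ∀ x ∈ (l v).toList, x.size ≤ q.eval v.size := by
  obtain ⟨q, hq⟩ := hl.size_le
  exact ⟨q, fun v x hx => (Val.size_le_of_mem_toList hx).trans (hq v)⟩

theorem IsPT.foldl_cons {l a : Val → Val} (hl : IsPT l) (ha : IsPT a) :
    IsPT fun v => (l v).toList.foldl (fun a x => .node x a) (a v) := by
  obtain ⟨q, hq⟩ := hl.exists_mem_size_le
  refine IsPT.foldl_of_additive (s := fun _ x a => .node x a)
    (IsPT.id.tl.hd.node IsPT.id.tl.tl) hl ha ⟨q + 1, fun v x hx a => ?_⟩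
  have := hq v x hx
  simp only [Val.size, Polynomial.eval_add, Polynomial.eval_one]
  omega

theorem IsPT.congr {f g : Val → Val} (hf : IsPT f) (h : ∀ v, f v = g v) : IsPT g :=
  funext h ▸ hf

theorem IsPT.rev {l : Val → Val} (hl : IsPT l) : IsPT fun v => (l v).rev :=
  (hl.foldl_cons IsPT.nil).congr fun v => by simp [ofList_append_foldl, Val.toList, Val.rev]

theorem IsPT.append {a b : Val → Val} (ha : IsPT a) (hb : IsPT b) :
    IsPT fun v => (a v).append (b v) :=
  (ha.rev.foldl_cons hb).congr fun v => by rw [ofList_append_foldl]; simp [Val.rev, Val.append]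

theorem IsPT.exists_apply_size_le {f : Val → Val → Val} {l : Val → Val}
    (hf : IsPT fun e => f e.hd e.tl) (hl : IsPT l) :
    ∃ q : Polynomial ℕ, ∀ v, ∀ x ∈ (l v).toList, (f v x).size ≤ q.eval v.size := by
  obtain ⟨q, hq⟩ := hl.exists_mem_size_le
  obtain ⟨qf, hqf⟩ := hf.size_le
  refine ⟨qf.comp (1 + .X + q), fun v x hx => (hqf (.node v x)).trans ?_⟩
  rw [Polynomial.eval_comp]
  refine polynomial_eval_mono qf ?_
  have := hq v x hx
  simp only [Val.size, Polynomial.eval_add, Polynomial.eval_one, Polynomial.eval_X]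
  omega

/-- Consing reverses the order, so the fold runs over the reversed list. -/
theorem IsPT.map {f : Val → Val → Val} {l : Val → Val} (hf : IsPT fun e => f e.hd e.tl)
    (hl : IsPT l) : IsPT fun v => (l v).map (f v) := by
  obtain ⟨q, hq⟩ := hf.exists_apply_size_le hl.rev
  have hs : IsPT fun e => .node (f e.hd e.tl.hd) e.tl.tl :=
    (IsPT.comp (g := fun e => .node e.hd e.tl.hd) hf
      (IsPT.id.hd.node IsPT.id.tl.hd)).node IsPT.id.tl.tl
  refine (IsPT.foldl_of_additive (s := fun v x a => .node (f v x) a) hs hl.rev IsPT.nil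
    ⟨q + 1, fun v x hx a => ?_⟩).congr fun v => ?_
  · have := hq v x hx
    simp only [Val.size, Polynomial.eval_add, Polynomial.eval_one]
    omega
  · have := ofList_append_foldl ((l v).rev.toList.map (f v)) .nil
    rw [List.foldl_map] at this
    rw [this]
    simp [Val.rev, Val.map, Val.toList]

theorem size_append_le (a b : Val) : (a.append b).size ≤ a.size + b.size := by
  conv_rhs => rw [← ofList_toList a, ← ofList_toList b]
  simp only [Val.append, size_ofList, List.map_append, List.sum_append]
  omega

theorem IsPT.flatMap {f : Val → Val → Val} {l : Val → Val} (hf : IsPT fun e => f e.hd e.tl)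
    (hl : IsPT l) : IsPT fun v => (l v).flatMap (f v) := by
  obtain ⟨q, hq⟩ := hf.exists_apply_size_le hl.rev
  have hs : IsPT fun e => (f e.hd e.tl.hd).append e.tl.tl :=
    (IsPT.comp (g := fun e => .node e.hd e.tl.hd) hf
      (IsPT.id.hd.node IsPT.id.tl.hd)).append IsPT.id.tl.tl
  refine (IsPT.foldl_of_additive (s := fun v x a => (f v x).append a) hs hl.rev IsPT.nil
    ⟨q, fun v x hx a => ?_⟩).congr fun v => ?_
  · have := hq v x hx
    have := size_append_le (f v x) a
    omega
  · have key : ∀ (l : List Val), l.reverse.foldl (fun a x => (f v x).append a) .nil =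
        ofList (l.flatMap fun x => (f v x).toList) := by
      intro l
      induction l with
      | nil => rfl
      | cons x l ih =>
        rw [List.reverse_cons, List.foldl_append, ih]
        simp [Val.append]
    simp only [Val.rev, toList_ofList]
    rw [key]
    rfl

theorem IsPT.drop {c u : Val → Val} (hc : IsPT c) (hu : IsPT u) :
    IsPT fun v => (c v).drop (u v) :=
  IsPT.foldl_of_additive (s := fun _ _ a => a.tl) IsPT.id.tl.tl.tl hc hu
    ⟨0, fun _ _ _ a => by simpa using a.size_tl_le⟩

/-- The list `[0, …, n - 1]`, where `n` is the length of `v`. -/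
def Val.range (v : Val) : Val :=
  ((v.toList.foldl (fun a _ => Val.node (.node .nil a.hd) a) Val.nil).map Val.tl).rev

/-- The accumulator is `[n, …, 1]`: each step puts the successor of the head in front, and the head
of `.nil` is `.nil`, the code of 0. Lowering all entries by one and reversing gives `[0, …, n - 1]`.
-/
theorem foldl_range (n : ℕ) (l : List Val) (hl : l.length = n) :
    l.foldl (fun a _ => Val.node (.node .nil a.hd) a) .nil =
      ofList ((List.range n).map fun i => encNat (i + 1)).reverse := by
  induction l using List.reverseRecOn generalizing n with
  | nil => subst hl; rfl
  | append_singleton l x ih =>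
    subst hl
    rw [List.foldl_append, ih _ rfl]
    simp only [List.foldl_cons, List.foldl_nil, List.length_append, List.length_singleton,
      List.range_succ, List.map_append, List.map_cons, List.map_nil, List.reverse_append,
      List.reverse_cons, List.reverse_nil, List.nil_append, List.singleton_append, ofList]
    congr 1
    cases h : l.length with
    | zero => rfl
    | succ m => simp [List.range_succ, ofList, Val.hd, encNat]

theorem range_encNat (n : ℕ) : (encNat n).range = encList encNat (List.range n) := by
  rw [Val.range, foldl_range n _ (by simp), Val.map, Val.rev, encList_eq]
  simp [Function.comp_def, encNat, Val.tl]

theorem IsPT.range {l : Val → Val} (hl : IsPT l) : IsPT fun v => (l v).range := by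
  obtain ⟨q, hq⟩ := hl.size_le
  -- The growth in a step depends on the head of the accumulator, so the additive criterion does not
  -- apply; the explicit bound comes from `q` entries of size at most `2 * q + 1`.
  refine IsPT.rev (IsPT.map (f := fun _ x => x.tl) IsPT.id.tl.tl (IsPT.foldl
    (s := fun _ _ a => .node (.node .nil a.hd) a)
    ((IsPT.nil.node IsPT.id.tl.tl.hd).node IsPT.id.tl.tl) hl IsPT.nil
    ⟨1 + q * (2 * q + 4), fun v l' hl' => ?_⟩))
  have h₁ : l'.length ≤ q.eval v.size :=
    hl'.length_le.trans ((l v).length_toList_le.trans (hq v))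
  rw [foldl_range _ _ rfl]
  refine (size_ofList_le (B := 2 * q.eval v.size + 1) ?_).trans ?_
  · intro x hx
    simp only [List.mem_reverse, List.mem_map, List.mem_range] at hx
    obtain ⟨i, hi, rfl⟩ := hx
    rw [size_encNat]
    omega
  · simp only [List.length_reverse, List.length_map, List.length_range, Polynomial.eval_add,
      Polynomial.eval_one, Polynomial.eval_mul, Polynomial.eval_ofNat]
    nlinarith

/-! ### Bit strings -/

/-- Exclusive or of two bits. -/
def Val.bitXor (a b : Val) : Val :=
  if a.isTrue then (if b.isTrue then .nil else .node .nil .nil)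
  else (if b.isTrue then .node .nil .nil else .nil)

/-- Conjunction of two bits. -/
def Val.bitAnd (a b : Val) : Val :=
  if a.isTrue then (if b.isTrue then .node .nil .nil else .nil) else .nil

theorem bitXor_encBool (a b : Bool) : (encBool a).bitXor (encBool b) = encBool (a ^^ b) := by
  cases a <;> cases b <;> rfl

theorem bitAnd_encBool (a b : Bool) : (encBool a).bitAnd (encBool b) = encBool (a && b) := by
  cases a <;> cases b <;> rfl

theorem size_bitXor_le (a b : Val) : (a.bitXor b).size ≤ 3 := by
  unfold Val.bitXor
  split <;> split <;> simp [Val.size]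

theorem IsPT.true : IsPT fun _ => .node .nil .nil := IsPT.nil.node IsPT.nil

theorem IsPT.bitXor {a b : Val → Val} (ha : IsPT a) (hb : IsPT b) :
    IsPT fun v => (a v).bitXor (b v) :=
  ha.ite (hb.ite IsPT.nil IsPT.true) (hb.ite IsPT.true IsPT.nil)

theorem IsPT.bitAnd {a b : Val → Val} (ha : IsPT a) (hb : IsPT b) :
    IsPT fun v => (a v).bitAnd (b v) :=
  ha.ite (hb.ite IsPT.true IsPT.nil) IsPT.nil

/-- Bitwise exclusive or of two bit strings, of the length of the first one. -/
def Val.xor (a b : Val) : Val :=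
  (a.toList.foldl (fun s x => Val.node s.hd.tl (.node (x.bitXor s.hd.hd) s.tl))
    (.node b .nil)).tl.rev

theorem IsPT.xor {a b : Val → Val} (ha : IsPT a) (hb : IsPT b) :
    IsPT fun v => (a v).xor (b v) := by
  have := IsPT.foldl_of_additive
    (s := fun _ x s => Val.node s.hd.tl (.node (x.bitXor s.hd.hd) s.tl))
    (IsPT.id.tl.tl.hd.tl.node ((IsPT.id.tl.hd.bitXor IsPT.id.tl.tl.hd.hd).node IsPT.id.tl.tl.tl))
    ha (hb.node IsPT.nil) ⟨10, fun v x hx a => ?_⟩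
  · exact this.tl.rev
  · have h := size_bitXor_le x a.hd.hd
    have h₁ := a.hd.size_tl_le
    cases a <;> simp only [Val.size, Val.hd, Val.tl, Polynomial.eval_ofNat] at * <;> omega

/-- The state consists of the unread part of `b` and of the output so far in reverse order. -/
theorem foldl_xor (a b : List Bool) (o : List Val) (h : a.length ≤ b.length) :
    (a.map encBool).foldl (fun s x => Val.node s.hd.tl (.node (x.bitXor s.hd.hd) s.tl))
      (.node (ofList (b.map encBool)) (ofList o)) =
    .node (ofList ((b.drop a.length).map encBool))
      (ofList (((List.zipWith Bool.xor a b).map encBool).reverse ++ o)) := by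
  induction a generalizing b o with
  | nil => simp
  | cons x a ih =>
    cases b with
    | nil => simp at h
    | cons y b =>
      have := ih b (encBool (x ^^ y) :: o) (by simpa using h)
      simpa [ofList, Val.hd, Val.tl, bitXor_encBool] using this

theorem xor_encBits (a b : List Bool) (h : a.length ≤ b.length) :
    (encBits a).xor (encBits b) = encBits (List.zipWith Bool.xor a b) := by
  have := foldl_xor a b [] h
  rw [Val.xor, toList_encBits, encBits_eq b]
  simp only [ofList] at this
  rw [this, encBits_eq]
  simp [Val.tl, Val.rev]

/-- The bound does not involve `b`. In `IsPT.mulQC` the accumulator is the second argument, so its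
growth stays additive. -/
theorem size_xor_le (a b : Val) : (a.xor b).size ≤ 4 * a.size + 1 := by
  have key : ∀ (l : List Val) (s : Val),
      (l.foldl (fun s x => Val.node s.hd.tl (.node (x.bitXor s.hd.hd) s.tl)) s).tl.size ≤
        s.tl.size + 4 * l.length := by
    intro l
    induction l with
    | nil => simp
    | cons x l ih =>
      intro s
      refine (ih _).trans ?_
      have := size_bitXor_le x s.hd.hd
      simp only [Val.tl, Val.size, List.length_cons]
      omega
  have h₁ := key a.toList (.node b .nil)
  have h₂ := a.length_toList_le
  rw [Val.xor, Val.size_rev]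
  simp only [Val.tl, Val.size] at h₁ ⊢
  omega

/-- The cyclic shift of a list by one position. -/
def Val.rotOne (v : Val) : Val := .node v.rev.hd v.rev.tl.rev

theorem rotOne_ofList (l : List Val) (x : Val) :
    (ofList (l ++ [x])).rotOne = ofList (x :: l) := by
  simp [Val.rotOne, Val.rev, ofList, Val.hd, Val.tl]

theorem size_rotOne_le (v : Val) : v.rotOne.size ≤ v.size + 2 := by
  rw [Val.rotOne, Val.size, Val.size_rev]
  have := v.size_rev
  cases h : v.rev with
  | nil => simpa [Val.hd, Val.tl, Val.size] using v.size_pos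
  | node a b => rw [h] at this; simp only [Val.hd, Val.tl, Val.size] at *; omega

theorem IsPT.rotOne {f : Val → Val} (hf : IsPT f) : IsPT fun v => (f v).rotOne :=
  hf.rev.hd.node hf.rev.tl.rev

/-- The cyclic shift of a list by as many positions as `n` has elements. -/
def Val.rot (n v : Val) : Val := n.toList.foldl (fun a _ => a.rotOne) v

theorem IsPT.rot {n f : Val → Val} (hn : IsPT n) (hf : IsPT f) :
    IsPT fun v => (n v).rot (f v) :=
  IsPT.foldl_of_additive (s := fun _ _ a => a.rotOne) IsPT.id.tl.tl.rotOne hn hf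
    ⟨2, fun _ _ _ a => by simpa using size_rotOne_le a⟩

/-- The product of the parity check matrix `[I A]`, where `A` is the circulant matrix of `a`, and
the vector `u`. -/
def Val.mulQC (a u : Val) : Val :=
  ((a.drop u).rev.toList.foldl (fun s x => if x.isTrue then a.xor s.rotOne else s.rotOne)
    (a.xor a)).xor u

theorem IsPT.mulQC {a u : Val → Val} (ha : IsPT a) (hu : IsPT u) :
    IsPT fun v => (a v).mulQC (u v) := by
  obtain ⟨q, hq⟩ := ha.size_le
  have ha' : IsPT fun e => a e.hd := IsPT.comp ha IsPT.id.hd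
  refine IsPT.xor (IsPT.foldl_of_additive
    (s := fun v x s => if x.isTrue then (a v).xor s.rotOne else s.rotOne)
    (IsPT.ite IsPT.id.tl.hd (ha'.xor IsPT.id.tl.tl.rotOne) IsPT.id.tl.tl.rotOne)
    (ha.drop hu).rev (ha.xor ha) ⟨4 * q + 2, fun v x _ s => ?_⟩) hu
  have h₁ := hq v
  have h₂ := size_rotOne_le s
  have h₃ := size_xor_le (a v) s.rotOne
  simp only [Polynomial.eval_add, Polynomial.eval_mul, Polynomial.eval_ofNat]
  split <;> omega

/-- The inner product of the first elements of `m` and of `x`, paired with the remaining elements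
of `m`. -/
def Val.dot (m x : Val) : Val :=
  x.toList.foldl (fun s y => Val.node s.hd.tl (s.tl.bitXor (s.hd.hd.bitAnd y))) (.node m .nil)

theorem IsPT.dot {m x : Val → Val} (hm : IsPT m) (hx : IsPT x) :
    IsPT fun v => (m v).dot (x v) :=
  IsPT.foldl_of_additive
    (s := fun _ y s => Val.node s.hd.tl (s.tl.bitXor (s.hd.hd.bitAnd y)))
    (IsPT.id.tl.tl.hd.tl.node (IsPT.id.tl.tl.tl.bitXor
      (IsPT.id.tl.tl.hd.hd.bitAnd IsPT.id.tl.hd))) hx (hm.node IsPT.nil)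
    ⟨10, fun v y _ s => by
      have h := size_bitXor_le s.tl (s.hd.hd.bitAnd y)
      have h₁ := s.hd.size_tl_le
      cases s <;> simp only [Val.size, Val.hd, Val.tl, Polynomial.eval_ofNat] at * <;> omega⟩

/-- Processing a row never enlarges the rest of the matrix and contributes a single bit, which makes
the fold in `IsPT.mulVec` additive. -/
theorem size_dot_le (m x : Val) : (m.dot x).hd.size ≤ m.size ∧ (m.dot x).tl.size ≤ 3 := by
  have key : ∀ (l : List Val) (s : Val), s.hd.size ≤ m.size → s.tl.size ≤ 3 →
      (l.foldl (fun s y => Val.node s.hd.tl (s.tl.bitXor (s.hd.hd.bitAnd y))) s).hd.size ≤ m.size ∧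
      (l.foldl (fun s y => Val.node s.hd.tl (s.tl.bitXor (s.hd.hd.bitAnd y))) s).tl.size ≤ 3 := by
    intro l
    induction l with
    | nil => exact fun s h₁ h₂ => ⟨h₁, h₂⟩
    | cons x l ih =>
      exact fun s h₁ h₂ => ih _ (s.hd.size_tl_le.trans h₁) (size_bitXor_le _ _)
  exact key _ _ le_rfl (by simp [Val.tl, Val.size])

/-- The product of a square matrix, given by the list of its entries, and the vector `x`. -/
def Val.mulVec (m x : Val) : Val :=
  (x.toList.foldl (fun s _ => Val.node (s.hd.dot x).hd (.node (s.hd.dot x).tl s.tl))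
    (.node m .nil)).tl.rev

theorem IsPT.mulVec {m x : Val → Val} (hm : IsPT m) (hx : IsPT x) :
    IsPT fun v => (m v).mulVec (x v) := by
  have hx' : IsPT fun e => x e.hd := IsPT.comp hx IsPT.id.hd
  have hd : IsPT fun e => e.tl.tl.hd.dot (x e.hd) := IsPT.id.tl.tl.hd.dot hx'
  refine (IsPT.foldl_of_additive
    (s := fun v _ s => Val.node (s.hd.dot (x v)).hd (.node (s.hd.dot (x v)).tl s.tl))
    (hd.hd.node (hd.tl.node IsPT.id.tl.tl.tl)) hx (hm.node IsPT.nil)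
    ⟨10, fun v y _ s => ?_⟩).tl.rev
  have h := size_dot_le s.hd (x v)
  cases s <;> simp only [Val.size, Val.hd, Val.tl, Polynomial.eval_ofNat] at * <;> omega

/-! ### Vectors and permutations -/

theorem encBits_append (a b : List Bool) :
    (encBits a).append (encBits b) = encBits (a ++ b) := by
  simp [Val.append, encBits_eq]

/-- The list of the `2k` coordinates. -/
def posList (k : ℕ) : List (Pos k) := List.ofFn Sum.inl ++ List.ofFn Sum.inr

theorem nodup_posList (k : ℕ) : (posList k).Nodup := by
  refine List.Nodup.append (List.nodup_ofFn.2 Sum.inl_injective)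
    (List.nodup_ofFn.2 Sum.inr_injective) ?_
  intro x hx hy
  simp only [List.mem_ofFn] at hx hy
  obtain ⟨i, rfl⟩ := hx
  obtain ⟨j, hj⟩ := hy
  simp at hj

theorem mem_posList {k : ℕ} (p : Pos k) : p ∈ posList k := by
  cases p <;> simp [posList]

@[simp] theorem length_posList (k : ℕ) : (posList k).length = 2 * k := by
  simp [posList]; omega

theorem vecBits₂_eq {k : ℕ} (x : Vec₂ k) :
    vecBits₂ x = (posList k).map fun p => decide (x p = 1) := by
  simp [vecBits₂, vecBits, posList, List.map_ofFn, Function.comp_def]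

theorem vecBits_eq {k : ℕ} (y : Vec k) :
    vecBits y = (List.finRange k).map fun i => decide (y i = 1) := by
  simp [vecBits, List.ofFn_eq_map]

theorem permBits_eq {k : ℕ} (π : Equiv.Perm (Pos k)) :
    permBits π = (posList k).flatMap fun i => (posList k).map fun j => decide (π j = i) := by
  simp only [permBits, posList, List.map_append, List.map_ofFn, Function.comp_def,
    List.flatMap_def, List.flatten_append]

@[simp] theorem length_vecBits {k : ℕ} (y : Vec k) : (vecBits y).length = k := by
  simp [vecBits]

@[simp] theorem length_vecBits₂ {k : ℕ} (x : Vec₂ k) : (vecBits₂ x).length = 2 * k := by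
  simp [vecBits₂_eq]

theorem length_permBits {k : ℕ} (π : Equiv.Perm (Pos k)) :
    (permBits π).length = 2 * k * (2 * k) := by
  simp [permBits_eq, List.length_flatMap]

theorem decide_add_eq_one : ∀ a b : ZMod 2,
    (decide (a = 1) ^^ decide (b = 1)) = decide (a + b = 1) := by
  decide

theorem xor_vecBits {k : ℕ} (y y' : Vec k) :
    (encBits (vecBits y)).xor (encBits (vecBits y')) = encBits (vecBits (y + y')) := by
  rw [xor_encBits _ _ (by simp)]
  simp [vecBits_eq, List.zipWith_map, List.zipWith_self, decide_add_eq_one]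

theorem xor_vecBits₂ {k : ℕ} (x x' : Vec₂ k) :
    (encBits (vecBits₂ x)).xor (encBits (vecBits₂ x')) = encBits (vecBits₂ (x + x')) := by
  rw [xor_encBits _ _ (by simp)]
  simp [vecBits₂_eq, List.zipWith_map, List.zipWith_self, decide_add_eq_one]

/-- `Val.xor` stops at the end of its first argument, so only the first block of `x` takes part.
This realises the identity block of the parity-check matrix. -/
theorem xor_vecBits_vecBits₂ {k : ℕ} (y : Vec k) (x : Vec₂ k) :
    (encBits (vecBits y)).xor (encBits (vecBits₂ x)) =
      encBits (vecBits (y + fun i => x (.inl i))) := by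
  rw [← xor_vecBits, xor_encBits _ _ (by simp; omega), xor_encBits _ _ (by simp), vecBits₂]
  congr 1
  refine List.ext_getElem (by simp) fun i h₁ h₂ => ?_
  simp at h₁
  simp [h₁]

theorem ofNat_succ_eq (k : ℕ) [NeZero k] (j : ℕ) :
    Fin.ofNat k (j + 1) = 1 + Fin.ofNat k j := by
  ext
  simp [Fin.val_add, Nat.add_comm]

theorem rot_rot_one {k : ℕ} [NeZero k] (j : ℕ) (y : Vec k) :
    rot (Fin.ofNat k j) (rot 1 y) = rot (Fin.ofNat k (j + 1)) y := by
  funext i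
  simp only [rot, ofNat_succ_eq]
  congr 1
  abel

theorem rotOne_vecBits {k : ℕ} [NeZero k] (y : Vec k) :
    (encBits (vecBits y)).rotOne = encBits (vecBits (rot 1 y)) := by
  obtain ⟨n, rfl⟩ : ∃ n, k = n + 1 := ⟨k - 1, (Nat.succ_pred (NeZero.ne k)).symm⟩
  have h₁ : vecBits y = List.ofFn (fun i : Fin n => decide (y i.castSucc = 1)) ++
      [decide (y (Fin.last n) = 1)] := by
    rw [vecBits, List.ofFn_succ_last]
  have h₂ : vecBits (rot 1 y) = decide (y (Fin.last n) = 1) ::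
      List.ofFn (fun i : Fin n => decide (y i.castSucc = 1)) := by
    rw [vecBits, List.ofFn_succ]
    have h₃ : (0 : Fin (n + 1)) - 1 = Fin.last n := by
      rw [zero_sub, neg_eq_iff_add_eq_zero]
      exact (add_comm _ _).trans (Fin.last_add_one n)
    have h₄ : ∀ i : Fin n, i.succ - 1 = i.castSucc := fun i => by
      rw [sub_eq_iff_eq_add, Fin.coeSucc_eq_succ]
    simp only [rot, h₃, h₄]
  rw [h₁, h₂, encBits_eq, List.map_append, List.map_singleton, rotOne_ofList, encBits_eq,
    List.map_cons]

theorem rot_vecBits {k : ℕ} [NeZero k] (r : Fin k) (y : Vec k) :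
    (encNat r).rot (encBits (vecBits y)) = encBits (vecBits (rot r y)) := by
  have key : ∀ (n : ℕ) (y : Vec k),
      (encNat n).rot (encBits (vecBits y)) = encBits (vecBits (rot (Fin.ofNat k n) y)) := by
    intro n
    induction n with
    | zero =>
      intro y
      have : rot (Fin.ofNat k 0) y = y := by
        funext i
        simp [rot]
      rw [this]
      rfl
    | succ n ih =>
      intro y
      have : (encNat (n + 1)).rot (encBits (vecBits y)) =
          (encNat n).rot (encBits (vecBits y)).rotOne := rfl
      rw [this, rotOne_vecBits, ih, rot_rot_one]
  rw [key, Fin.ofNat_val_eq_self]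

/-- The `k` bits of `a` serve only as a counter for skipping the first block of `u`. -/
theorem drop_vecBits {k : ℕ} (a : Vec k) (u : Vec₂ k) :
    (encBits (vecBits a)).drop (encBits (vecBits₂ u)) =
      encBits (vecBits fun i => u (.inr i)) := by
  have key : ∀ (c l : List Val),
      c.foldl (fun a _ => Val.tl a) (ofList l) = ofList (l.drop c.length) := by
    intro c
    induction c with
    | nil => intro l; rfl
    | cons x c ih =>
      intro l
      cases l with
      | nil => simpa [ofList, Val.tl] using ih []
      | cons y l => simpa [ofList, Val.tl] using ih l
  rw [Val.drop, encBits_eq (vecBits₂ u), key]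
  simp [vecBits₂, encBits_eq]

/-- Horner's scheme: the circulant matrix of `a` times `c` is the sum of the `j`-fold shifts of `a`
weighted by `c j`. Starting from the last coefficient, each step shifts the partial sum by one and
adds `a` if the coefficient is 1. The start value `a.xor a` is the zero vector of the right length.
-/
theorem mulQC_vecBits {k : ℕ} [NeZero k] (a : Vec k) (u : Vec₂ k) :
    (encBits (vecBits a)).mulQC (encBits (vecBits₂ u)) =
      encBits (vecBits ((qcMatrix a).mulVec u)) := by
  have key : ∀ (n : ℕ) (c : Fin n → ZMod 2),
      ((List.ofFn fun j => decide (c j = 1)).map encBool).reverse.foldl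
        (fun s x => if x.isTrue then (encBits (vecBits a)).xor s.rotOne else s.rotOne)
        (encBits (vecBits (0 : Vec k))) =
      encBits (vecBits fun i => ∑ j, c j * a (i - Fin.ofNat k j)) := by
    intro n
    induction n with
    | zero =>
      intro c
      simp only [List.ofFn_zero, List.map_nil, List.reverse_nil, List.foldl_nil,
        Finset.univ_eq_empty, Finset.sum_empty]
      rfl
    | succ n ih =>
      intro c
      rw [List.ofFn_succ, List.map_cons, List.reverse_cons, List.foldl_append, ih]
      simp only [List.foldl_cons, List.foldl_nil, isTrue_encBool, rotOne_vecBits, xor_vecBits]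
      have h : (fun i => ∑ j, c j * a (i - Fin.ofNat k j)) = c 0 • a +
          rot 1 (fun i => ∑ j : Fin n, c j.succ * a (i - Fin.ofNat k j)) := by
        funext i
        simp only [Fin.sum_univ_succ, rot, Pi.add_apply, Pi.smul_apply, smul_eq_mul]
        congr 1
        · simp
        · refine Finset.sum_congr rfl fun j _ => ?_
          rw [Fin.val_succ, ofNat_succ_eq, sub_sub]
      rw [h]
      have h₂ : ∀ z : ZMod 2, z = 0 ∨ z = 1 := by decide
      rcases h₂ (c 0) with h₀ | h₀ <;> simp [h₀]
  rw [Val.mulQC, drop_vecBits, xor_vecBits]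
  have hz : a + a = 0 := by
    funext i
    exact CharTwo.add_self_eq_zero (a i)
  have := key k fun i => u (.inr i)
  have hv : vecBits (fun i => u (.inr i)) = List.ofFn fun j => decide (u (.inr j) = 1) := rfl
  rw [hz, Val.rev, toList_ofList, toList_encBits, hv, this, xor_vecBits_vecBits₂]
  congr 2
  rw [qcMatrix, Matrix.fromCols_mulVec, Matrix.one_mulVec, add_comm]
  congr 1
  funext i
  simp only [Matrix.mulVec, dotProduct, Matrix.circulant_apply, Function.comp_apply]
  refine Finset.sum_congr rfl fun j _ => ?_
  rw [Fin.ofNat_val_eq_self, mul_comm]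

theorem foldl_dot {α : Type} (L : List α) (f g : α → Bool) (m : List Val) (b : Bool) :
    (L.map fun j => encBool (g j)).foldl
      (fun s y => Val.node s.hd.tl (s.tl.bitXor (s.hd.hd.bitAnd y)))
      (.node (ofList ((L.map fun j => encBool (f j)) ++ m)) (encBool b)) =
    .node (ofList m) (encBool (L.foldl (fun b j => b ^^ (f j && g j)) b)) := by
  induction L generalizing b with
  | nil => simp
  | cons j L ih =>
    simp only [List.map_cons, List.cons_append, List.foldl_cons, ofList, Val.hd, Val.tl,
      bitAnd_encBool, bitXor_encBool]
    exact ih _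

/-- In a list without repetitions at most one term of the sum survives. -/
theorem foldl_xor_indicator {α : Type} [DecidableEq α] (L : List α) (hL : L.Nodup) (i : α)
    (g : α → Bool) (b : Bool) :
    L.foldl (fun b j => b ^^ (decide (j = i) && g j)) b = (b ^^ (decide (i ∈ L) && g i)) := by
  induction L generalizing b with
  | nil => simp
  | cons j L ih =>
    rw [List.nodup_cons] at hL
    rw [List.foldl_cons, ih hL.2]
    by_cases h : j = i
    · subst h
      simp [hL.1]
    · simp [h, Ne.symm h]

/-- Row `i` of the matrix has its only 1 at `π⁻¹ i`, so its product with `x` is `x (π⁻¹ i)`. Since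
the matrix is square, the list of bits of `x` also counts the rows. -/
theorem mulVec_permBits {k : ℕ} (π : Equiv.Perm (Pos k)) (x : Vec₂ k) :
    (encBits (permBits π)).mulVec (encBits (vecBits₂ x)) =
      encBits (vecBits₂ (permute π x)) := by
  have hdot : ∀ (i : Pos k) (m : List Val),
      (ofList (((posList k).map fun j => encBool (decide (π j = i))) ++ m)).dot
        (encBits (vecBits₂ x)) = .node (ofList m) (encBool (decide (permute π x i = 1))) := by
    intro i m
    have := foldl_dot (posList k) (fun j => decide (π j = i)) (fun j => decide (x j = 1)) m false
    rw [Val.dot, toList_encBits, vecBits₂_eq, List.map_map]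
    refine this.trans ?_
    have h := foldl_xor_indicator (posList k) (nodup_posList k) (π.symm i)
      (fun j => decide (x j = 1)) false
    simp only [Equiv.eq_symm_apply] at h
    rw [h]
    simp only [mem_posList, permute, decide_true, Bool.true_and, Bool.false_xor]
    rfl
  have hrows : ∀ (I : List (Pos k)) (xs : List Val) (o : List Val), xs.length = I.length →
      xs.foldl (fun s _ => Val.node (s.hd.dot (encBits (vecBits₂ x))).hd
        (.node (s.hd.dot (encBits (vecBits₂ x))).tl s.tl))
        (.node (ofList ((I.flatMap fun i => (posList k).map fun j => decide (π j = i)).map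
          encBool)) (ofList o)) =
      .node .nil (ofList ((I.map fun i => encBool (decide (permute π x i = 1))).reverse ++ o)) := by
    intro I
    induction I with
    | nil =>
      intro xs o h
      obtain rfl := List.length_eq_zero_iff.1 h
      rfl
    | cons i I ih =>
      intro xs o h
      cases xs with
      | nil => simp at h
      | cons y xs =>
        have h₁ := hdot i ((I.flatMap fun i => (posList k).map fun j => decide (π j = i)).map
          encBool)
        have h₂ := ih xs (encBool (decide (permute π x i = 1)) :: o) (by simpa using h)
        rw [List.foldl_cons, List.flatMap_cons, List.map_append, List.map_map]
        simp only [Val.hd, Val.tl, Function.comp_def, h₁] at h₂ ⊢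
        rw [ofList] at h₂
        rw [h₂]
        simp
  have := hrows (posList k) (encBits (vecBits₂ x)).toList [] (by simp)
  rw [Val.mulVec, permBits_eq, encBits_eq (List.flatMap _ _)]
  simp only [ofList] at this
  rw [this]
  simp [Val.rev, Val.tl, encBits_eq, vecBits₂_eq, Function.comp_def]

/-! ### Negligible functions and polynomial bounds -/

theorem Negligible.of_le {f g : ℕ → ℝ} (hg : Negligible g) (hf : ∀ l, 0 ≤ f l)
    (h : ∀ l, f l ≤ g l) : Negligible f :=
  Asymptotics.SuperpolynomialDecay.trans_abs_le hg fun l => by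
    rw [abs_of_nonneg (hf l)]
    exact (h l).trans (le_abs_self _)

theorem PolyBounded.mono {f g : ℕ → ℕ} (hg : PolyBounded g) (h : ∀ l, f l ≤ g l) :
    PolyBounded f := by
  obtain ⟨q, hq⟩ := hg
  exact ⟨q, fun l => (h l).trans (hq l)⟩

theorem PolyBounded.const (c : ℕ) : PolyBounded fun _ => c := ⟨.C c, fun l => by simp⟩

theorem PolyBounded.id : PolyBounded fun l => l := ⟨.X, fun l => by simp⟩

theorem PolyBounded.add {f g : ℕ → ℕ} (hf : PolyBounded f) (hg : PolyBounded g) :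
    PolyBounded fun l => f l + g l := by
  obtain ⟨q, hq⟩ := hf
  obtain ⟨r, hr⟩ := hg
  exact ⟨q + r, fun l => by simpa using add_le_add (hq l) (hr l)⟩

theorem PolyBounded.mul {f g : ℕ → ℕ} (hf : PolyBounded f) (hg : PolyBounded g) :
    PolyBounded fun l => f l * g l := by
  obtain ⟨q, hq⟩ := hf
  obtain ⟨r, hr⟩ := hg
  exact ⟨q * r, fun l => by simpa using mul_le_mul' (hq l) (hr l)⟩

theorem PolyBounded.eval {f : ℕ → ℕ} (hf : PolyBounded f) (q : Polynomial ℕ) :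
    PolyBounded fun l => q.eval (f l) := by
  obtain ⟨r, hr⟩ := hf
  exact ⟨q.comp r, fun l => by
    rw [Polynomial.eval_comp]; exact polynomial_eval_mono q (hr l)⟩

/-- This absorbs the loss factor of the hybrid argument in `CompIndist.iid`. -/
theorem Negligible.polyBounded_mul {n : ℕ → ℕ} {f : ℕ → ℝ} (hf : Negligible f)
    (hn : PolyBounded n) (h0 : ∀ l, 0 ≤ f l) : Negligible fun l => n l * f l := by
  obtain ⟨q, hq⟩ := hn
  have := Asymptotics.SuperpolynomialDecay.polynomial_mul hf (q.map (Nat.castRingHom ℝ))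
  refine Negligible.of_le this (fun l => mul_nonneg (Nat.cast_nonneg _) (h0 l)) fun l => ?_
  refine mul_le_mul_of_nonneg_right ?_ (h0 l)
  have h₁ : (q.map (Nat.castRingHom ℝ)).eval (l : ℝ) = (q.eval l : ℕ) := by
    simp
  rw [h₁]
  exact_mod_cast hq l

/-! ### Computational indistinguishability -/

theorem toReal_bind_apply {α β : Type} (μ : PMF α) (f : α → PMF β) (b : β) :
    ((μ.bind f) b).toReal = ∑' a, (μ a).toReal * (f a b).toReal := by
  rw [PMF.bind_apply, ENNReal.tsum_toReal_eq fun a =>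
    ENNReal.mul_ne_top (PMF.apply_ne_top _ _) (PMF.apply_ne_top _ _)]
  simp only [ENNReal.toReal_mul]

theorem pmf_summable_toReal {α : Type} (μ : PMF α) : Summable fun a => (μ a).toReal :=
  ENNReal.summable_toReal (by rw [μ.tsum_coe]; exact ENNReal.one_ne_top)

theorem pmf_tsum_toReal {α : Type} (μ : PMF α) : ∑' a, (μ a).toReal = 1 := by
  rw [← ENNReal.tsum_toReal_eq fun a => PMF.apply_ne_top _ _, μ.tsum_coe, ENNReal.toReal_one]

theorem acceptProb_nonneg (D : PPT) (l : ℕ) (z : Val) (X : PMF Val) : 0 ≤ acceptProb D l z X :=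
  ENNReal.toReal_nonneg

theorem acceptProb_le_one (D : PPT) (l : ℕ) (z : Val) (X : PMF Val) : acceptProb D l z X ≤ 1 :=
  ENNReal.toReal_le_of_le_ofReal zero_le_one
    ((PMF.coe_le_one _ _).trans_eq ENNReal.ofReal_one.symm)

theorem acceptProb_bind {α : Type} (D : PPT) (l : ℕ) (z : Val) (W : PMF α) (X : α → PMF Val) :
    acceptProb D l z (W.bind X) = ∑' w, (W w).toReal * acceptProb D l z (X w) := by
  rw [acceptProb, PMF.bind_bind, toReal_bind_apply]
  rfl

/-- The advantage for a mixture is at most the advantage for one of its components. -/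
theorem exists_advantage_le {α : Type} (W : PMF α) {f g : α → ℝ} (hf : ∀ a, 0 ≤ f a ∧ f a ≤ 1)
    (hg : ∀ a, 0 ≤ g a ∧ g a ≤ 1) :
    ∃ a ∈ W.support, |∑' a, (W a).toReal * f a - ∑' a, (W a).toReal * g a| ≤ |f a - g a| := by
  -- If all advantages on the support were below `c`, their mean would be below `c`, strictly
  -- because the support is nonempty; but the triangle inequality bounds `c` by this mean.
  by_contra! h
  set c := |∑' a, (W a).toReal * f a - ∑' a, (W a).toReal * g a| with hc
  have hs := pmf_summable_toReal W
  have hsum : ∀ {h : α → ℝ}, (∀ a, |h a| ≤ 1) → Summable fun a => (W a).toReal * h a := by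
    intro h hh
    refine Summable.of_norm_bounded hs fun a => ?_
    rw [Real.norm_eq_abs, abs_mul, abs_of_nonneg ENNReal.toReal_nonneg]
    exact mul_le_of_le_one_right ENNReal.toReal_nonneg (hh a)
  have hsf := hsum (h := f) fun a => abs_le.2 ⟨by linarith [hf a], (hf a).2⟩
  have hsg := hsum (h := g) fun a => abs_le.2 ⟨by linarith [hg a], (hg a).2⟩
  have hd : ∀ a, |f a - g a| ≤ 1 := fun a =>
    abs_le.2 ⟨by linarith [hf a, hg a], by linarith [hf a, hg a]⟩
  have hsd := hsum (h := fun a => |f a - g a|) fun a => by rw [abs_abs]; exact hd a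
  have h₁ : c ≤ ∑' a, (W a).toReal * |f a - g a| := by
    rw [hc, ← hsf.tsum_sub hsg]
    have h₂ : ∀ a, ‖(W a).toReal * f a - (W a).toReal * g a‖ = (W a).toReal * |f a - g a| := by
      intro a
      rw [← mul_sub, Real.norm_eq_abs, abs_mul, abs_of_nonneg ENNReal.toReal_nonneg]
    have := norm_tsum_le_tsum_norm (f := fun a => (W a).toReal * f a - (W a).toReal * g a)
      (by simpa only [h₂] using hsd)
    simpa only [h₂, Real.norm_eq_abs] using this
  obtain ⟨a₀, ha₀⟩ := W.support_nonempty
  have h₂ : ∑' a, (W a).toReal * |f a - g a| < ∑' a, (W a).toReal * c := by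
    refine Summable.tsum_lt_tsum (i := a₀) (fun a => ?_) ?_ hsd (hs.mul_right c)
    · by_cases ha : a ∈ W.support
      · exact mul_le_mul_of_nonneg_left (h a ha).le ENNReal.toReal_nonneg
      · simp [(PMF.apply_eq_zero_iff _ _).2 ha]
    · exact mul_lt_mul_of_pos_left (h a₀ ha₀)
        (ENNReal.toReal_pos ((PMF.mem_support_iff _ _).1 ha₀) (PMF.apply_ne_top _ _))
  rw [tsum_mul_right, pmf_tsum_toReal, one_mul] at h₂
  exact absurd (h₁.trans_lt h₂) (lt_irrefl _)

namespace CompIndist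

variable {X Y Z : ℕ → PMF Val}

theorem symm (h : CompIndist X Y) : CompIndist Y X := fun D z hz => by
  simpa only [abs_sub_comm] using h D z hz

theorem trans (h : CompIndist X Y) (h' : CompIndist Y Z) : CompIndist X Z := fun D z hz =>
  Negligible.of_le (Asymptotics.SuperpolynomialDecay.add (h D z hz) (h' D z hz))
    (fun _ => abs_nonneg _) fun _ => abs_sub_le _ _ _

/-- Mixtures of indistinguishable distributions are indistinguishable: the distinguisher gets
a component of the mixture as auxiliary input. -/
theorem bind {α : ℕ → Type} {W : ∀ l, PMF (α l)} {X Y : ∀ l, α l → PMF Val}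
    (h : ∀ w : ∀ l, α l, (∀ l, w l ∈ (W l).support) →
      CompIndist (fun l => X l (w l)) (fun l => Y l (w l))) :
    CompIndist (fun l => (W l).bind (X l)) (fun l => (W l).bind (Y l)) := by
  intro D z hz
  have : ∀ l, ∃ w ∈ (W l).support,
      |acceptProb D l (z l) ((W l).bind (X l)) - acceptProb D l (z l) ((W l).bind (Y l))| ≤
      |acceptProb D l (z l) (X l w) - acceptProb D l (z l) (Y l w)| := by
    intro l
    simp only [acceptProb_bind]
    exact exists_advantage_le (W l) (fun _ => ⟨acceptProb_nonneg _ _ _ _, acceptProb_le_one _ _ _ _⟩)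
      (fun _ => ⟨acceptProb_nonneg _ _ _ _, acceptProb_le_one _ _ _ _⟩)
  -- This choice need not be computable, as `h` covers every family of components.
  choose w hw hle using this
  exact Negligible.of_le (h w hw D z hz) (fun _ => abs_nonneg _) hle

/-- Processing by a PPT algorithm with auxiliary input preserves indistinguishability. -/
theorem process (h : CompIndist X Y) {F : Val → PMF Val} (hF : IsPPT F) {z : ℕ → Val}
    (hz : PolyBounded fun l => (z l).size) :
    CompIndist (fun l => (X l).bind fun x => F (.node (encNat l) (.node (z l) x)))
      (fun l => (Y l).bind fun x => F (.node (encNat l) (.node (z l) x))) := by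
  intro D z' hz'
  -- The reduction receives the pair of `z'`, which is meant for `D`, and `z`, which is meant for
  -- `F`; it runs `F` on its sample and then `D` on the result.
  have hD : IsPPT fun v => (F (.node v.hd (.node v.tl.hd.tl v.tl.tl))).bind fun y =>
      D.eval (.node v.hd (.node v.tl.hd.hd y)) := by
    refine IsPPT.bind (h := fun v y => D.eval (.node v.hd (.node v.tl.hd.hd y)))
      (IsPPT.comp hF (IsPT.id.hd.node (IsPT.id.tl.hd.tl.node IsPT.id.tl.tl))) ?_
    exact IsPPT.comp D.isPPT (IsPT.id.tl.hd.node (IsPT.id.tl.tl.hd.hd.node IsPT.id.hd))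
  obtain ⟨A, hA⟩ := hD.exists_ppt
  have key : ∀ l (W : PMF Val), acceptProb A l (.node (z' l) (z l)) W =
      acceptProb D l (z' l) (W.bind fun x => F (.node (encNat l) (.node (z l) x))) := by
    intro l W
    simp only [acceptProb, PPT.guess, hA, Val.hd, Val.tl, PMF.bind_bind, PMF.map_bind]
  simp only [← key]
  refine h A _ ?_
  simpa only [Val.size] using ((PolyBounded.const 1).add hz').add hz

end CompIndist

/-- Commitments to messages of the same length are indistinguishable. -/
theorem CommitmentScheme.Hiding.compIndist {COM : CommitmentScheme} (h : COM.Hiding)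
    {m₀ m₁ : ℕ → List Bool} (hm : PolyBounded fun l => (m₀ l).length)
    (hl : ∀ l, (m₀ l).length = (m₁ l).length) :
    CompIndist
      (fun l => (PMF.uniformOfFintype (COM.Coins l)).map fun ρ => encBits (COM.commit l (m₀ l) ρ))
      (fun l => (PMF.uniformOfFintype (COM.Coins l)).map
        fun ρ => encBits (COM.commit l (m₁ l) ρ)) := by
  intro D z hz
  have hadv := h D z m₀ m₁ hz hm hl
  -- If `D` answers 1 with probability `p₀` or `p₁` on commitments to the two messages, the hiding
  -- experiment succeeds with probability `1/2 + (p₁ - p₀)/2`; hence the factor 2.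
  refine (Asymptotics.SuperpolynomialDecay.mul_const hadv 2).congr fun l => ?_
  set W : Bool → PMF Bool := fun b => (PMF.uniformOfFintype (COM.Coins l)).bind fun ρ =>
    D.guess (.node (encNat l) (.node (z l)
      (encBits (COM.commit l (if b then m₁ l else m₀ l) ρ)))) with hW
  have h₁ : COM.hidingExperiment D l (z l) (m₀ l) (m₁ l) =
      (PMF.uniformOfFintype Bool).bind fun b => (W b).bind fun b' => PMF.pure (b == b') := by
    simp only [hW, PMF.bind_bind]
    rfl
  have h₂ : ∀ μ : PMF Bool, (μ false).toReal = 1 - (μ true).toReal := by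
    intro μ
    have := pmf_tsum_toReal μ
    rw [tsum_fintype, Fintype.sum_bool] at this
    linarith
  have h₃ : (COM.hidingExperiment D l (z l) (m₀ l) (m₁ l) true).toReal =
      1 / 2 + ((W true true).toReal - (W false true).toReal) / 2 := by
    rw [h₁, toReal_bind_apply, tsum_fintype, Fintype.sum_bool, toReal_bind_apply,
      toReal_bind_apply, tsum_fintype, tsum_fintype, Fintype.sum_bool, Fintype.sum_bool]
    simp only [PMF.uniformOfFintype_apply, Fintype.card_bool, PMF.pure_apply]
    simp [h₂ (W false)]
    ring
  have h₄ : ∀ b, acceptProb D l (z l) ((PMF.uniformOfFintype (COM.Coins l)).map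
      fun ρ => encBits (COM.commit l (if b then m₁ l else m₀ l) ρ)) = (W b true).toReal := by
    intro b
    rw [acceptProb, PMF.bind_map]
    rfl
  have h₅ := h₄ false
  have h₆ := h₄ true
  simp only [Bool.false_eq_true, if_false, if_true] at h₅ h₆
  rw [h₅, h₆, CommitmentScheme.hidingAdvantage, h₃, add_sub_cancel_left, abs_div,
    abs_of_pos (by norm_num : (0 : ℝ) < 2), abs_sub_comm]
  ring

/-! ### Independent samples -/

/-- A list of `n` independent samples. -/
noncomputable def iid {α : Type} (μ : PMF α) : ℕ → PMF (List α)
  | 0 => PMF.pure []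
  | n + 1 => μ.bind fun a => (iid μ n).map fun l => a :: l

/-- The definition splits off the first sample. Hybrids also need the last one, because the prefix
of replaced samples grows at its end. -/
theorem iid_succ' {α : Type} (μ : PMF α) (n : ℕ) :
    iid μ (n + 1) = (iid μ n).bind fun l => μ.map fun a => l ++ [a] := by
  induction n with
  | zero => simp [iid, PMF.pure_bind, PMF.map, Function.comp_def]
  | succ n ih =>
    have h : iid μ (n + 1) = μ.bind fun a => (iid μ n).map fun l => a :: l := rfl
    conv_rhs => rw [h]
    rw [iid, ih]
    simp only [PMF.map_bind, PMF.map_comp, PMF.bind_bind, PMF.bind_map]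
    rfl

theorem iid_map {α β : Type} (μ : PMF α) (f : α → β) (n : ℕ) :
    iid (μ.map f) n = (iid μ n).map (List.map f) := by
  induction n with
  | zero => simp [iid, PMF.pure_map]
  | succ n ih =>
    simp only [iid, ih, PMF.bind_map, PMF.map_bind, PMF.map_comp, Function.comp_def,
      List.map_cons]

theorem of_mem_support_iid {α : Type} {μ : PMF α} {n : ℕ} {l : List α}
    (h : l ∈ (iid μ n).support) : l.length = n ∧ ∀ a ∈ l, a ∈ μ.support := by
  induction n generalizing l with
  | zero =>
    simp only [iid, PMF.mem_support_pure_iff] at h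
    simp [h]
  | succ n ih =>
    simp only [iid, PMF.mem_support_bind_iff, PMF.mem_support_map_iff] at h
    obtain ⟨a, ha, l', hl', rfl⟩ := h
    obtain ⟨h₁, h₂⟩ := ih hl'
    refine ⟨by simp [h₁], fun b hb => ?_⟩
    rcases List.mem_cons.1 hb with rfl | hb
    exacts [ha, h₂ b hb]

/-- All samples have polynomial size. -/
def PolySized (X : ℕ → PMF Val) : Prop :=
  ∃ B : ℕ → ℕ, PolyBounded B ∧ ∀ l, ∀ x ∈ (X l).support, x.size ≤ B l

/-- Polynomially many independent samples of indistinguishable distributions are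
indistinguishable. -/
theorem CompIndist.iid {X Y : ℕ → PMF Val} (h : CompIndist X Y) (hX : PolySized X)
    (hY : PolySized Y) {n : ℕ → ℕ} (hn : PolyBounded n) :
    CompIndist (fun l => (iid (X l) (n l)).map ofList) (fun l => (iid (Y l) (n l)).map ofList) := by
  obtain ⟨BX, hBX, hX⟩ := hX
  obtain ⟨BY, hBY, hY⟩ := hY
  intro D z hz
  -- The hybrid `G l i` has `i` samples of `Y` followed by samples of `X`. In `H l i S` position `i`
  -- holds a sample of `S`, and `W l i` draws everything around it; so `G l i` and `G l (i + 1)` are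
  -- `H l i` at `X` and at `Y`.
  let W : (l : ℕ) → ℕ → PMF (List Val × List Val) := fun l i =>
    (QCStern.iid (Y l) i).bind fun p => (QCStern.iid (X l) (n l - 1 - i)).map fun s => (p, s)
  let H : (l : ℕ) → ℕ → PMF Val → PMF Val := fun l i S =>
    (W l i).bind fun c => S.bind fun x => PMF.pure (ofList (c.1 ++ x :: c.2))
  let G : (l : ℕ) → ℕ → PMF Val := fun l i =>
    (QCStern.iid (Y l) i).bind fun p => (QCStern.iid (X l) (n l - i)).map fun s => ofList (p ++ s)
  -- The surrounding samples are fixed by averaging and become auxiliary input, which is why samples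
  -- must have polynomial size. The position may depend on `l` in an arbitrary way.
  have hH : ∀ i : ℕ → ℕ, (∀ l, i l ≤ n l) →
      CompIndist (fun l => H l (i l) (X l)) (fun l => H l (i l) (Y l)) := by
    intro i hi
    refine CompIndist.bind fun c hc => ?_
    have hF : IsPPT fun v => PMF.pure (v.tl.hd.hd.append (.node v.tl.tl v.tl.hd.tl)) :=
      IsPT.append IsPT.id.tl.hd.hd (IsPT.id.tl.tl.node IsPT.id.tl.hd.tl)
    have := h.process hF (z := fun l => .node (ofList (c l).1) (ofList (c l).2)) ?_
    · simpa only [Val.hd, Val.tl, Val.append, toList_ofList, Val.toList] using this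
    · refine (((PolyBounded.const 1).add ((PolyBounded.const 1).add
        (hn.mul ((PolyBounded.const 1).add hBY)))).add ((PolyBounded.const 1).add
        (hn.mul ((PolyBounded.const 1).add hBX)))).mono fun l => ?_
      have hcl := hc l
      simp only [W, PMF.mem_support_bind_iff, PMF.mem_support_map_iff] at hcl
      obtain ⟨p, hp, s, hs, hps⟩ := hcl
      obtain ⟨hp₁, hp₂⟩ := of_mem_support_iid hp
      obtain ⟨hs₁, hs₂⟩ := of_mem_support_iid hs
      have h₁ := size_ofList_le fun x hx => hY l x (hp₂ x hx)
      have h₂ := size_ofList_le fun x hx => hX l x (hs₂ x hx)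
      have h₃ : p.length ≤ n l := hp₁ ▸ hi l
      have h₄ : s.length ≤ n l := by omega
      rw [← hps]
      simp only [Val.size]
      have h₅ := Nat.mul_le_mul_right (1 + BY l) h₃
      have h₆ := Nat.mul_le_mul_right (1 + BX l) h₄
      omega
  have hG₁ : ∀ l i, i < n l → G l i = H l i (X l) := by
    intro l i hi
    obtain ⟨m, hm⟩ : ∃ m, n l - i = m + 1 := ⟨n l - i - 1, by omega⟩
    have hm' : n l - 1 - i = m := by omega
    simp only [G, H, W, hm, hm', PMF.bind_bind, PMF.bind_map, QCStern.iid, PMF.map_bind,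
      PMF.map_comp, Function.comp_def]
    congr 1
    funext p
    rw [PMF.bind_comm]
    rfl
  have hG₂ : ∀ l i, i < n l → G l (i + 1) = H l i (Y l) := by
    intro l i hi
    have hm : n l - 1 - i = n l - (i + 1) := by omega
    simp only [G, H, W, hm, PMF.bind_bind, PMF.bind_map, iid_succ',
      Function.comp_def, List.append_assoc, List.singleton_append]
    congr 1
    funext p
    rw [PMF.bind_comm]
    rfl
  have hG₀ : ∀ l, G l 0 = (QCStern.iid (X l) (n l)).map ofList := by
    intro l
    simp [G, QCStern.iid, PMF.pure_bind]
  have hGn : ∀ l, G l (n l) = (QCStern.iid (Y l) (n l)).map ofList := by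
    intro l
    simp [G, QCStern.iid, PMF.map, Function.comp_def]
  -- By telescoping, some gap between neighbouring hybrids is at least the average one. The weak
  -- inequality `i ≤ n l` leaves room for `i = 0` when there are no samples.
  have key : ∀ l, ∃ i ≤ n l, |acceptProb D l (z l) (G l 0) - acceptProb D l (z l) (G l (n l))| ≤
      n l * |acceptProb D l (z l) (H l i (X l)) - acceptProb D l (z l) (H l i (Y l))| := by
    intro l
    rcases Nat.eq_zero_or_pos (n l) with h0 | h0
    · exact ⟨0, Nat.zero_le _, by simp [h0]⟩
    · set g : ℕ → ℝ := fun i => acceptProb D l (z l) (G l i) with hg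
      have hn0 : (n l : ℝ) ≠ 0 := by positivity
      obtain ⟨i, hi, hle⟩ := Finset.exists_le_of_sum_le
        (s := Finset.range (n l)) (f := fun _ => |g 0 - g (n l)| / n l)
        (g := fun i => |g i - g (i + 1)|) (Finset.nonempty_range_iff.2 h0.ne') (by
          rw [Finset.sum_const, Finset.card_range, nsmul_eq_mul, mul_div_cancel₀ _ hn0,
            ← Finset.sum_range_sub']
          exact Finset.abs_sum_le_sum_abs _ _)
      rw [Finset.mem_range] at hi
      refine ⟨i, hi.le, ?_⟩
      rw [← hG₁ l i hi, ← hG₂ l i hi]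
      rwa [div_le_iff₀' (by positivity)] at hle
  choose i hi hle using key
  refine Negligible.of_le ((hH i hi D z hz).polyBounded_mul hn fun _ => abs_nonneg _)
    (fun _ => abs_nonneg _) fun l => ?_
  have := hle l
  rwa [hG₀, hGn] at this

/-! ### Uniform distributions -/

theorem uniform_map_equiv {A B : Type} [Fintype A] [Nonempty A] [Fintype B] [Nonempty B]
    (e : A ≃ B) : (PMF.uniformOfFintype A).map e = PMF.uniformOfFintype B := by
  ext b
  rw [PMF.map_apply, tsum_eq_single (e.symm b)]
  · simp [Fintype.card_congr e]
  · intro a ha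
    rw [if_neg]
    rintro rfl
    simp at ha

theorem uniform_prod (A B : Type) [Fintype A] [Nonempty A] [Fintype B] [Nonempty B] :
    PMF.uniformOfFintype (A × B) =
      (PMF.uniformOfFintype A).bind fun a => (PMF.uniformOfFintype B).map fun b => (a, b) := by
  ext ⟨a, b⟩
  rw [PMF.bind_apply, tsum_eq_single a, PMF.map_apply, tsum_eq_single b]
  · simp only [PMF.uniformOfFintype_apply, Fintype.card_prod, Nat.cast_mul, if_true]
    rw [ENNReal.mul_inv (by simp) (by simp)]
  · intro b' hb
    simp [hb.symm]
  · intro a' ha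
    simp [PMF.map_apply, ha.symm]

theorem uniform_pi_prod (n : ℕ) (A B : Type) [Fintype A] [Nonempty A] [Fintype B] [Nonempty B] :
    PMF.uniformOfFintype (Fin n → A × B) = (PMF.uniformOfFintype (Fin n → A)).bind fun f =>
      (PMF.uniformOfFintype (Fin n → B)).map fun g i => (f i, g i) := by
  rw [← uniform_map_equiv (Equiv.arrowProdEquivProdArrow (Fin n) (fun _ => A) (fun _ => B)).symm,
    uniform_prod]
  simp only [PMF.map_bind, PMF.map_comp]
  rfl

/-- The protocol draws the randomness of all iterations at once, as functions on `Fin P.δ`; this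
turns it into a list of independent samples. -/
theorem uniform_pi_map_ofFn (n : ℕ) (A : Type) [Fintype A] [Nonempty A] :
    (PMF.uniformOfFintype (Fin n → A)).map List.ofFn = iid (PMF.uniformOfFintype A) n := by
  induction n with
  | zero =>
    have : (List.ofFn : (Fin 0 → A) → List A) = Function.const _ [] := by
      funext f; simp
    rw [this, PMF.map_const, iid]
  | succ n ih =>
    rw [iid, ← ih, ← uniform_map_equiv (Fin.consEquiv fun _ : Fin (n + 1) => A), uniform_prod]
    simp only [PMF.map_bind, PMF.map_comp]
    congr 1
    funext a
    congr 1
    funext f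
    simp [Fin.consEquiv]

theorem pickElem_ofFn {n : ℕ} [NeZero n] (g : Fin n → Val) :
    pickElem (ofList (List.ofFn g)) = (PMF.uniformOfFintype (Fin n)).map g := by
  obtain ⟨m, rfl⟩ : ∃ m, n = m + 1 := ⟨n - 1, (Nat.succ_pred (NeZero.ne n)).symm⟩
  -- The index type in `pickElem` depends on the list, so `a` and `b` are kept general and
  -- `finCongr` moves to `Fin (m + 1)`.
  have key : ∀ (a b : Val), (h : a :: b.toList = List.ofFn g) →
      pickElem (.node a b) = (PMF.uniformOfFintype (Fin (m + 1))).map g := by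
    intro a b h
    have hl : b.toList.length + 1 = m + 1 := by
      simpa using congrArg List.length h
    rw [pickElem, ← uniform_map_equiv (finCongr hl), PMF.map_comp]
    congr 1
    funext i
    have : (a :: b.toList)[(i : ℕ)] = (List.ofFn g)[(i : ℕ)]'(by simp; omega) :=
      List.getElem_of_eq h _
    rw [List.get_eq_getElem, this, List.getElem_ofFn]
    rfl
  rw [List.ofFn_succ, ofList]
  exact key _ _ (by rw [toList_ofList, List.ofFn_succ])

theorem pickElem_range (n : ℕ) [NeZero n] :
    pickElem (encNat n).range = (PMF.uniformOfFintype (Fin n)).map fun i : Fin n => encNat (i : ℕ) := by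
  rw [range_encNat, encList_eq, ← pickElem_ofFn]
  congr 2
  refine List.ext_getElem (by simp) fun i h₁ h₂ => by simp

/-! ### Sampling programs -/

/-- The list of the two bits. -/
def bitsVal : Val := .node .nil (.node (.node .nil .nil) .nil)

theorem IsPT.bitsVal : IsPT fun _ => bitsVal := IsPT.nil.node (IsPT.true.node IsPT.nil)

theorem pickElem_bitsVal :
    pickElem bitsVal = (PMF.uniformOfFintype Bool).map encBool := by
  have := pickElem_ofFn (n := 2) (fun i => encBool (finTwoEquiv i))
  rw [← uniform_map_equiv finTwoEquiv, PMF.map_comp]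
  refine Eq.trans ?_ this
  congr 1

/-- A list of independent samples, as many as `n` has elements. -/
noncomputable def sampleList (μ : PMF Val) (n : Val) : PMF Val :=
  pfold (fun _ a => μ.bind fun b => PMF.pure (.node b a)) n.toList .nil

/-- The program conses its samples and so produces them in reverse order. For independent samples
this makes no difference: `iid_succ'` with an exchange of draws matches the two. -/
theorem sampleList_eq (μ : PMF Val) (n : Val) :
    sampleList μ n = (iid μ n.toList.length).map ofList := by
  have key : ∀ (l acc : List Val),
      pfold (fun _ a => μ.bind fun b => PMF.pure (.node b a)) l (ofList acc) =
        (iid μ l.length).map fun s => ofList (s ++ acc) := by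
    intro l
    induction l with
    | nil => intro acc; simp [pfold, iid, PMF.pure_map]
    | cons x l ih =>
      intro acc
      have h : ∀ b, pfold (fun _ a => μ.bind fun b => PMF.pure (.node b a)) l
          (.node b (ofList acc)) = (iid μ l.length).map fun s => ofList (s ++ b :: acc) :=
        fun b => ih (b :: acc)
      simp only [pfold, PMF.bind_bind, PMF.pure_bind, h, List.length_cons, iid_succ',
        PMF.map, Function.comp_def, PMF.bind_bind, PMF.pure_bind, List.append_assoc,
        List.singleton_append]
      rw [PMF.bind_comm]
  have := key n.toList []
  simpa [sampleList, ofList] using this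

theorem IsPPT.sampleList {μ : Val → PMF Val} {n : Val → Val} (hμ : IsPPT μ) (hn : IsPT n) :
    IsPPT fun v => sampleList (μ v) (n v) := by
  obtain ⟨q, hq⟩ := hμ.size_le
  refine IsPPT.pfold_of_additive
    (s := fun v _ a => (μ v).bind fun b => PMF.pure (.node b a)) ?_ hn IsPT.nil
    ⟨q + 1, fun v x _ a w hw => ?_⟩
  · exact IsPPT.bind (h := fun e b => PMF.pure (.node b e.tl.tl)) (IsPPT.comp hμ IsPT.id.hd)
      (IsPT.id.hd.node IsPT.id.tl.tl.tl)
  · simp only [PMF.mem_support_bind_iff, PMF.mem_support_pure_iff] at hw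
    obtain ⟨b, hb, rfl⟩ := hw
    have := hq v b hb
    simp only [Val.size, Polynomial.eval_add, Polynomial.eval_one]
    omega

/-- A uniformly random bit string, as long as `n`. -/
noncomputable def randBits (n : Val) : PMF Val := sampleList (pickElem bitsVal) n

theorem IsPPT.randBits {n : Val → Val} (hn : IsPT n) : IsPPT fun v => randBits (n v) :=
  IsPPT.sampleList (IsPPT.pick IsPT.bitsVal) hn

theorem randBits_encNat (n : ℕ) :
    randBits (encNat n) = (PMF.uniformOfFintype (Bits n)).map encFixed := by
  rw [randBits, sampleList_eq, pickElem_bitsVal, iid_map, ← uniform_pi_map_ofFn, PMF.map_comp,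
    PMF.map_comp, toList_encNat, List.length_replicate]
  congr 1
  funext b
  simp [encFixed, encSeq, encList_eq]

/-- The component number `i` of a tuple. -/
def Val.arg : ℕ → Val → Val
  | 0, v => v.hd
  | i + 1, v => Val.arg i v.tl

theorem IsPT.arg {f : Val → Val} (i : ℕ) (hf : IsPT f) : IsPT fun v => (f v).arg i := by
  induction i generalizing f with
  | zero => exact hf.hd
  | succ i ih => exact ih hf.tl

/-! ### The programs of one iteration -/

/-- The encoding of an iteration. -/
def iterVal (sr b c₁ c₂ c₃ d : Val) : Val :=
  .node sr (.node b (.node c₁ (.node c₂ (.node c₃ d))))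

/-- An iteration with second challenge `0`, computed from the security parameter, the first
challenge, a seed, the bits of its permutation, the block of the parity check matrix, the shifted
syndrome, the coins of the first and the third commitment, the second commitment and the revealed
word. -/
noncomputable def iter₀ (C : Val → PMF Val) (v : Val) : PMF Val :=
  (C (.node (v.arg 0) (.node ((v.arg 3).append (((v.arg 4).mulQC (v.arg 9)).xor (v.arg 5)))
    (v.arg 6)))).bind fun c₁ =>
  (C (.node (v.arg 0) (.node ((v.arg 3).mulVec (v.arg 9)) (v.arg 7)))).bind fun c₃ =>
  PMF.pure (iterVal (v.arg 1) .nil c₁ (v.arg 8) c₃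
    (.node (v.arg 2) (.node (v.arg 9) (.node (v.arg 8) (.node (v.arg 6) (v.arg 7))))))

/-- An iteration with second challenge `1`, computed from the security parameter, the first
challenge, a seed, the bits of its vector, the coins of the second and the third commitment, the
first commitment and the revealed word. -/
noncomputable def iter₁ (C : Val → PMF Val) (v : Val) : PMF Val :=
  (C (.node (v.arg 0) (.node (v.arg 3) (v.arg 4)))).bind fun c₂ =>
  (C (.node (v.arg 0) (.node ((v.arg 3).xor (v.arg 7)) (v.arg 5)))).bind fun c₃ =>
  PMF.pure (iterVal (v.arg 1) (.node .nil .nil) (v.arg 6) c₂ c₃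
    (.node (v.arg 2) (.node (v.arg 7) (.node (v.arg 6) (.node (v.arg 4) (v.arg 5))))))

theorem IsPPT.pure {f : Val → Val} (hf : IsPT f) : IsPPT fun v => PMF.pure (f v) := hf


theorem isPPT_iter₀ {C : Val → PMF Val} (hC : IsPPT C) : IsPPT (iter₀ C) := by
  unfold iter₀ iterVal
  -- The goal is decomposed along the syntax of the program; at reducible transparency an `IsPT`
  -- goal is not unfolded to an `IsPPT` goal.
  with_reducible repeat' first
    | exact IsPT.id | exact IsPT.nil | apply IsPT.node | apply IsPT.arg | apply IsPT.append
    | apply IsPT.xor | apply IsPT.mulQC | apply IsPT.mulVec | apply IsPT.hd | apply IsPT.tl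
    | apply IsPT.flatMap | apply IsPT.map | apply IsPT.rot | apply IsPT.drop | apply IsPT.range
    | exact IsPT.bitsVal | apply IsPPT.pure | apply IsPPT.randBits | apply IsPPT.pick
    | apply IsPPT.ite
    | apply IsPPT.comp hC
    | apply IsPPT.bind

theorem isPPT_iter₁ {C : Val → PMF Val} (hC : IsPPT C) : IsPPT (iter₁ C) := by
  unfold iter₁ iterVal
  with_reducible repeat' first
    | exact IsPT.id | exact IsPT.nil | apply IsPT.node | apply IsPT.arg | apply IsPT.append
    | apply IsPT.xor | apply IsPT.mulQC | apply IsPT.mulVec | apply IsPT.hd | apply IsPT.tl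
    | apply IsPT.flatMap | apply IsPT.map | apply IsPT.rot | apply IsPT.drop | apply IsPT.range
    | exact IsPT.bitsVal | apply IsPPT.pure | apply IsPPT.randBits | apply IsPPT.pick
    | apply IsPPT.ite
    | apply IsPPT.comp hC
    | apply IsPPT.bind

/-- The transcript, computed from the security parameter, the parameters, the coins of `Cmt_1` and
`Cmt_2`, and the list of the iterations, with the programs `C` for commitments and `K` for
compression. -/
noncomputable def finish (C K : Val → PMF Val) (v : Val) : PMF Val :=
  (C (.node v.hd (.node (v.tl.tl.flatMap fun x => (x.arg 2).append (x.arg 3))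
    v.tl.hd.tl.hd))).bind fun m₁ =>
  (C (.node v.hd (.node (v.tl.tl.flatMap fun x => x.arg 4) v.tl.hd.tl.tl))).bind fun m₂ =>
  (K (.node v.hd (.node v.tl.hd.hd (.node (v.tl.tl.map fun x => x.arg 1)
    (.node v.tl.hd.tl.hd (.node v.tl.hd.tl.tl
      (v.tl.tl.map fun x => x.tl.tl.tl.tl.tl))))))).bind fun rsp =>
  PMF.pure (.node m₁ (.node (v.tl.tl.map fun x => x.arg 0) (.node m₂
    (.node (v.tl.tl.map fun x => x.arg 1) rsp))))

theorem isPPT_finish {C K : Val → PMF Val} (hC : IsPPT C) (hK : IsPPT K) :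
    IsPPT (finish C K) := by
  unfold finish
  with_reducible repeat' first
    | exact IsPT.id | exact IsPT.nil | apply IsPT.node | apply IsPT.arg | apply IsPT.append
    | apply IsPT.xor | apply IsPT.mulQC | apply IsPT.mulVec | apply IsPT.hd | apply IsPT.tl
    | apply IsPT.flatMap | apply IsPT.map | apply IsPT.rot | apply IsPT.drop | apply IsPT.range
    | exact IsPT.bitsVal | apply IsPPT.pure | apply IsPPT.randBits | apply IsPPT.pick
    | apply IsPPT.ite
    | apply IsPPT.comp hC
    | apply IsPPT.comp hK
    | apply IsPPT.bind

/-- A simulated iteration, computed from the security parameter, the parameters and the public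
key. The programs `C`, `N`, `Pm`, `Ve`, `Bl`, `Se` compute commitments, the number of their coins,
and the permutation, the vector, the block and the secrets that belong to a seed. -/
noncomputable def simIter (C N Pm Ve Bl Se : Val → PMF Val) (v : Val) : PMF Val :=
  (pickElem (v.tl.hd.arg 3).range).bind fun s =>
  (pickElem (v.tl.hd.arg 0).range).bind fun r =>
  (pickElem bitsVal).bind fun b =>
  (randBits (v.tl.hd.arg 4)).bind fun θ =>
  (randBits (v.tl.hd.arg 4)).bind fun ξ =>
  (N v.hd).bind fun n =>
  (randBits n).bind fun ρ₁ =>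
  (randBits n).bind fun ρ₂ =>
  (randBits n).bind fun ρ₃ =>
  (Pm (.node v.hd (.node v.tl.hd θ))).bind fun π =>
  (Ve (.node v.hd (.node v.tl.hd ξ))).bind fun u =>
  (Bl (.node v.hd (.node v.tl.hd v.tl.tl.hd))).bind fun a =>
  -- Stand-ins computed from the public seed: `π'` (with `a`) and `u'` give dummy messages of the
  -- right lengths for the closed commitments, and `x` provides a word of weight `w`.
  (Pm (.node v.hd (.node v.tl.hd v.tl.tl.hd))).bind fun π' =>
  (Ve (.node v.hd (.node v.tl.hd v.tl.tl.hd))).bind fun u' =>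
  (Se (.node v.hd (.node v.tl.hd v.tl.tl.hd))).bind fun x =>
  if b.isTrue then
    (C (.node v.hd (.node (π'.append a) ρ₁))).bind fun c₁ =>
    iter₁ C (.node v.hd (.node (.node s r) (.node ξ (.node u (.node ρ₂ (.node ρ₃ (.node c₁
      (.node (π.mulVec x.hd) .nil))))))))
  else
    (C (.node v.hd (.node u' ρ₂))).bind fun c₂ =>
    iter₀ C (.node v.hd (.node (.node s r) (.node θ (.node π (.node a (.node
      (r.rot (s.drop v.tl.tl.tl).hd) (.node ρ₁ (.node ρ₃ (.node c₂ (.node u .nil))))))))))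

theorem isPPT_simIter {C N Pm Ve Bl Se : Val → PMF Val} (hC : IsPPT C) (hN : IsPPT N)
    (hPm : IsPPT Pm) (hVe : IsPPT Ve) (hBl : IsPPT Bl) (hSe : IsPPT Se) :
    IsPPT (simIter C N Pm Ve Bl Se) := by
  have h₀ := isPPT_iter₀ hC
  have h₁ := isPPT_iter₁ hC
  unfold simIter
  with_reducible repeat' first
    | exact IsPT.id | exact IsPT.nil | apply IsPT.node | apply IsPT.arg | apply IsPT.append
    | apply IsPT.xor | apply IsPT.mulQC | apply IsPT.mulVec | apply IsPT.hd | apply IsPT.tl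
    | apply IsPT.flatMap | apply IsPT.map | apply IsPT.rot | apply IsPT.drop | apply IsPT.range
    | exact IsPT.bitsVal | apply IsPPT.pure | apply IsPPT.randBits | apply IsPPT.pick
    | apply IsPPT.ite
    | apply IsPPT.comp hC
    | apply IsPPT.comp hN
    | apply IsPPT.comp hPm
    | apply IsPPT.comp hVe
    | apply IsPPT.comp hBl
    | apply IsPPT.comp hSe
    | apply IsPPT.comp h₀
    | apply IsPPT.comp h₁
    | apply IsPPT.bind

/-- The simulator: independent simulated iterations are turned into a transcript. -/
noncomputable def simulator (C K N Pm Ve Bl Se : Val → PMF Val) (v : Val) : PMF Val :=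
  (N v.hd).bind fun n =>
  (randBits n).bind fun R₁ =>
  (randBits n).bind fun R₂ =>
  (sampleList (simIter C N Pm Ve Bl Se v) (v.tl.hd.arg 2)).bind fun L =>
  finish C K (.node v.hd (.node (.node v.tl.hd (.node R₁ R₂)) L))

theorem isPPT_simulator {C K N Pm Ve Bl Se : Val → PMF Val} (hC : IsPPT C) (hK : IsPPT K)
    (hN : IsPPT N) (hPm : IsPPT Pm) (hVe : IsPPT Ve) (hBl : IsPPT Bl) (hSe : IsPPT Se) :
    IsPPT (simulator C K N Pm Ve Bl Se) := by
  have h₀ := isPPT_simIter hC hN hPm hVe hBl hSe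
  have h₁ := isPPT_finish hC hK
  unfold simulator
  with_reducible repeat' first
    | exact IsPT.id | exact IsPT.nil | apply IsPT.node | apply IsPT.arg | apply IsPT.append
    | apply IsPT.xor | apply IsPT.mulQC | apply IsPT.mulVec | apply IsPT.hd | apply IsPT.tl
    | apply IsPT.flatMap | apply IsPT.map | apply IsPT.rot | apply IsPT.drop | apply IsPT.range
    | exact IsPT.bitsVal | apply IsPPT.pure | apply IsPPT.randBits | apply IsPPT.pick
    | apply IsPPT.ite
    | apply IsPPT.comp hN
    | apply IsPPT.comp h₁
    -- After three binds the original input lies behind three tails of the environment.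
    | apply IsPPT.sampleList (IsPPT.comp h₀ IsPT.id.tl.tl.tl)
    | apply IsPPT.bind

/-! ### Correctness of the programs -/

/-- Programs for the algorithms that the protocol uses. -/
structure Programs (COM : CommitmentScheme) (E : SeedSampler) (Z : Compressor COM) where
  com : PPT
  coinLen : PPT
  compress : PPT
  perm : PPT
  vec : PPT
  block : PPT
  secrets : PPT
  com_eval : ∀ (l : ℕ) (m : List Bool) (ρ : COM.Coins l),
    com.eval (.node (encNat l) (.node (encBits m) (encFixed ρ))) =
      PMF.pure (encBits (COM.commit l m ρ))
  coinLen_eval : ∀ l, coinLen.eval (encNat l) = PMF.pure (encNat (COM.coinLen l))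
  compress_eval : ∀ l P b o,
    compress.eval (.node (encNat l) (.node (encParams P) (.node (encFixed b) (encOpening o)))) =
      PMF.pure (Z.compress l P b o)
  perm_eval : ∀ (l : ℕ) (P : Params) (θ : Seed P),
    perm.eval (.node (encNat l) (.node (encParams P) (encFixed θ))) =
      PMF.pure (encBits (permBits (E.perm l P θ)))
  vec_eval : ∀ (l : ℕ) (P : Params) (θ : Seed P),
    vec.eval (.node (encNat l) (.node (encParams P) (encFixed θ))) =
      PMF.pure (encBits (vecBits₂ (E.vec l P θ)))
  block_eval : ∀ (l : ℕ) (P : Params) (θ : Seed P),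
    block.eval (.node (encNat l) (.node (encParams P) (encFixed θ))) =
      PMF.pure (encBits (vecBits (E.block l P θ)))
  secrets_eval : ∀ (l : ℕ) (P : Params) (θ : Seed P),
    secrets.eval (.node (encNat l) (.node (encParams P) (encFixed θ))) =
      PMF.pure (encSeq (fun x : WeightVec P => encBits (vecBits₂ x.1)) (E.secrets l P θ))

theorem Programs.nonempty (COM : CommitmentScheme) (E : SeedSampler) (Z : Compressor COM) :
    Nonempty (Programs COM E Z) := by
  obtain ⟨C, hC⟩ := COM.commit_polyTime
  obtain ⟨N, hN⟩ := COM.coinLen_polyTime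
  obtain ⟨K, hK⟩ := Z.compress_polyTime
  obtain ⟨Pm, hPm⟩ := E.perm_polyTime
  obtain ⟨Ve, hVe⟩ := E.vec_polyTime
  obtain ⟨Bl, hBl⟩ := E.block_polyTime
  obtain ⟨Se, hSe⟩ := E.secrets_polyTime
  exact ⟨⟨C, N, K, Pm, Ve, Bl, Se, fun l m ρ => hC ⟨l, m, ρ⟩, hN, hK, hPm, hVe, hBl, hSe⟩⟩

/-- The encoding of the first challenge of an iteration. -/
def encChallenge {P : Params} (c : Fin P.s × Fin P.k) : Val :=
  .node (encNat c.1) (encNat c.2)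

section

variable {COM : CommitmentScheme} {E : SeedSampler} {Z : Compressor COM} (Q : Programs COM E Z)
  (l : ℕ) (P : Params)

theorem flatMap_ofFn {n : ℕ} (f : Fin n → Val) (g : Val → Val) (c : Fin n → List Bool)
    (h : ∀ i, g (f i) = encBits (c i)) :
    (ofList (List.ofFn f)).flatMap g = encBits (List.ofFn c).flatten := by
  rw [Val.flatMap, toList_ofList, encBits_eq, List.map_flatten, List.map_ofFn, List.flatMap_def,
    List.map_ofFn]
  congr 3
  funext i
  simp [h]

theorem map_ofFn {α : Type} {n : ℕ} (f : Fin n → Val) (g : Val → Val) (e : α → Val)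
    (c : Fin n → α) (h : ∀ i, g (f i) = e (c i)) :
    (ofList (List.ofFn f)).map g = encSeq e c := by
  rw [Val.map, toList_ofList, encSeq, encList_eq, List.map_ofFn, List.map_ofFn]
  congr 2
  funext i
  exact h i

/-- Given the iterations, the rest of a transcript depends only on public data and the coins `R₁`,
`R₂`, so the same program completes honest and simulated iterations. -/
theorem finish_eq (R₁ R₂ : COM.Coins l) (ch₁ : Challenge₁ P) (ch₂ : Challenge₂ P)
    (c₁ c₂ c₃ : Fin P.δ → List Bool) (d : Fin P.δ → Response COM l P) :
    finish Q.com.eval Q.compress.eval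
      (.node (encNat l) (.node (.node (encParams P) (.node (encFixed R₁) (encFixed R₂)))
        (ofList (List.ofFn fun i => iterVal (encChallenge (ch₁ i)) (encBool (ch₂ i))
          (encBits (c₁ i)) (encBits (c₂ i)) (encBits (c₃ i)) (encResponse (d i)))))) =
    PMF.pure (encTranscript ⟨COM.commit l (List.ofFn fun i => c₁ i ++ c₂ i).flatten R₁, ch₁,
      COM.commit l (List.ofFn c₃).flatten R₂, ch₂, Z.compress l P ch₂ ⟨R₁, R₂, d⟩⟩) := by
  set L := fun i => iterVal (encChallenge (ch₁ i)) (encBool (ch₂ i))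
          (encBits (c₁ i)) (encBits (c₂ i)) (encBits (c₃ i)) (encResponse (d i)) with hL
  have e₁ := flatMap_ofFn L (fun x => (x.arg 2).append (x.arg 3)) (fun i => c₁ i ++ c₂ i)
    fun i => encBits_append _ _
  have e₂ := flatMap_ofFn L (fun x => x.arg 4) c₃ fun i => rfl
  have e₃ := map_ofFn L (fun x => x.arg 0) encChallenge ch₁ fun i => rfl
  have e₄ := map_ofFn L (fun x => x.arg 1) encBool ch₂ fun i => rfl
  have e₅ := map_ofFn L (fun x => x.tl.tl.tl.tl.tl) encResponse d fun i => rfl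
  have h := Q.compress_eval l P ch₂ ⟨R₁, R₂, d⟩
  simp only [encOpening, encFixed] at h
  simp only [finish, Val.hd_node, Val.tl_node, e₁, e₂, e₃, e₄, e₅, Q.com_eval, PMF.pure_bind]
  rw [encFixed, encFixed, h, PMF.pure_bind]
  rfl

theorem drop_encSeq_hd {α : Type} {n : ℕ} (e : α → Val) (f : Fin n → α) (i : Fin n) :
    ((encNat i).drop (encSeq e f)).hd = e (f i) := by
  have key : ∀ (m : ℕ) (L : List Val) (h : m < L.length),
      ((encNat m).drop (ofList L)).hd = L[m] := by
    intro m
    induction m with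
    | zero => intro L h; cases L <;> simp at h; rfl
    | succ m ih =>
      intro L h
      cases L with
      | nil => simp at h
      | cons x L => exact ih L (by simpa using h)
  rw [encSeq, encList_eq, key i _ (by simp)]
  simp

theorem encSeq_hd {α : Type} {n : ℕ} [NeZero n] (e : α → Val) (f : Fin n → α) :
    (encSeq e f).hd = e (f 0) := by
  simpa [encNat, Val.drop, Val.toList] using drop_encSeq_hd e f 0

/-- The encoding of an iteration with second challenge `0`. -/
def encIter₀ (φ : Seed P) (y : Vec P.k) (c : Fin P.s × Fin P.k) (θ : Seed P) (u : Vec₂ P.k)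
    (c₂ : List Bool) (ρ₁ ρ₃ : COM.Coins l) : Val :=
  iterVal (encChallenge c) .nil
    (encBits (COM.commit l (permBits (E.perm l P θ) ++
      vecBits ((qcMatrix (E.block l P φ)).mulVec u + y)) ρ₁)) (encBits c₂)
    (encBits (COM.commit l (vecBits₂ (permute (E.perm l P θ) u)) ρ₃))
    (encResponse (⟨θ, u, c₂, ρ₁, ρ₃⟩ : Response COM l P))

/-- The encoding of an iteration with second challenge `1`. -/
def encIter₁ (c : Fin P.s × Fin P.k) (ξ : Seed P) (x : Vec₂ P.k)
    (c₁ : List Bool) (ρ₂ ρ₃ : COM.Coins l) : Val :=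
  iterVal (encChallenge c) (.node .nil .nil) (encBits c₁)
    (encBits (COM.commit l (vecBits₂ (E.vec l P ξ)) ρ₂))
    (encBits (COM.commit l (vecBits₂ (E.vec l P ξ + x)) ρ₃))
    (encResponse (⟨ξ, x, c₁, ρ₂, ρ₃⟩ : Response COM l P))

theorem iter₀_eq (φ : Seed P) (y : Vec P.k) (c : Fin P.s × Fin P.k) (θ : Seed P) (u : Vec₂ P.k)
    (c₂ : List Bool) (ρ₁ ρ₃ : COM.Coins l) :
    iter₀ Q.com.eval (.node (encNat l) (.node (encChallenge c) (.node (encFixed θ)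
      (.node (encBits (permBits (E.perm l P θ))) (.node (encBits (vecBits (E.block l P φ)))
      (.node (encBits (vecBits y)) (.node (encFixed ρ₁) (.node (encFixed ρ₃) (.node (encBits c₂)
      (.node (encBits (vecBits₂ u)) .nil)))))))))) =
    PMF.pure (encIter₀ (E := E) l P φ y c θ u c₂ ρ₁ ρ₃) := by
  simp only [iter₀, Val.arg, Val.hd_node, Val.tl_node, mulQC_vecBits, xor_vecBits, encBits_append,
    mulVec_permBits, Q.com_eval, PMF.pure_bind]
  rfl

theorem iter₁_eq (c : Fin P.s × Fin P.k) (ξ : Seed P) (x : Vec₂ P.k)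
    (c₁ : List Bool) (ρ₂ ρ₃ : COM.Coins l) :
    iter₁ Q.com.eval (.node (encNat l) (.node (encChallenge c) (.node (encFixed ξ)
      (.node (encBits (vecBits₂ (E.vec l P ξ))) (.node (encFixed ρ₂) (.node (encFixed ρ₃)
      (.node (encBits c₁) (.node (encBits (vecBits₂ x)) .nil)))))))) =
    PMF.pure (encIter₁ (E := E) l P c ξ x c₁ ρ₂ ρ₃) := by
  simp only [iter₁, Val.arg, Val.hd_node, Val.tl_node, xor_vecBits₂, Q.com_eval, PMF.pure_bind]
  rfl

/-- The message that the simulator commits to instead of the permutation. -/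
def dummyPerm (E : SeedSampler) (φ : Seed P) : List Bool :=
  permBits (E.perm l P φ) ++ vecBits (E.block l P φ)

/-- The distribution of a simulated iteration with given challenges. -/
noncomputable def simIterDist (COM : CommitmentScheme) (E : SeedSampler) (pk : PublicKey P)
    (c : Fin P.s × Fin P.k) (b : Bool) : PMF Val :=
  (PMF.uniformOfFintype (Seed P)).bind fun θ =>
  (PMF.uniformOfFintype (Seed P)).bind fun ξ =>
  (PMF.uniformOfFintype (COM.Coins l)).bind fun ρ₁ =>
  (PMF.uniformOfFintype (COM.Coins l)).bind fun ρ₂ =>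
  (PMF.uniformOfFintype (COM.Coins l)).bind fun ρ₃ =>
  PMF.pure (if b then
    encIter₁ (E := E) l P c ξ (permute (E.perm l P θ) (E.secrets l P pk.1 0).1)
      (COM.commit l (dummyPerm l P E pk.1) ρ₁) ρ₂ ρ₃
  else
    encIter₀ (E := E) l P pk.1 (rot c.2 (pk.2 c.1)) c θ (E.vec l P ξ)
      (COM.commit l (vecBits₂ (E.vec l P pk.1)) ρ₂) ρ₁ ρ₃)

/-- The random draws correspond one to one; values computed from the public seed are deterministic
and disappear from the sequence of draws. -/
theorem simIter_eq (pk : PublicKey P) :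
    simIter Q.com.eval Q.coinLen.eval Q.perm.eval Q.vec.eval Q.block.eval Q.secrets.eval
      (.node (encNat l) (.node (encParams P) (encPublicKey pk))) =
    (PMF.uniformOfFintype ((Fin P.s × Fin P.k) × Bool)).bind fun c =>
      simIterDist l P COM E pk c.1 c.2 := by
  have hs := pickElem_range P.s
  have hk := pickElem_range P.k
  have h₁ := iter₁_eq (E := E) Q l P
  have h₀ := iter₀_eq (E := E) Q l P
  simp only [encChallenge] at h₁ h₀
  simp only [simIter, Val.arg, Val.hd_node, Val.tl_node, encParams, encList, hs, hk, pickElem_bitsVal,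
    encPublicKey, uniform_prod, PMF.bind_bind, PMF.bind_map, Function.comp_def]
  refine congrArg _ (funext fun s => congrArg _ (funext fun r => congrArg _ (funext fun b => ?_)))
  have hv := Q.vec_eval l P
  have hp := Q.perm_eval l P
  have hb := Q.block_eval l P
  have hx := Q.secrets_eval l P
  simp only [encParams, encList] at hv hp hb hx
  simp only [randBits_encNat, PMF.bind_map, Function.comp_def, Q.coinLen_eval, PMF.pure_bind,
    simIterDist, hv, hp, hb, hx, isTrue_encBool]
  cases b
  · simp only [Bool.false_eq_true, if_false, drop_encSeq_hd, rot_vecBits, Q.com_eval,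
      PMF.pure_bind]
    exact congrArg _ (funext fun θ => congrArg _ (funext fun ξ => congrArg _ (funext fun ρ₁ =>
      congrArg _ (funext fun ρ₂ => congrArg _ (funext fun ρ₃ => h₀ _ _ (s, r) _ _ _ _ _)))))
  · simp only [if_true, encSeq_hd, mulVec_permBits, encBits_append, Q.com_eval,
      PMF.pure_bind, dummyPerm]
    exact congrArg _ (funext fun θ => congrArg _ (funext fun ξ => congrArg _ (funext fun ρ₁ =>
      congrArg _ (funext fun ρ₂ => congrArg _ (funext fun ρ₃ => h₁ (s, r) _ _ _ _ _)))))

/-- The distribution of an honest iteration with given challenges. -/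
noncomputable def honestIterDist (COM : CommitmentScheme) (E : SeedSampler) (sk : SecretKey P)
    (pk : PublicKey P) (c : Fin P.s × Fin P.k) (b : Bool) : PMF Val :=
  (PMF.uniformOfFintype (Seed P)).bind fun θ =>
  (PMF.uniformOfFintype (Seed P)).bind fun ξ =>
  (PMF.uniformOfFintype (COM.Coins l)).bind fun ρ₁ =>
  (PMF.uniformOfFintype (COM.Coins l)).bind fun ρ₂ =>
  (PMF.uniformOfFintype (COM.Coins l)).bind fun ρ₃ =>
  PMF.pure (if b then
    encIter₁ (E := E) l P c ξ (permute (E.perm l P θ) (rot₂ c.2 (E.secrets l P sk c.1).1))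
      (COM.commit l (permBits (E.perm l P θ) ++ vecBits ((qcMatrix (E.block l P pk.1)).mulVec
        (permute (E.perm l P θ).symm (E.vec l P ξ)))) ρ₁) ρ₂ ρ₃
  else
    encIter₀ (E := E) l P pk.1 (rot c.2 (pk.2 c.1)) c θ
      (permute (E.perm l P θ).symm (E.vec l P ξ) + rot₂ c.2 (E.secrets l P sk c.1).1)
      (COM.commit l (vecBits₂ (E.vec l P ξ)) ρ₂) ρ₁ ρ₃)

/-! ### Algebra of honest iterations and their independence -/

theorem permute_add {k : ℕ} (π : Equiv.Perm (Pos k)) (x y : Vec₂ k) :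
    permute π (x + y) = permute π x + permute π y := rfl

theorem permute_permute_symm {k : ℕ} (π : Equiv.Perm (Pos k)) (x : Vec₂ k) :
    permute π (permute π.symm x) = x := by
  funext i
  simp [permute]

theorem rot_add {k : ℕ} (r : Fin k) (x y : Vec k) : rot r (x + y) = rot r x + rot r y := rfl

/-- The product with a quasi-cyclic matrix commutes with cyclic shifts. -/
theorem qcMatrix_mulVec_rot₂ {k : ℕ} [NeZero k] (a : Vec k) (r : Fin k) (x : Vec₂ k) :
    (qcMatrix a).mulVec (rot₂ r x) = rot r ((qcMatrix a).mulVec x) := by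
  simp only [qcMatrix, Matrix.fromCols_mulVec, Matrix.one_mulVec, rot_add]
  congr 1
  funext i
  simp only [Matrix.mulVec, dotProduct, Matrix.circulant_apply, Function.comp_apply, rot₂,
    Sum.elim_inr, rot]
  -- A circulant entry depends only on the difference of its indices, which a common shift by `r`
  -- leaves unchanged.
  refine Fintype.sum_equiv (Equiv.subRight r) _ _ fun j => ?_
  simp only [Equiv.subRight_apply, sub_sub_sub_cancel_right]

/-- The encoding of an honest iteration with given challenges and seeds. -/
def honestIterVal (COM : CommitmentScheme) (E : SeedSampler) (sk : SecretKey P) (pk : PublicKey P)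
    (c : Fin P.s × Fin P.k) (b : Bool) (θ ξ : Seed P) (ρ₁ ρ₂ ρ₃ : COM.Coins l) : Val :=
  let π := E.perm l P θ
  let v := E.vec l P ξ
  let u := permute π.symm v
  let xr := rot₂ c.2 (E.secrets l P sk c.1).1
  let c₁ := COM.commit l (permBits π ++ vecBits ((qcMatrix (E.block l P pk.1)).mulVec u)) ρ₁
  let c₂ := COM.commit l (vecBits₂ (permute π u)) ρ₂
  let d : Response COM l P :=
    if b = false then ⟨θ, u + xr, c₂, ρ₁, ρ₃⟩ else ⟨ξ, permute π xr, c₁, ρ₂, ρ₃⟩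
  iterVal (encChallenge c) (encBool b) (encBits c₁) (encBits c₂)
    (encBits (COM.commit l (vecBits₂ (permute π (u + xr))) ρ₃)) (encResponse d)

/-- This is the completeness of the protocol: the opened commitments are those that the verifier
recomputes. For bit 0, `H (u + x')` plus the shifted syndrome is `H u`, as the syndrome occurs
twice; for bit 1, `π[u + x'] = v + π[x']`. Honest iterations thereby take the shape `encIter₀`,
`encIter₁` of the simulated ones. -/
theorem honestIterDist_eq (sk : SecretKey P) (pk : PublicKey P)
    (hpk : ∀ i, pk.2 i = (qcMatrix (E.block l P pk.1)).mulVec (E.secrets l P sk i).1)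
    (c : Fin P.s × Fin P.k) (b : Bool) :
    honestIterDist l P COM E sk pk c b =
      (PMF.uniformOfFintype (Seed P)).bind fun θ =>
      (PMF.uniformOfFintype (Seed P)).bind fun ξ =>
      (PMF.uniformOfFintype (COM.Coins l)).bind fun ρ₁ =>
      (PMF.uniformOfFintype (COM.Coins l)).bind fun ρ₂ =>
      (PMF.uniformOfFintype (COM.Coins l)).bind fun ρ₃ =>
      PMF.pure (honestIterVal l P COM E sk pk c b θ ξ ρ₁ ρ₂ ρ₃) := by
  rw [honestIterDist]
  refine pmf_bind_congr fun θ _ => pmf_bind_congr fun ξ _ => pmf_bind_congr fun ρ₁ _ =>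
    pmf_bind_congr fun ρ₂ _ => pmf_bind_congr fun ρ₃ _ => congrArg PMF.pure ?_
  cases b
  · simp only [Bool.false_eq_true, if_false, encIter₀, honestIterVal, if_true,
      permute_permute_symm, Matrix.mulVec_add, qcMatrix_mulVec_rot₂, hpk, add_assoc, encBool]
    have : ∀ y : Vec P.k, y + y = 0 := fun y => funext fun i => CharTwo.add_self_eq_zero (y i)
    rw [this, add_zero]
  · simp only [if_true, encIter₁, honestIterVal, if_false, reduceCtorEq,
      permute_permute_symm, permute_add, encBool]

/-- Honest executions consist of independent iterations. -/
theorem honestTranscript_eq (sk : SecretKey P) (pk : PublicKey P)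
    (hpk : ∀ i, pk.2 i = (qcMatrix (E.block l P pk.1)).mulVec (E.secrets l P sk i).1) :
    (honestTranscript COM E Z l P sk pk).map encTranscript =
      (PMF.uniformOfFintype (COM.Coins l)).bind fun R₁ =>
      (PMF.uniformOfFintype (COM.Coins l)).bind fun R₂ =>
      ((iid ((PMF.uniformOfFintype ((Fin P.s × Fin P.k) × Bool)).bind fun c =>
        honestIterDist l P COM E sk pk c.1 c.2) P.δ).map ofList).bind fun L =>
      finish Q.com.eval Q.compress.eval (.node (encNat l)
        (.node (.node (encParams P) (.node (encFixed R₁) (encFixed R₂))) L)) := by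
  -- All randomness of an iteration is collected in one uniform tuple, so that the list of
  -- iterations becomes the image of a uniform function on `Fin P.δ`.
  have hsample : ((PMF.uniformOfFintype ((Fin P.s × Fin P.k) × Bool)).bind fun c =>
      honestIterDist l P COM E sk pk c.1 c.2) = (PMF.uniformOfFintype
        ((Fin P.s × Fin P.k) × Bool × Seed P × Seed P × COM.Coins l × COM.Coins l ×
        COM.Coins l)).map fun a => honestIterVal l P COM E sk pk a.1 a.2.1 a.2.2.1 a.2.2.2.1
          a.2.2.2.2.1 a.2.2.2.2.2.1 a.2.2.2.2.2.2 := by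
    simp only [honestIterDist_eq l P sk pk hpk, uniform_prod, PMF.map_bind, PMF.map_comp,
      PMF.bind_bind, PMF.bind_map, Function.comp_def]
    rfl
  rw [hsample, iid_map, ← uniform_pi_map_ofFn]
  simp only [PMF.map_comp, PMF.bind_map, uniform_pi_prod _ (Fin P.s × Fin P.k),
    uniform_pi_prod _ Bool, uniform_pi_prod _ (Seed P), uniform_pi_prod _ (COM.Coins l),
    PMF.bind_bind, Function.comp_def, List.map_ofFn, honestIterVal, finish_eq]
  have hb : ∀ {α β : Type} (μ : PMF α) (f : α → PMF β), μ >>= f = μ.bind f := fun _ _ => rfl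
  have hp : ∀ {α : Type} (a : α), (pure a : PMF α) = PMF.pure a := fun _ => rfl
  simp only [honestTranscript, hb, hp, PMF.map_bind,
    PMF.pure_map]
  -- Both sides now draw the same independent variables in different orders; these exchanges bring
  -- them to a common order.
  simp only [
    PMF.bind_comm (.uniformOfFintype (Fin P.δ → Seed P)) (.uniformOfFintype (COM.Coins l)),
    PMF.bind_comm (.uniformOfFintype (Fin P.δ → COM.Coins l)) (.uniformOfFintype (COM.Coins l)),
    PMF.bind_comm (.uniformOfFintype (Challenge₁ P)) (.uniformOfFintype (COM.Coins l)),
    PMF.bind_comm (.uniformOfFintype (Fin P.δ → Seed P)) (.uniformOfFintype (Challenge₁ P)),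
    PMF.bind_comm (.uniformOfFintype (Fin P.δ → COM.Coins l)) (.uniformOfFintype (Challenge₁ P)),
    PMF.bind_comm (.uniformOfFintype (Fin P.δ → Seed P)) (.uniformOfFintype (Challenge₂ P)),
    PMF.bind_comm (.uniformOfFintype (Fin P.δ → COM.Coins l)) (.uniformOfFintype (Challenge₂ P))]

end

/-! ### Sizes -/

theorem size_encFixed_le {n : ℕ} (b : Bits n) : (encFixed b).size ≤ 1 + n * 4 := by
  have := size_encList_le (l := List.ofFn b) fun b _ => size_encBool_le b
  rw [List.length_ofFn] at this
  exact this

theorem PPT.size_le_of_eval_eq (A : PPT) {v w : Val} (h : A.eval v = PMF.pure w) :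
    w.size ≤ A.bound.eval v.size :=
  (A.runs v).size_le (by rw [h]; simp)

/-- Bounds for the sizes of the data that occur in an iteration. -/
structure SizeBound (COM : CommitmentScheme) (par : ℕ → Params) (B : ℕ → ℕ) : Prop where
  poly : PolyBounded B
  iterations : ∀ l, (par l).δ ≤ B l
  params : ∀ l, (encParams (par l)).size ≤ B l
  seed : ∀ l, ∀ θ : Seed (par l), (encFixed θ).size ≤ B l
  coins : ∀ l, ∀ ρ : COM.Coins l, (encFixed ρ).size ≤ B l
  vec : ∀ l, ∀ y : Vec (par l).k, (encBits (vecBits y)).size ≤ B l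
  vec₂ : ∀ l, ∀ x : Vec₂ (par l).k, (encBits (vecBits₂ x)).size ≤ B l
  perm : ∀ l, ∀ π : Equiv.Perm (Pos (par l).k), (encBits (permBits π)).size ≤ B l
  challenge : ∀ l, ∀ c : Fin (par l).s × Fin (par l).k, (encChallenge c).size ≤ B l
  com : ∀ l (m : List Bool) (ρ : COM.Coins l),
    m.length ≤ 2 * (par l).k * (2 * (par l).k) + 2 * (par l).k →
    (encBits (COM.commit l m ρ)).size ≤ B l

theorem exists_sizeBound {setup : Setup} (hsetup : setup.PolyBounded) (COM : CommitmentScheme)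
    {par : ℕ → Params} (hpar : ∀ l, par l ∈ (setup l).support) :
    ∃ B, SizeBound COM par B := by
  obtain ⟨q, hq⟩ := hsetup
  obtain ⟨A, hA⟩ := COM.commit_polyTime
  obtain ⟨N, hN⟩ := COM.coinLen_polyTime
  set K : ℕ → ℕ := fun l => q.eval l with hK
  set n : ℕ → ℕ := fun l => N.bound.eval (2 * l + 1) with hn
  -- `I` dominates the encoded input of the commitment program: at most four units per bit, with
  -- `(2k)²` bits for a permutation. Commitments are then bounded by `A.bound` at `I l`.
  set I : ℕ → ℕ := fun l => 20 + 2 * l + 20 * K l + 16 * (K l * K l) + 4 * n l + 8 * K l with hI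
  have hnl : ∀ l, COM.coinLen l ≤ n l := by
    intro l
    have := N.size_le_of_eval_eq (hN l)
    rw [size_encNat, size_encNat] at this
    simp only [hn]
    omega
  have hKp : PolyBounded K := ⟨q, fun l => le_rfl⟩
  have hnp : PolyBounded n :=
    (((PolyBounded.const 2).mul PolyBounded.id).add (PolyBounded.const 1)).eval N.bound
  have hIp : PolyBounded I :=
    (((((PolyBounded.const 20).add ((PolyBounded.const 2).mul PolyBounded.id)).add
      ((PolyBounded.const 20).mul hKp)).add ((PolyBounded.const 16).mul (hKp.mul hKp))).add
      ((PolyBounded.const 4).mul hnp)).add ((PolyBounded.const 8).mul hKp)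
  have hk : ∀ l, (par l).k ≤ K l := fun l => (hq l _ (hpar l)).1
  have hδ : ∀ l, (par l).δ ≤ K l := fun l => (hq l _ (hpar l)).2.1
  have hs : ∀ l, (par l).s ≤ K l := fun l => (hq l _ (hpar l)).2.2.1
  have hsd : ∀ l, (par l).seedLen ≤ K l := fun l => (hq l _ (hpar l)).2.2.2
  have hkk : ∀ l, (par l).k * (par l).k ≤ K l * K l := fun l => Nat.mul_le_mul (hk l) (hk l)
  refine ⟨fun l => I l + A.bound.eval (I l), hIp.add (hIp.eval A.bound), ?_, ?_, ?_, ?_, ?_, ?_,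
    ?_, ?_, ?_⟩
  all_goals intro l
  all_goals have h₁ := hk l
  all_goals have h₂ := hkk l
  all_goals have h₃ := hnl l
  · have := hδ l; simp only [hI]; omega
  · have := hδ l
    have := hs l
    have := hsd l
    have := (par l).w_le
    simp only [encParams, encList, Val.size, size_encNat, hI]
    omega
  · intro θ
    have := size_encFixed_le θ
    have := hsd l
    simp only [hI]; omega
  · intro ρ
    have := size_encFixed_le ρ
    simp only [hI]; omega
  · intro y
    have := size_encBits_le (vecBits y)
    rw [length_vecBits] at this
    simp only [hI]; omega
  · intro x
    have := size_encBits_le (vecBits₂ x)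
    rw [length_vecBits₂] at this
    simp only [hI]; omega
  · intro π
    have := size_encBits_le (permBits π)
    rw [length_permBits] at this
    simp only [hI]; nlinarith
  · intro c
    have := c.1.2
    have := c.2.2
    have := hs l
    simp only [encChallenge, Val.size, size_encNat, hI]; omega
  · intro m ρ hm
    have := A.size_le_of_eval_eq (hA ⟨l, m, ρ⟩)
    refine (this.trans (polynomial_eval_mono _ ?_)).trans (Nat.le_add_left _ _)
    have h₄ := size_encFixed_le ρ
    have h₅ := size_encBits_le m
    simp only [Val.size, size_encNat, hI]
    nlinarith

/-! ### Distributions of permuted vectors -/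

/-- The map `v ↦ σ[v] + x` is a bijection. With `σ = π⁻¹` and `x = x'` it shows that `u + x'` hides
the secret when `v` is uniform. -/
theorem uniform_bind_affine {β : Type} {k : ℕ} (σ : Equiv.Perm (Pos k)) (x : Vec₂ k)
    (f : Vec₂ k → PMF β) :
    ((PMF.uniformOfFintype (Vec₂ k)).bind fun v => f (permute σ v + x)) =
      (PMF.uniformOfFintype (Vec₂ k)).bind f := by
  conv_rhs => rw [← uniform_map_equiv
    ((σ.arrowCongr (Equiv.refl (ZMod 2))).trans (Equiv.addRight x)), PMF.bind_map]
  rfl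

/-- A binary vector is determined by its support; a bijection between supports of equal size extends
to a permutation of all coordinates. -/
theorem exists_permute_eq {k : ℕ} {x y : Vec₂ k} (h : hammingNorm x = hammingNorm y) :
    ∃ σ : Equiv.Perm (Pos k), permute σ x = y := by
  have hc : Fintype.card {i // x i ≠ 0} = Fintype.card {i // y i ≠ 0} := by
    simpa [hammingNorm, Fintype.card_subtype] using h
  set e := Fintype.equivOfCardEq hc
  refine ⟨e.extendSubtype, funext fun i => ?_⟩
  obtain ⟨j, rfl⟩ := e.extendSubtype.surjective i
  simp only [permute, Equiv.symm_apply_apply]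
  have key : ∀ a b : ZMod 2, (a ≠ 0 ↔ b ≠ 0) → a = b := by decide
  refine key _ _ ⟨fun hj => e.extendSubtype_mem j hj, fun hj => ?_⟩
  by_contra hx
  exact e.extendSubtype_not_mem j (not_not.2 hx) hj

/-- If `y = σ[x]`, then `π[y] = (π σ)[x]`, and right translation by `σ` preserves the uniform
distribution on the group. -/
theorem uniform_perm_bind_permute {β : Type} {k : ℕ} {x y : Vec₂ k}
    (h : hammingNorm x = hammingNorm y) (f : Vec₂ k → PMF β) :
    ((PMF.uniformOfFintype (Equiv.Perm (Pos k))).bind fun π => f (permute π x)) =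
      (PMF.uniformOfFintype (Equiv.Perm (Pos k))).bind fun π => f (permute π y) := by
  obtain ⟨σ, rfl⟩ := exists_permute_eq h
  conv_lhs => rw [← uniform_map_equiv (Equiv.mulRight σ), PMF.bind_map]
  rfl

/-! ### Indistinguishability of the iterations -/

/-- The bit may vary with `l`; the sum of the two advantages covers both cases. -/
theorem CompIndist.bool {X Y : ℕ → Bool → PMF Val}
    (h : ∀ b, CompIndist (fun l => X l b) (fun l => Y l b)) (b : ℕ → Bool) :
    CompIndist (fun l => X l (b l)) (fun l => Y l (b l)) := by
  intro D z hz
  refine Negligible.of_le (Asymptotics.SuperpolynomialDecay.add (h false D z hz) (h true D z hz))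
    (fun _ => abs_nonneg _) fun l => ?_
  rcases hb : b l <;> simp [hb]

section

variable {COM : CommitmentScheme} {E : SeedSampler} {Z : Compressor COM}
  {par : ℕ → Params} {B : ℕ → ℕ}

/-- The coins of the closed commitment occur nowhere else in the iteration, so a reduction can
insert a given commitment and compute the rest from auxiliary input. -/
theorem compIndist_encIter₀_com (Q : Programs COM E Z)
    (hB : SizeBound COM par B) {X Y : ℕ → PMF (List Bool)}
    (h : CompIndist (fun l => (X l).map encBits) (fun l => (Y l).map encBits))
    (φ : ∀ l, Seed (par l)) (y : ∀ l, Vec (par l).k) (c : ∀ l, Fin (par l).s × Fin (par l).k)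
    (θ : ∀ l, Seed (par l)) (u : ∀ l, Vec₂ (par l).k) (ρ₁ ρ₃ : ∀ l, COM.Coins l) :
    CompIndist
      (fun l => (X l).bind fun c₂ =>
        PMF.pure (encIter₀ (E := E) l (par l) (φ l) (y l) (c l) (θ l) (u l) c₂ (ρ₁ l) (ρ₃ l)))
      (fun l => (Y l).bind fun c₂ =>
        PMF.pure (encIter₀ (E := E) l (par l) (φ l) (y l) (c l) (θ l) (u l) c₂ (ρ₁ l) (ρ₃ l))) := by
  have hF : IsPPT fun v => iter₀ Q.com.eval (.node v.hd (.node (v.tl.hd.arg 0)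
      (.node (v.tl.hd.arg 1) (.node (v.tl.hd.arg 2) (.node (v.tl.hd.arg 3) (.node (v.tl.hd.arg 4)
      (.node (v.tl.hd.arg 5) (.node (v.tl.hd.arg 6) (.node v.tl.tl
      (.node (v.tl.hd.arg 7) .nil)))))))))) := by
    refine IsPPT.comp (isPPT_iter₀ Q.com.isPPT) ?_
    with_reducible repeat' first
    | exact IsPT.id | exact IsPT.nil | apply IsPT.node | apply IsPT.arg | apply IsPT.hd
    | apply IsPT.tl
  have := h.process hF (z := fun l => .node (encChallenge (c l)) (.node (encFixed (θ l))
    (.node (encBits (permBits (E.perm l (par l) (θ l))))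
    (.node (encBits (vecBits (E.block l (par l) (φ l)))) (.node (encBits (vecBits (y l)))
    (.node (encFixed (ρ₁ l)) (.node (encFixed (ρ₃ l))
    (.node (encBits (vecBits₂ (u l))) .nil)))))))) ?_
  · simpa only [PMF.bind_map, Function.comp_def, Val.arg, Val.hd_node, Val.tl_node, iter₀_eq]
      using this
  · refine ((PolyBounded.const 8).mul ((PolyBounded.const 2).add hB.poly)).mono fun l => ?_
    have h₁ := hB.challenge l (c l)
    have h₂ := hB.seed l (θ l)
    have h₃ := hB.perm l (E.perm l (par l) (θ l))
    have h₄ := hB.vec l (E.block l (par l) (φ l))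
    have h₅ := hB.vec l (y l)
    have h₆ := hB.coins l (ρ₁ l)
    have h₇ := hB.coins l (ρ₃ l)
    have h₈ := hB.vec₂ l (u l)
    simp only [Val.size]
    omega

/-- The affine map given by `σ` and `x` lets one reduction serve twice: with `π⁻¹` and `x'` for the
honest word, and with the identity and 0 for the simulated one. -/
theorem compIndist_encIter₀_word (Q : Programs COM E Z)
    (hB : SizeBound COM par B) {X Y : ∀ l, PMF (Vec₂ (par l).k)}
    (h : CompIndist (fun l => (X l).map fun v => encBits (vecBits₂ v))
      (fun l => (Y l).map fun v => encBits (vecBits₂ v)))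
    (φ : ∀ l, Seed (par l)) (y : ∀ l, Vec (par l).k) (c : ∀ l, Fin (par l).s × Fin (par l).k)
    (θ : ∀ l, Seed (par l)) (σ : ∀ l, Equiv.Perm (Pos (par l).k)) (x : ∀ l, Vec₂ (par l).k)
    (c₂ : ℕ → List Bool) (hc₂ : ∀ l, (encBits (c₂ l)).size ≤ B l) (ρ₁ ρ₃ : ∀ l, COM.Coins l) :
    CompIndist
      (fun l => (X l).bind fun v => PMF.pure (encIter₀ (E := E) l (par l) (φ l) (y l) (c l) (θ l)
        (permute (σ l) v + x l) (c₂ l) (ρ₁ l) (ρ₃ l)))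
      (fun l => (Y l).bind fun v => PMF.pure (encIter₀ (E := E) l (par l) (φ l) (y l) (c l) (θ l)
        (permute (σ l) v + x l) (c₂ l) (ρ₁ l) (ρ₃ l))) := by
  have hF : IsPPT fun v => iter₀ Q.com.eval (.node v.hd (.node (v.tl.hd.arg 0)
      (.node (v.tl.hd.arg 1) (.node (v.tl.hd.arg 2) (.node (v.tl.hd.arg 3) (.node (v.tl.hd.arg 4)
      (.node (v.tl.hd.arg 5) (.node (v.tl.hd.arg 6) (.node (v.tl.hd.arg 7)
      (.node (((v.tl.hd.arg 8).mulVec v.tl.tl).xor (v.tl.hd.arg 9)) .nil)))))))))) := by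
    refine IsPPT.comp (isPPT_iter₀ Q.com.isPPT) ?_
    with_reducible repeat' first
    | exact IsPT.id | exact IsPT.nil | apply IsPT.node | apply IsPT.arg | apply IsPT.hd
    | apply IsPT.tl | apply IsPT.xor | apply IsPT.mulVec
  have := h.process hF (z := fun l => .node (encChallenge (c l)) (.node (encFixed (θ l))
    (.node (encBits (permBits (E.perm l (par l) (θ l))))
    (.node (encBits (vecBits (E.block l (par l) (φ l)))) (.node (encBits (vecBits (y l)))
    (.node (encFixed (ρ₁ l)) (.node (encFixed (ρ₃ l)) (.node (encBits (c₂ l))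
    (.node (encBits (permBits (σ l))) (.node (encBits (vecBits₂ (x l))) .nil)))))))))) ?_
  · simpa only [PMF.bind_map, Function.comp_def, Val.arg, Val.hd_node, Val.tl_node,
      mulVec_permBits, xor_vecBits₂, iter₀_eq] using this
  · refine ((PolyBounded.const 10).mul ((PolyBounded.const 2).add hB.poly)).mono fun l => ?_
    have h₁ := hB.challenge l (c l)
    have h₂ := hB.seed l (θ l)
    have h₃ := hB.perm l (E.perm l (par l) (θ l))
    have h₄ := hB.vec l (E.block l (par l) (φ l))
    have h₅ := hB.vec l (y l)
    have h₆ := hB.coins l (ρ₁ l)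
    have h₇ := hB.coins l (ρ₃ l)
    have h₈ := hc₂ l
    have h₉ := hB.perm l (σ l)
    have h₁₀ := hB.vec₂ l (x l)
    simp only [Val.size]
    omega

theorem compIndist_encIter₁_com (Q : Programs COM E Z)
    (hB : SizeBound COM par B) {X Y : ℕ → PMF (List Bool)}
    (h : CompIndist (fun l => (X l).map encBits) (fun l => (Y l).map encBits))
    (c : ∀ l, Fin (par l).s × Fin (par l).k) (ξ : ∀ l, Seed (par l))
    (x : ∀ l, Vec₂ (par l).k) (ρ₂ ρ₃ : ∀ l, COM.Coins l) :
    CompIndist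
      (fun l => (X l).bind fun c₁ =>
        PMF.pure (encIter₁ (E := E) l (par l) (c l) (ξ l) (x l) c₁ (ρ₂ l) (ρ₃ l)))
      (fun l => (Y l).bind fun c₁ =>
        PMF.pure (encIter₁ (E := E) l (par l) (c l) (ξ l) (x l) c₁ (ρ₂ l) (ρ₃ l))) := by
  have hF : IsPPT fun v => iter₁ Q.com.eval (.node v.hd (.node (v.tl.hd.arg 0)
      (.node (v.tl.hd.arg 1) (.node (v.tl.hd.arg 2) (.node (v.tl.hd.arg 3) (.node (v.tl.hd.arg 4)
      (.node v.tl.tl (.node (v.tl.hd.arg 5) .nil)))))))) := by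
    refine IsPPT.comp (isPPT_iter₁ Q.com.isPPT) ?_
    with_reducible repeat' first
    | exact IsPT.id | exact IsPT.nil | apply IsPT.node | apply IsPT.arg | apply IsPT.hd
    | apply IsPT.tl
  have := h.process hF (z := fun l => .node (encChallenge (c l)) (.node (encFixed (ξ l))
    (.node (encBits (vecBits₂ (E.vec l (par l) (ξ l)))) (.node (encFixed (ρ₂ l))
    (.node (encFixed (ρ₃ l)) (.node (encBits (vecBits₂ (x l))) .nil)))))) ?_
  · simpa only [PMF.bind_map, Function.comp_def, Val.arg, Val.hd_node, Val.tl_node, iter₁_eq]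
      using this
  · refine ((PolyBounded.const 8).mul ((PolyBounded.const 2).add hB.poly)).mono fun l => ?_
    have h₁ := hB.challenge l (c l)
    have h₂ := hB.seed l (ξ l)
    have h₃ := hB.vec₂ l (E.vec l (par l) (ξ l))
    have h₄ := hB.coins l (ρ₂ l)
    have h₅ := hB.coins l (ρ₃ l)
    have h₆ := hB.vec₂ l (x l)
    simp only [Val.size]
    omega

/-- The permutation may enter only through `π[x]`; therefore `c₁` is a fixed string here, and the
commitment to `π` must have been replaced beforehand. -/
theorem compIndist_encIter₁_perm (Q : Programs COM E Z)
    (hB : SizeBound COM par B) {X Y : ∀ l, PMF (Equiv.Perm (Pos (par l).k))}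
    (h : CompIndist (fun l => (X l).map fun π => encBits (permBits π))
      (fun l => (Y l).map fun π => encBits (permBits π)))
    (c : ∀ l, Fin (par l).s × Fin (par l).k) (ξ : ∀ l, Seed (par l)) (x : ∀ l, Vec₂ (par l).k)
    (c₁ : ℕ → List Bool) (hc₁ : ∀ l, (encBits (c₁ l)).size ≤ B l) (ρ₂ ρ₃ : ∀ l, COM.Coins l) :
    CompIndist
      (fun l => (X l).bind fun π => PMF.pure (encIter₁ (E := E) l (par l) (c l) (ξ l)
        (permute π (x l)) (c₁ l) (ρ₂ l) (ρ₃ l)))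
      (fun l => (Y l).bind fun π => PMF.pure (encIter₁ (E := E) l (par l) (c l) (ξ l)
        (permute π (x l)) (c₁ l) (ρ₂ l) (ρ₃ l))) := by
  have hF : IsPPT fun v => iter₁ Q.com.eval (.node v.hd (.node (v.tl.hd.arg 0)
      (.node (v.tl.hd.arg 1) (.node (v.tl.hd.arg 2) (.node (v.tl.hd.arg 3) (.node (v.tl.hd.arg 4)
      (.node (v.tl.hd.arg 5) (.node (v.tl.tl.mulVec (v.tl.hd.arg 6)) .nil)))))))) := by
    refine IsPPT.comp (isPPT_iter₁ Q.com.isPPT) ?_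
    with_reducible repeat' first
    | exact IsPT.id | exact IsPT.nil | apply IsPT.node | apply IsPT.arg | apply IsPT.hd
    | apply IsPT.tl | apply IsPT.mulVec
  have := h.process hF (z := fun l => .node (encChallenge (c l)) (.node (encFixed (ξ l))
    (.node (encBits (vecBits₂ (E.vec l (par l) (ξ l)))) (.node (encFixed (ρ₂ l))
    (.node (encFixed (ρ₃ l)) (.node (encBits (c₁ l))
    (.node (encBits (vecBits₂ (x l))) .nil))))))) ?_
  · simpa only [PMF.bind_map, Function.comp_def, Val.arg, Val.hd_node, Val.tl_node,
      mulVec_permBits, iter₁_eq] using this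
  · refine ((PolyBounded.const 8).mul ((PolyBounded.const 2).add hB.poly)).mono fun l => ?_
    have h₁ := hB.challenge l (c l)
    have h₂ := hB.seed l (ξ l)
    have h₃ := hB.vec₂ l (E.vec l (par l) (ξ l))
    have h₄ := hB.coins l (ρ₂ l)
    have h₅ := hB.coins l (ρ₃ l)
    have h₆ := hB.vec₂ l (x l)
    have h₇ := hc₁ l
    simp only [Val.size]
    omega

end

/-- Independent draws can be exchanged, so inner ones may be fixed while an outer one, the subject
of the next reduction, stays random. -/
theorem CompIndist.bind_right {α β : ℕ → Type} {W : ∀ l, PMF (α l)} {W' : ∀ l, PMF (β l)}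
    {X Y : ∀ l, α l → β l → PMF Val}
    (h : ∀ w : ∀ l, β l, CompIndist (fun l => (W l).bind fun a => X l a (w l))
      (fun l => (W l).bind fun a => Y l a (w l))) :
    CompIndist (fun l => (W l).bind fun a => (W' l).bind (X l a))
      (fun l => (W l).bind fun a => (W' l).bind (Y l a)) := by
  have e : ∀ (X : ∀ l, α l → β l → PMF Val) l, ((W l).bind fun a => (W' l).bind (X l a)) =
      (W' l).bind fun b => (W l).bind fun a => X l a b := fun X l => PMF.bind_comm _ _ _
  simp only [e]
  exact CompIndist.bind fun w _ => h w

theorem hammingNorm_rot₂ {k : ℕ} (r : Fin k) (x : Vec₂ k) :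
    hammingNorm (rot₂ r x) = hammingNorm x := by
  have : NeZero k := ⟨(Fin.pos r).ne'⟩
  refine Finset.card_equiv ((Equiv.subRight r).sumCongr (Equiv.subRight r)) fun i => ?_
  rw [Finset.mem_filter_univ, Finset.mem_filter_univ]
  cases i <;> rfl

section

variable {COM : CommitmentScheme} {E : SeedSampler} {Z : Compressor COM}
  {par : ℕ → Params} {B : ℕ → ℕ}

theorem SizeBound.length_vecBits₂ (hB : SizeBound COM par B) (x : ∀ l, Vec₂ (par l).k) :
    PolyBounded fun l => (vecBits₂ (x l)).length :=
  hB.poly.mono fun l => (length_le_size_encBits _).trans (hB.vec₂ l (x l))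

theorem CommitmentScheme.Hiding.compIndist_commit (h : COM.Hiding)
    {m₀ m₁ : ℕ → List Bool} (hm : PolyBounded fun l => (m₀ l).length)
    (hl : ∀ l, (m₀ l).length = (m₁ l).length) :
    CompIndist
      (fun l => ((PMF.uniformOfFintype (COM.Coins l)).map (COM.commit l (m₀ l))).map encBits)
      (fun l => ((PMF.uniformOfFintype (COM.Coins l)).map (COM.commit l (m₁ l))).map encBits) := by
  simpa only [PMF.map_comp, Function.comp_def] using h.compIndist hm hl

theorem compIndist_iter₀ (Q : Programs COM E Z) (hB : SizeBound COM par B) (hCOM : COM.Hiding)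
    (hE : CompIndist
      (fun l => (PMF.uniformOfFintype (Seed (par l))).map
        fun ξ => encBits (vecBits₂ (E.vec l (par l) ξ)))
      (fun l => (PMF.uniformOfFintype (Vec₂ (par l).k)).map fun v => encBits (vecBits₂ v)))
    (sk : ∀ l, SecretKey (par l)) (pk : ∀ l, PublicKey (par l))
    (c : ∀ l, Fin (par l).s × Fin (par l).k) :
    CompIndist (fun l => honestIterDist l (par l) COM E (sk l) (pk l) (c l) false)
      (fun l => simIterDist l (par l) COM E (pk l) (c l) false) := by
  have hE' : CompIndist
      (fun l => ((PMF.uniformOfFintype (Seed (par l))).map (E.vec l (par l))).map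
        fun v => encBits (vecBits₂ v))
      (fun l => (PMF.uniformOfFintype (Vec₂ (par l).k)).map fun v => encBits (vecBits₂ v)) := by
    simpa only [PMF.map_comp, Function.comp_def] using hE
  simp only [honestIterDist, simIterDist, Bool.false_eq_true, if_false]
  refine CompIndist.bind fun θ _ => ?_
  -- In the intermediate distribution `c₂` commits to the dummy vector, so `ξ` occurs only in the
  -- revealed word.
  refine CompIndist.trans (Y := fun l =>
    (PMF.uniformOfFintype (Seed (par l))).bind fun ξ =>
    (PMF.uniformOfFintype (COM.Coins l)).bind fun ρ₁ =>
    (PMF.uniformOfFintype (COM.Coins l)).bind fun ρ₂ =>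
    (PMF.uniformOfFintype (COM.Coins l)).bind fun ρ₃ =>
    PMF.pure (encIter₀ (E := E) l (par l) (pk l).1 (rot (c l).2 ((pk l).2 (c l).1)) (c l) (θ l)
      (permute (E.perm l (par l) (θ l)).symm (E.vec l (par l) ξ) +
        rot₂ (c l).2 (E.secrets l (par l) (sk l) (c l).1).1)
      (COM.commit l (vecBits₂ (E.vec l (par l) (pk l).1)) ρ₂) ρ₁ ρ₃)) ?_ ?_
  · refine CompIndist.bind fun ξ _ => CompIndist.bind fun ρ₁ _ => CompIndist.bind_right fun ρ₃ => ?_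
    have := compIndist_encIter₀_com Q hB (hCOM.compIndist_commit
      (hB.length_vecBits₂ fun l => E.vec l (par l) (ξ l))
      (m₁ := fun l => vecBits₂ (E.vec l (par l) (pk l).1)) fun l => by simp [length_vecBits₂])
      (fun l => (pk l).1) (fun l => rot (c l).2 ((pk l).2 (c l).1)) c θ
      (fun l => permute (E.perm l (par l) (θ l)).symm (E.vec l (par l) (ξ l)) +
        rot₂ (c l).2 (E.secrets l (par l) (sk l) (c l).1).1) ρ₁ ρ₃
    simpa only [PMF.bind_map, Function.comp_def] using this
  · refine CompIndist.bind_right fun ρ₁ => CompIndist.bind_right fun ρ₂ =>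
      CompIndist.bind_right fun ρ₃ => ?_
    have h := fun σ x => compIndist_encIter₀_word Q hB hE' (fun l => (pk l).1)
      (fun l => rot (c l).2 ((pk l).2 (c l).1)) c θ σ x
      (fun l => COM.commit l (vecBits₂ (E.vec l (par l) (pk l).1)) (ρ₂ l))
      (fun l => hB.com l _ _ (by rw [length_vecBits₂]; exact Nat.le_add_left _ _)) ρ₁ ρ₃
    -- Both words come from pseudorandom vectors. Each is replaced by its uniform counterpart, and
    -- the two uniform versions agree by `uniform_bind_affine`.
    have h₁ := h (fun l => (E.perm l (par l) (θ l)).symm)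
      (fun l => rot₂ (c l).2 (E.secrets l (par l) (sk l) (c l).1).1)
    have h₂ := h (fun l => 1) (fun l => 0)
    simp only [PMF.bind_map, Function.comp_def] at h₁ h₂
    have e := fun l => uniform_bind_affine (E.perm l (par l) (θ l)).symm
      (rot₂ (c l).2 (E.secrets l (par l) (sk l) (c l).1).1) fun v =>
        PMF.pure (encIter₀ (E := E) l (par l) (pk l).1 (rot (c l).2 ((pk l).2 (c l).1)) (c l)
          (θ l) v (COM.commit l (vecBits₂ (E.vec l (par l) (pk l).1)) (ρ₂ l)) (ρ₁ l) (ρ₃ l))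
    have hp : ∀ l (x : Vec₂ (par l).k), permute 1 x = x := fun l x => rfl
    simp only [e] at h₁
    simp only [hp, add_zero] at h₂
    exact h₁.trans h₂.symm

theorem compIndist_iter₁ (Q : Programs COM E Z) (hB : SizeBound COM par B) (hCOM : COM.Hiding)
    (hE : CompIndist
      (fun l => (PMF.uniformOfFintype (Seed (par l))).map
        fun θ => encBits (permBits (E.perm l (par l) θ)))
      (fun l => (PMF.uniformOfFintype (Equiv.Perm (Pos (par l).k))).map
        fun π => encBits (permBits π)))
    (sk : ∀ l, SecretKey (par l)) (pk : ∀ l, PublicKey (par l))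
    (c : ∀ l, Fin (par l).s × Fin (par l).k) :
    CompIndist (fun l => honestIterDist l (par l) COM E (sk l) (pk l) (c l) true)
      (fun l => simIterDist l (par l) COM E (pk l) (c l) true) := by
  have hE' : CompIndist
      (fun l => ((PMF.uniformOfFintype (Seed (par l))).map (E.perm l (par l))).map
        fun π => encBits (permBits π))
      (fun l => (PMF.uniformOfFintype (Equiv.Perm (Pos (par l).k))).map
        fun π => encBits (permBits π)) := by
    simpa only [PMF.map_comp, Function.comp_def] using hE
  simp only [honestIterDist, simIterDist, if_true]
  -- In the intermediate distribution `c₁` commits to the dummy message, so `θ` occurs only in the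
  -- permuted word.
  refine CompIndist.trans (Y := fun l =>
    (PMF.uniformOfFintype (Seed (par l))).bind fun θ =>
    (PMF.uniformOfFintype (Seed (par l))).bind fun ξ =>
    (PMF.uniformOfFintype (COM.Coins l)).bind fun ρ₁ =>
    (PMF.uniformOfFintype (COM.Coins l)).bind fun ρ₂ =>
    (PMF.uniformOfFintype (COM.Coins l)).bind fun ρ₃ =>
    PMF.pure (encIter₁ (E := E) l (par l) (c l) ξ (permute (E.perm l (par l) θ)
      (rot₂ (c l).2 (E.secrets l (par l) (sk l) (c l).1).1))
      (COM.commit l (dummyPerm l (par l) E (pk l).1) ρ₁) ρ₂ ρ₃)) ?_ ?_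
  · refine CompIndist.bind fun θ _ => CompIndist.bind fun ξ _ => CompIndist.bind_right fun ρ₂ =>
      CompIndist.bind_right fun ρ₃ => ?_
    have := compIndist_encIter₁_com Q hB (hCOM.compIndist_commit
      (m₀ := fun l => permBits (E.perm l (par l) (θ l)) ++
        vecBits ((qcMatrix (E.block l (par l) (pk l).1)).mulVec
          (permute (E.perm l (par l) (θ l)).symm (E.vec l (par l) (ξ l)))))
      (m₁ := fun l => dummyPerm l (par l) E (pk l).1)
      ((hB.poly.add hB.poly).mono fun l => ?_)
      fun l => by simp [dummyPerm, length_vecBits, length_permBits])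
      c ξ (fun l => permute (E.perm l (par l) (θ l))
        (rot₂ (c l).2 (E.secrets l (par l) (sk l) (c l).1).1)) ρ₂ ρ₃
    · simpa only [PMF.bind_map, Function.comp_def] using this
    · rw [List.length_append]
      exact add_le_add ((length_le_size_encBits _).trans (hB.perm l _))
        ((length_le_size_encBits _).trans (hB.vec l _))
  · refine CompIndist.bind_right fun ξ => CompIndist.bind_right fun ρ₁ =>
      CompIndist.bind_right fun ρ₂ => CompIndist.bind_right fun ρ₃ => ?_
    have h := fun x => compIndist_encIter₁_perm Q hB hE' c ξ x
      (fun l => COM.commit l (dummyPerm l (par l) E (pk l).1) (ρ₁ l))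
      (fun l => hB.com l _ _ (by
        rw [dummyPerm, List.length_append, length_vecBits, length_permBits]; omega)) ρ₂ ρ₃
    -- For a uniform permutation only the weight of the permuted vector matters, and the shifted
    -- secret has the same weight as the simulator's vector. Pseudorandomness is used once on each
    -- side.
    have h₁ := h fun l => rot₂ (c l).2 (E.secrets l (par l) (sk l) (c l).1).1
    have h₂ := h fun l => (E.secrets l (par l) (pk l).1 0).1
    simp only [PMF.bind_map, Function.comp_def] at h₁ h₂
    have e := fun l => uniform_perm_bind_permute
      (x := rot₂ (c l).2 (E.secrets l (par l) (sk l) (c l).1).1)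
      (y := (E.secrets l (par l) (pk l).1 0).1)
      ((hammingNorm_rot₂ _ _).trans ((E.secrets l (par l) (sk l) (c l).1).2.trans
        (E.secrets l (par l) (pk l).1 0).2.symm)) fun x =>
        PMF.pure (encIter₁ (E := E) l (par l) (c l) (ξ l) x
          (COM.commit l (dummyPerm l (par l) E (pk l).1) (ρ₁ l)) (ρ₂ l) (ρ₃ l))
    simp only [e] at h₁
    exact h₁.trans h₂.symm

theorem compIndist_iter (Q : Programs COM E Z) (hB : SizeBound COM par B) (hCOM : COM.Hiding)
    {setup : Setup} (hE : E.Pseudorandom setup) (hpar : ∀ l, par l ∈ (setup l).support)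
    (sk : ∀ l, SecretKey (par l)) (pk : ∀ l, PublicKey (par l)) :
    CompIndist
      (fun l => (PMF.uniformOfFintype ((Fin (par l).s × Fin (par l).k) × Bool)).bind fun c =>
        honestIterDist l (par l) COM E (sk l) (pk l) c.1 c.2)
      (fun l => (PMF.uniformOfFintype ((Fin (par l).s × Fin (par l).k) × Bool)).bind fun c =>
        simIterDist l (par l) COM E (pk l) c.1 c.2) := by
  refine CompIndist.bind fun c _ => CompIndist.bool
    (X := fun l b => honestIterDist l (par l) COM E (sk l) (pk l) (c l).1 b)
    (Y := fun l b => simIterDist l (par l) COM E (pk l) (c l).1 b) (fun b => ?_) fun l => (c l).2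
  cases b
  · exact compIndist_iter₀ Q hB hCOM (hE par hpar).2 sk pk fun l => (c l).1
  · exact compIndist_iter₁ Q hB hCOM (hE par hpar).1 sk pk fun l => (c l).1

/-! ### Sizes of iterations and the passage to transcripts -/

theorem SizeBound.size_encIter₀_le (hB : SizeBound COM par B) {l : ℕ} (φ : Seed (par l))
    (y : Vec (par l).k) (c : Fin (par l).s × Fin (par l).k) (θ : Seed (par l))
    (u : Vec₂ (par l).k) {c₂ : List Bool} (hc₂ : (encBits c₂).size ≤ B l) (ρ₁ ρ₃ : COM.Coins l) :
    (encIter₀ (E := E) l (par l) φ y c θ u c₂ ρ₁ ρ₃).size ≤ 20 + 9 * B l := by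
  have h₁ := hB.challenge l c
  have h₂ := hB.seed l θ
  have h₃ := hB.vec₂ l u
  have h₄ := hB.coins l ρ₁
  have h₅ := hB.coins l ρ₃
  have h₆ := hB.com l (permBits (E.perm l (par l) θ) ++
      vecBits ((qcMatrix (E.block l (par l) φ)).mulVec u + y)) ρ₁
    (by rw [List.length_append, length_vecBits, length_permBits]; omega)
  have h₇ := hB.com l (vecBits₂ (permute (E.perm l (par l) θ) u)) ρ₃
    (by rw [QCStern.length_vecBits₂]; exact Nat.le_add_left _ _)
  simp only [encIter₀, iterVal, encResponse, Val.size]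
  omega

theorem SizeBound.size_encIter₁_le (hB : SizeBound COM par B) {l : ℕ}
    (c : Fin (par l).s × Fin (par l).k) (ξ : Seed (par l)) (x : Vec₂ (par l).k)
    {c₁ : List Bool} (hc₁ : (encBits c₁).size ≤ B l) (ρ₂ ρ₃ : COM.Coins l) :
    (encIter₁ (E := E) l (par l) c ξ x c₁ ρ₂ ρ₃).size ≤ 20 + 9 * B l := by
  have h₁ := hB.challenge l c
  have h₂ := hB.seed l ξ
  have h₃ := hB.vec₂ l x
  have h₄ := hB.coins l ρ₂
  have h₅ := hB.coins l ρ₃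
  have h₆ := hB.com l (vecBits₂ (E.vec l (par l) ξ)) ρ₂
    (by rw [QCStern.length_vecBits₂]; exact Nat.le_add_left _ _)
  have h₇ := hB.com l (vecBits₂ (E.vec l (par l) ξ + x)) ρ₃
    (by rw [QCStern.length_vecBits₂]; exact Nat.le_add_left _ _)
  simp only [encIter₁, iterVal, encResponse, Val.size]
  omega

theorem SizeBound.polySized_honestIterDist (hB : SizeBound COM par B)
    (sk : ∀ l, SecretKey (par l)) (pk : ∀ l, PublicKey (par l)) :
    PolySized fun l =>
      (PMF.uniformOfFintype ((Fin (par l).s × Fin (par l).k) × Bool)).bind fun c =>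
        honestIterDist l (par l) COM E (sk l) (pk l) c.1 c.2 := by
  refine ⟨fun l => 20 + 9 * B l, (PolyBounded.const 20).add ((PolyBounded.const 9).mul hB.poly),
    fun l x hx => ?_⟩
  simp only [honestIterDist, PMF.mem_support_bind_iff, PMF.mem_support_pure_iff] at hx
  obtain ⟨⟨c, b⟩, -, θ, -, ξ, -, ρ₁, -, ρ₂, -, ρ₃, -, rfl⟩ := hx
  cases b
  · exact hB.size_encIter₀_le _ _ _ _ _
      (hB.com l _ _ (by rw [QCStern.length_vecBits₂]; exact Nat.le_add_left _ _)) _ _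
  · exact hB.size_encIter₁_le _ _ _ (hB.com l _ _
      (by rw [List.length_append, length_vecBits, length_permBits]; omega)) _ _

theorem SizeBound.polySized_simIterDist (hB : SizeBound COM par B)
    (pk : ∀ l, PublicKey (par l)) :
    PolySized fun l =>
      (PMF.uniformOfFintype ((Fin (par l).s × Fin (par l).k) × Bool)).bind fun c =>
        simIterDist l (par l) COM E (pk l) c.1 c.2 := by
  refine ⟨fun l => 20 + 9 * B l, (PolyBounded.const 20).add ((PolyBounded.const 9).mul hB.poly),
    fun l x hx => ?_⟩
  simp only [simIterDist, PMF.mem_support_bind_iff, PMF.mem_support_pure_iff] at hx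
  obtain ⟨⟨c, b⟩, -, θ, -, ξ, -, ρ₁, -, ρ₂, -, ρ₃, -, rfl⟩ := hx
  cases b
  · exact hB.size_encIter₀_le _ _ _ _ _
      (hB.com l _ _ (by rw [QCStern.length_vecBits₂]; exact Nat.le_add_left _ _)) _ _
  · exact hB.size_encIter₁_le _ _ _ (hB.com l _ _
      (by rw [dummyPerm, List.length_append, length_vecBits, length_permBits]; omega)) _ _

/-- The shape is that of `honestTranscript_eq`: the two transcripts differ only in the distribution
of a single iteration. -/
theorem simulator_eq (Q : Programs COM E Z) (l : ℕ) (P : Params) (pk : PublicKey P) :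
    simulator Q.com.eval Q.compress.eval Q.coinLen.eval Q.perm.eval Q.vec.eval Q.block.eval
      Q.secrets.eval (.node (encNat l) (.node (encParams P) (encPublicKey pk))) =
      (PMF.uniformOfFintype (COM.Coins l)).bind fun R₁ =>
      (PMF.uniformOfFintype (COM.Coins l)).bind fun R₂ =>
      ((iid ((PMF.uniformOfFintype ((Fin P.s × Fin P.k) × Bool)).bind fun c =>
        simIterDist l P COM E pk c.1 c.2) P.δ).map ofList).bind fun L =>
      finish Q.com.eval Q.compress.eval (.node (encNat l)
        (.node (.node (encParams P) (.node (encFixed R₁) (encFixed R₂))) L)) := by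
  have hδ : (encParams P).arg 2 = encNat P.δ := rfl
  rw [simulator]
  simp only [Val.hd_node, Val.tl_node, Q.coinLen_eval, PMF.pure_bind, randBits_encNat,
    PMF.bind_map, Function.comp_def, sampleList_eq, simIter_eq, hδ, toList_encNat,
    List.length_replicate]

/-- The two ensembles of transcripts are obtained in the same way from indistinguishable
iterations. -/
theorem compIndist_transcript (Q : Programs COM E Z) (hB : SizeBound COM par B)
    (hCOM : COM.Hiding) {setup : Setup} (hE : E.Pseudorandom setup)
    (hpar : ∀ l, par l ∈ (setup l).support) (sk : ∀ l, SecretKey (par l))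
    (pk : ∀ l, PublicKey (par l))
    (hpk : ∀ l i, (pk l).2 i =
      (qcMatrix (E.block l (par l) (pk l).1)).mulVec (E.secrets l (par l) (sk l) i).1) :
    CompIndist
      (fun l => (honestTranscript COM E Z l (par l) (sk l) (pk l)).map encTranscript)
      (fun l => simulator Q.com.eval Q.compress.eval Q.coinLen.eval Q.perm.eval Q.vec.eval
        Q.block.eval Q.secrets.eval
        (.node (encNat l) (.node (encParams (par l)) (encPublicKey (pk l))))) := by
  have h := (compIndist_iter Q hB hCOM hE hpar sk pk).iid (hB.polySized_honestIterDist sk pk)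
    (hB.polySized_simIterDist pk) (hB.poly.mono hB.iterations)
  have e := fun l => honestTranscript_eq Q l (par l) (sk l) (pk l) (hpk l)
  simp only [e, simulator_eq]
  -- The coins of the outer commitments are fixed and passed to `finish` with the parameters as
  -- auxiliary input.
  refine CompIndist.bind fun R₁ _ => CompIndist.bind fun R₂ _ =>
    h.process (isPPT_finish Q.com.isPPT Q.compress.isPPT) ?_
  refine ((PolyBounded.const 3).mul ((PolyBounded.const 1).add hB.poly)).mono fun l => ?_
  have h₁ := hB.params l
  have h₂ := hB.coins l (R₁ l)
  have h₃ := hB.coins l (R₂ l)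
  simp only [Val.size]
  omega

/-- The relation between syndromes and secret vectors is the only property of generated keys that
the argument needs; the weight is part of the type of the secrets. -/
theorem eq_of_mem_support_keyGen {l : ℕ} {P : Params} {key : SecretKey P × PublicKey P}
    (h : key ∈ (keyGen E l P).support) (i : Fin P.s) :
    key.2.2 i = (qcMatrix (E.block l P key.2.1)).mulVec (E.secrets l P key.1 i).1 := by
  have hb : ∀ {α β : Type} (μ : PMF α) (f : α → PMF β), μ >>= f = μ.bind f := fun _ _ => rfl
  have hp : ∀ {α : Type} (a : α), (pure a : PMF α) = PMF.pure a := fun _ => rfl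
  simp only [keyGen, hb, hp, PMF.mem_support_bind_iff, PMF.mem_support_pure_iff] at h
  obtain ⟨φ₁, -, φ₂, -, rfl⟩ := h
  rfl

end

end QCStern

theorem theorem4 (setup : QCStern.Setup) (hsetup : setup.PolyBounded)
    (COM : QCStern.CommitmentScheme) (E : QCStern.SeedSampler) (Z : QCStern.Compressor COM)
    (hE : E.Pseudorandom setup) (hCOM : COM.Hiding) :
    QCStern.HonestVerifierZK setup COM E Z := by
  obtain ⟨Q⟩ := QCStern.Programs.nonempty COM E Z
  obtain ⟨S, hS⟩ := (QCStern.isPPT_simulator Q.com.isPPT Q.compress.isPPT Q.coinLen.isPPT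
    Q.perm.isPPT Q.vec.isPPT Q.block.isPPT Q.secrets.isPPT).exists_ppt
  -- The simulator is fixed before parameters and keys; only the size bound and the distinguishers
  -- depend on them.
  refine ⟨S, fun par hpar key hkey => ?_⟩
  obtain ⟨B, hB⟩ := QCStern.exists_sizeBound hsetup COM hpar
  simp only [hS]
  exact QCStern.compIndist_transcript Q hB hCOM hE hpar (fun l => (key l).1) (fun l => (key l).2)
    fun l => QCStern.eq_of_mem_support_keyGen (hkey l)
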